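/- All multigraphs are finite and loopless (multiple edges are allowed); a graph is simple if it has no multiple edges. A multigraph is \emph{subcubic} if its maximum degree is at most three. A \emph{star $k$-edge-coloring} of a multigraph $G$ ($k\ge 1$) is a proper edge-coloring $c:E(G)\to\{1,\dots,k\}$ such that no path or cycle of length four (that is, with four edges) in $G$ is bi-colored, i.e. has all its edges colored from only two colors. The \emph{star chromatic index} $\chi'_s(G)$ is the smallest integer $k\ge 1$ such that $G$ has a star $k$-edge-coloring. The \emph{maximum average degree} $\mathrm{mad}(G)$ is the maximum of $2e(H)/|H|$ over all subgraphs $H$ of $G$ with at least one vertex, where $e(H)$ and $|H|$ denote the numbers of edges and of vertices of $H$ (and $\mathrm{mad}(G)=0$ if $G$ has no vertices). \textbf{Theorem.} Let $G$ be a subcubic multigraph. (a) If $\mathrm{mad}(G)<2$, then $\chi'_s(G)\le 4$. This is tight in both senses: there is a subcubic multigraph $G$ with $\mathrm{mad}(G)<2$ and $\chi'_s(G)=4$, and there is a subcubic simple graph $G$ with $\mathrm{mad}(G)=2$ and $\chi'_s(G)=5$. (b) If $\mathrm{mad}(G)<24/11$, then $\chi'_s(G)\le 5$. (c) If $\mathrm{mad}(G)<5/2$,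 then $\chi'_s(G)\le 6$. -/

import Mathlib

open scoped Graph

namespace StarEdge

variable {α β : Type*}

/-- The degree of `v` in `G`: the number of edges incident with `v`
(the usual degree when `G` has finitely many edges and no loops). -/
noncomputable def degree (G : Graph α β) (v : α) : ℕ := (G.incidenceSet v).ncard

/-- `G` is a subcubic multigraph: a finite loopless multigraph of maximum degree at most three. -/
structure IsSubcubic (G : Graph α β) : Prop where
  finite_vertexSet : V(G).Finite
  finite_edgeSet : E(G).Finite
  loopless : G.Loopless
  degree_le : ∀ v ∈ V(G), degree G v ≤ 3

/-- The maximum average degree of `G`: the maximum of `2 e(H) / |H|` over all subgraphs `H` of `G`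
with at least one vertex. For a finite `G` there are only finitely many such values; the value
for the graph without vertices is `0`. -/
noncomputable def mad (G : Graph α β) : ℝ :=
  sSup {d : ℝ | ∃ H : Graph α β, H ≤ G ∧ V(H).Nonempty ∧
    d = 2 * (E(H).ncard : ℝ) / (V(H).ncard : ℝ)}

/-- The edges `e₁, e₂, e₃, e₄`, in this order, form a path of length four in `G`. -/
def IsPathFour (G : Graph α β) (e₁ e₂ e₃ e₄ : β) : Prop :=
  ∃ v₀ v₁ v₂ v₃ v₄ : α, [v₀, v₁, v₂, v₃, v₄].Nodup ∧
    G.IsLink e₁ v₀ v₁ ∧ G.IsLink e₂ v₁ v₂ ∧ G.IsLink e₃ v₂ v₃ ∧ G.IsLink e₄ v₃ v₄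

/-- The edges `e₁, e₂, e₃, e₄`, in this order, form a cycle of length four in `G`. -/
def IsCycleFour (G : Graph α β) (e₁ e₂ e₃ e₄ : β) : Prop :=
  ∃ v₀ v₁ v₂ v₃ : α, [v₀, v₁, v₂, v₃].Nodup ∧
    G.IsLink e₁ v₀ v₁ ∧ G.IsLink e₂ v₁ v₂ ∧ G.IsLink e₃ v₂ v₃ ∧ G.IsLink e₄ v₃ v₀

/-- A proper edge-coloring: distinct edges with a common end receive distinct colors. -/
def IsProperEdgeColoring {κ : Type*} (G : Graph α β) (c : E(G) → κ) : Prop :=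
  ∀ (e f : E(G)) (v : α), e ≠ f → G.Inc e v → G.Inc f v → c e ≠ c f

/-- A star edge-coloring: a proper edge-coloring in which no path or cycle of length four
is bi-colored, that is, has all its edges colored from two colors. -/
structure IsStarEdgeColoring {κ : Type*} (G : Graph α β) (c : E(G) → κ) : Prop where
  proper : IsProperEdgeColoring G c
  not_bicolored : ∀ e₁ e₂ e₃ e₄ : E(G),
    IsPathFour G e₁ e₂ e₃ e₄ ∨ IsCycleFour G e₁ e₂ e₃ e₄ →
      ¬ ∃ a b : κ, ∀ e ∈ [e₁, e₂, e₃, e₄], c e = a ∨ c e = b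

/-- `G` is star `k`-edge-colorable (`Fin k` serves as the set of `k` colors). -/
def StarEdgeColorable (G : Graph α β) (k : ℕ) : Prop :=
  ∃ c : E(G) → Fin k, IsStarEdgeColoring G c

/-- The star chromatic index: the smallest integer `k ≥ 1` such that `G` is star
`k`-edge-colorable (`⊤` if there is none, which does not happen for finite loopless `G`). -/
noncomputable def starChromaticIndex (G : Graph α β) : ℕ∞ :=
  ⨅ k ∈ {k : ℕ | 1 ≤ k ∧ StarEdgeColorable G k}, (k : ℕ∞)

end StarEdge

open scoped Graph

namespace StarEdge

/-! A path or cycle of length four is determined by its two middle edges `vx` and `vy`. A proper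
coloring is therefore a star edge-coloring exactly when there are no such edges, `x ≠ y`, with the
color of each occurring at the far end of the other. This form, `StarOn`, also makes sense for a set
`F` of edges, and extending a coloring by one edge becomes a local check (`StarOn.insert_edge`). The
bound on the maximum average degree enters only as `2|S| < q|ends S|` for nonempty edge sets `S`
(`IsSubcubic.card_lt_of_mad_lt`).

For five and six colors, take a minimal edge set `F` without a coloring. A pendant edge at a vertex
with at most one non-pendant edge can be colored last. Hence the core of `F`, the edges with no end
of degree one, is nonempty and has all degrees two or three (`core_degree`, `core_nonempty`).
Counting in the core yields a configuration. Below `24/11` it is an edge whose ends have degree two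
and only neighbors of degree two. Below `5/2` it is two adjacent vertices of degree two, or a vertex
of degree three with only neighbors of degree two. Each configuration is reducible: some edges,
including the pendant edges that are in the way, are removed, the rest is colored by minimality, and
the removed edges are colored again (`exists_starOn_of_thread`, `exists_starOn_of_adjacent_two`,
`exists_starOn_of_three_two`). A color may often be repeated at distance one on pendant edges,
because a bicolored path ends there.

For forests and four colors the induction needs a stronger statement. At a vertex `p`, draw an arc
from `e` to `f` if the color of `f` occurs at the other end of `e`. A star coloring has no two
opposite arcs; `CyclicOn` also asks for in- and outdegree at most one. Then a pendant edge at a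
vertex with at most one core edge can always be added (`exists_cyclicOn_of_pendant`).

For tightness, three colors fail on the binary tree with seven vertices, and four fail on the
five-cycle with a pendant edge at every vertex. The matching upper bounds are parts (a) and (b). -/

open Classical in
/-- The edges of `F` incident with `v`. -/
noncomputable def inc {α β : Type*} (G : Graph α β) (F : Finset β) (v : α) : Finset β :=
  F.filter (fun e => G.Inc e v)

/-- The colors of the edges of `F` incident with `v`. -/
noncomputable def colors {α β : Type*} {k : ℕ} (G : Graph α β) (F : Finset β) (c : β → Fin k)
    (v : α) : Finset (Fin k) :=
  (inc G F v).image c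

/-- The restriction of `c` to `F` is a star edge-coloring. A bicolored path or cycle of length
four is described by its two middle edges. -/
structure StarOn {α β : Type*} {k : ℕ} (G : Graph α β) (F : Finset β) (c : β → Fin k) : Prop where
  proper : ∀ e ∈ F, ∀ f ∈ F, ∀ v, e ≠ f → G.Inc e v → G.Inc f v → c e ≠ c f
  not_swap : ∀ e ∈ F, ∀ f ∈ F, ∀ v x y, G.IsLink e v x → G.IsLink f v y → x ≠ y →
    ¬ (c f ∈ colors G F c x ∧ c e ∈ colors G F c y)

/-! ### Partial star colorings and their extension by one edge -/

section

variable {α β : Type*} {k : ℕ} {G : Graph α β} {F H : Finset β} {c c' : β → Fin k}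

lemma mem_inc {e : β} {v : α} : e ∈ inc G F v ↔ e ∈ F ∧ G.Inc e v := by
  simp [inc]

lemma mem_colors {a : Fin k} {v : α} : a ∈ colors G F c v ↔ ∃ e ∈ F, G.Inc e v ∧ c e = a := by
  simp [colors, mem_inc, and_assoc]

lemma inc_mono (h : H ⊆ F) (v : α) : inc G H v ⊆ inc G F v := fun e he => by
  rw [mem_inc] at he ⊢; exact ⟨h he.1, he.2⟩

lemma colors_mono (h : H ⊆ F) (v : α) : colors G H c v ⊆ colors G F c v :=
  Finset.image_subset_image (inc_mono h v)

lemma card_colors_le (v : α) : (colors G F c v).card ≤ (inc G F v).card := Finset.card_image_le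

lemma colors_congr (h : ∀ e ∈ F, c' e = c e) (v : α) : colors G F c' v = colors G F c v :=
  Finset.image_congr fun e he => h e (mem_inc.1 (by simpa using he)).1

lemma StarOn.congr (hs : StarOn G F c) (h : ∀ e ∈ F, c' e = c e) : StarOn G F c' := by
  refine ⟨fun e he f hf v => ?_, fun e he f hf v x y => ?_⟩
  · rw [h e he, h f hf]; exact hs.proper e he f hf v
  · rw [h e he, h f hf, colors_congr h, colors_congr h]; exact hs.not_swap e he f hf v x y

lemma StarOn.mono (hs : StarOn G F c) (h : H ⊆ F) : StarOn G H c :=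
  ⟨fun e he f hf => hs.proper e (h he) f (h hf), fun e he f hf v x y h1 h2 h3 h4 =>
    hs.not_swap e (h he) f (h hf) v x y h1 h2 h3 ⟨colors_mono h _ h4.1, colors_mono h _ h4.2⟩⟩

lemma starOn_empty (c : β → Fin k) : StarOn G ∅ c :=
  ⟨by simp, by simp⟩

open Classical in
/-- Adding one edge `m` joining `u` and `v` to a partial star edge-coloring. -/
lemma StarOn.insert_edge (hG : G.Loopless) (hs : StarOn G H c) {m : β} {u v : α}
    (hm : G.IsLink m u v) (hmH : m ∉ H)
    (hu : c m ∉ colors G H c u) (hv : c m ∉ colors G H c v)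
    (hu' : ∀ f ∈ H, ∀ w, G.IsLink f u w → c m ∉ colors G H c w ∨
      (c f ∉ colors G H c v ∧ ∀ h ∈ H, ∀ x, G.IsLink h w x → c h = c m → c f ∉ colors G H c x))
    (hv' : ∀ f ∈ H, ∀ w, G.IsLink f v w → c m ∉ colors G H c w ∨
      (c f ∉ colors G H c u ∧ ∀ h ∈ H, ∀ x, G.IsLink h w x → c h = c m → c f ∉ colors G H c x)) :
    StarOn G (insert m H) c := by
  have huv : u ≠ v := hm.ne
  have hcol : ∀ x a, a ∈ colors G (insert m H) c x ↔
      (a = c m ∧ (x = u ∨ x = v)) ∨ a ∈ colors G H c x := by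
    intro x a
    simp only [mem_colors, Finset.mem_insert]
    constructor
    · rintro ⟨e, rfl | he, hx, rfl⟩
      · exact .inl ⟨rfl, hx.eq_or_eq_of_isLink hm⟩
      · exact .inr ⟨e, he, hx, rfl⟩
    · rintro (⟨rfl, rfl | rfl⟩ | ⟨e, he, hx, rfl⟩)
      · exact ⟨m, .inl rfl, hm.inc_left, rfl⟩
      · exact ⟨m, .inl rfl, hm.inc_right, rfl⟩
      · exact ⟨e, .inr he, hx, rfl⟩
  have key : ∀ f ∈ H, ∀ x, G.Inc f x → c f ∈ colors G H c x := fun f hf x hx =>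
    mem_colors.2 ⟨f, hf, hx, rfl⟩
  -- Bicolored paths and cycles in which the new edge is one of the two middle edges.
  have pairm : ∀ f ∈ H, ∀ p x y, G.IsLink m p x → G.IsLink f p y → x ≠ y →
      ¬ (c f ∈ colors G (insert m H) c x ∧ c m ∈ colors G (insert m H) c y) := by
    rintro f hf p x y h1 h2 hxy ⟨h3, h4⟩
    rw [hcol] at h3 h4
    have hfp := key f hf p h2.inc_left
    rcases hm.eq_and_eq_or_eq_and_eq h1 with ⟨rfl, rfl⟩ | ⟨rfl, rfl⟩
    · have := hu' f hf y h2
      have h5 : y ≠ u := h2.ne.symm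
      grind
    · have := hv' f hf y h2
      have h5 : y ≠ v := h2.ne.symm
      grind
  -- Those in which the new edge is an end edge: the far end `x` of the middle edge `e` is then an
  -- end of `m`, and the other middle edge has the color of `m`.
  have pairo : ∀ e ∈ H, ∀ f ∈ H, ∀ p x y, G.IsLink e p x → G.IsLink f p y → x ≠ y →
      c f = c m → (x = u ∨ x = v) → ¬ c e ∈ colors G (insert m H) c y := by
    intro e he f hf p x y h1 h2 hxy h3 hx h4
    rw [hcol] at h4
    have hfp := key f hf p h2.inc_left
    have hey := key f hf y h2.inc_right
    have hex := key e he x h1.inc_right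
    rcases hx with rfl | rfl
    · have := hu' e he p h1.symm
      have h5 := this.resolve_left (by rw [← h3]; simpa using hfp)
      have := h5.2 f hf y h2 h3
      grind
    · have := hv' e he p h1.symm
      have h5 := this.resolve_left (by rw [← h3]; simpa using hfp)
      have := h5.2 f hf y h2 h3
      grind
  refine ⟨fun e he f hf p hef h1 h2 => ?_, fun e he f hf p x y h1 h2 hxy h3 => ?_⟩
  · rw [Finset.mem_insert] at he hf
    rcases he with rfl | he
    · rcases hf with rfl | hf
      · exact absurd rfl hef
      · intro h
        rcases h1.eq_or_eq_of_isLink hm with rfl | rfl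
        · exact hu (h ▸ key f hf _ h2)
        · exact hv (h ▸ key f hf _ h2)
    · rcases hf with rfl | hf
      · intro h
        rcases h2.eq_or_eq_of_isLink hm with rfl | rfl
        · exact hu (h ▸ key e he _ h1)
        · exact hv (h ▸ key e he _ h1)
      · exact hs.proper e he f hf p hef h1 h2
  · rw [Finset.mem_insert] at he hf
    rcases he with rfl | he
    · rcases hf with rfl | hf
      · exact hxy (h1.right_unique h2)
      · exact pairm f hf p x y h1 h2 hxy h3
    · rcases hf with rfl | hf
      · exact pairm e he p y x h2 h1 hxy.symm h3.symm
      · obtain ⟨h3, h4⟩ := h3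
        rcases (hcol _ _).1 h3 with ⟨h5, h6⟩ | h5
        · exact pairo e he f hf p x y h1 h2 hxy h5 h6 h4
        rcases (hcol _ _).1 h4 with ⟨h7, h8⟩ | h7
        · exact pairo f hf e he p y x h2 h1 hxy.symm h7 h8 h3
        · exact hs.not_swap e he f hf p x y h1 h2 hxy ⟨h5, h7⟩

open Classical in
/-- Adding an edge whose color does not occur at distance at most one. -/
lemma StarOn.insert_edge_of_far (hG : G.Loopless) (hs : StarOn G H c) {m : β} {u v : α}
    (hm : G.IsLink m u v) (hmH : m ∉ H)
    (hu : c m ∉ colors G H c u) (hv : c m ∉ colors G H c v)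
    (hu' : ∀ f ∈ H, ∀ w, G.IsLink f u w → c m ∉ colors G H c w)
    (hv' : ∀ f ∈ H, ∀ w, G.IsLink f v w → c m ∉ colors G H c w) :
    StarOn G (insert m H) c :=
  hs.insert_edge hG hm hmH hu hv (fun f hf w hw => .inl (hu' f hf w hw))
    (fun f hf w hw => .inl (hv' f hf w hw))

end

/-! ### Degree counting in sparse edge sets -/

open Classical in
/-- The ends of the edges of `S`. -/
noncomputable def ends {α β : Type*} (G : Graph α β) (S : Finset β) : Finset α :=
  S.biUnion fun e => if h : ∃ p : α × α, G.IsLink e p.1 p.2 then {h.choose.1, h.choose.2} else ∅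

section

variable {α β : Type*} {G : Graph α β} {S : Finset β}

lemma mem_ends {v : α} : v ∈ ends G S ↔ ∃ e ∈ S, G.Inc e v := by
  simp only [ends, Finset.mem_biUnion]
  refine exists_congr fun e => and_congr_right fun _ => ?_
  split_ifs with h
  · have hl := h.choose_spec
    simp only [Finset.mem_insert, Finset.mem_singleton]
    exact ⟨by rintro (rfl | rfl); exacts [hl.inc_left, hl.inc_right],
      fun hv => hv.eq_or_eq_of_isLink hl⟩
  · simp only [Finset.notMem_empty, false_iff]
    rintro ⟨w, hw⟩
    exact h ⟨(v, w), hw⟩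

lemma sum_card_inc (hG : G.Loopless) (hS : ∀ e ∈ S, e ∈ E(G)) :
    ∑ v ∈ ends G S, (inc G S v).card = 2 * S.card := by
  classical
  have h := Finset.sum_card_bipartiteAbove_eq_sum_card_bipartiteBelow
    (s := ends G S) (t := S) (fun v e => G.Inc e v)
  have h1 : ∀ v, (S.bipartiteAbove (fun v e => G.Inc e v) v) = inc G S v := by
    intro v; ext e; simp [Finset.mem_bipartiteAbove, mem_inc]
  have h2 : ∀ e ∈ S, ((ends G S).bipartiteBelow (fun v e => G.Inc e v) e).card = 2 := by
    intro e he
    obtain ⟨x, y, hl⟩ := G.exists_isLink_of_mem_edgeSet (hS e he)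
    rw [Finset.card_eq_two]
    refine ⟨x, y, hl.ne, ?_⟩
    ext v
    simp only [Finset.mem_bipartiteBelow, Finset.mem_insert, Finset.mem_singleton]
    constructor
    · exact fun h => h.2.eq_or_eq_of_isLink hl
    · rintro (rfl | rfl)
      · exact ⟨mem_ends.2 ⟨e, he, hl.inc_left⟩, hl.inc_left⟩
      · exact ⟨mem_ends.2 ⟨e, he, hl.inc_right⟩, hl.inc_right⟩
  simp only [h1] at h
  rw [h, Finset.sum_congr rfl h2]
  simp [mul_comm]

/-- A sparse edge set has an end of degree at most one. -/
lemma exists_card_inc_le_one (hG : G.Loopless) (hS : ∀ e ∈ S, e ∈ E(G))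
    (hlt : S.card < (ends G S).card) : ∃ v ∈ ends G S, (inc G S v).card ≤ 1 := by
  by_contra! h
  have h1 := Finset.card_nsmul_le_sum (ends G S) (fun v => (inc G S v).card) 2 (fun v hv => h v hv)
  rw [sum_card_inc hG hS, smul_eq_mul] at h1
  omega

/-- These two linear equations let a bound on the average degree be compared with counts of vertices
of degree two and three. -/
lemma card_ends_of_two_or_three (hG : G.Loopless) (hS : ∀ e ∈ S, e ∈ E(G))
    (hdeg : ∀ v ∈ ends G S, (inc G S v).card = 2 ∨ (inc G S v).card = 3) :
    ((ends G S).filter fun v => (inc G S v).card = 2).card +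
      ((ends G S).filter fun v => (inc G S v).card = 3).card = (ends G S).card ∧
    2 * ((ends G S).filter fun v => (inc G S v).card = 2).card +
      3 * ((ends G S).filter fun v => (inc G S v).card = 3).card = 2 * S.card := by
  have h3 : (ends G S).filter (fun v => (inc G S v).card = 3) =
      (ends G S).filter (fun v => ¬ (inc G S v).card = 2) := by
    refine Finset.filter_congr fun v hv => ?_
    have := hdeg v hv
    omega
  have hsum := sum_card_inc hG hS
  rw [← Finset.sum_filter_add_sum_filter_not _ (fun v => (inc G S v).card = 2), ← h3,
    Finset.sum_congr rfl (fun v hv => (Finset.mem_filter.1 hv).2),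
    Finset.sum_congr (g := fun _ => 3) rfl (fun v hv => (Finset.mem_filter.1 hv).2)] at hsum
  simp only [Finset.sum_const, smul_eq_mul] at hsum
  refine ⟨?_, by omega⟩
  rw [h3]
  exact Finset.card_filter_add_card_filter_not _

/-- In an edge set of average degree less than `5/2` with all degrees two or three, there are two
adjacent vertices of degree two, or a vertex of degree three with neighbors of degree two only. -/
lemma exists_of_average_lt_five_halves (hG : G.Loopless) (hS : ∀ e ∈ S, e ∈ E(G))
    (hdeg : ∀ v ∈ ends G S, (inc G S v).card = 2 ∨ (inc G S v).card = 3)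
    (hlt : 4 * S.card < 5 * (ends G S).card) :
    (∃ e ∈ S, ∃ u v, G.IsLink e u v ∧ (inc G S u).card = 2 ∧ (inc G S v).card = 2) ∨
    (∃ v, (inc G S v).card = 3 ∧ ∀ e ∈ S, ∀ u, G.IsLink e v u → (inc G S u).card = 2) := by
  classical
  by_contra! hcon
  obtain ⟨hadj, hthree⟩ := hcon
  obtain ⟨hc1, hc2⟩ := card_ends_of_two_or_three hG hS hdeg
  set V2 := (ends G S).filter fun v => (inc G S v).card = 2
  set V3 := (ends G S).filter fun v => (inc G S v).card = 3
  set M := S.filter fun e => ∃ u, G.Inc e u ∧ (inc G S u).card = 2 with hM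
  -- No edge of `M` is counted twice, since vertices of degree two are not adjacent.
  have h1 : V2.card * 2 ≤ M.card * 1 := by
    refine Finset.card_mul_le_card_mul (fun v e => G.Inc e v) (fun u hu => ?_) fun e he => ?_
    · obtain ⟨hu1, hu2⟩ := Finset.mem_filter.1 hu
      rw [← hu2]
      refine Finset.card_le_card fun e he => ?_
      obtain ⟨he1, he2⟩ := mem_inc.1 he
      exact (Finset.mem_bipartiteAbove _).2 ⟨Finset.mem_filter.2 ⟨he1, u, he2, hu2⟩, he2⟩
    · refine Finset.card_le_one.2 fun a ha b hb => ?_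
      obtain ⟨ha1, ha2⟩ := (Finset.mem_bipartiteBelow _).1 ha
      obtain ⟨hb1, hb2⟩ := (Finset.mem_bipartiteBelow _).1 hb
      obtain ⟨x, hx⟩ := ha2
      rcases hb2.eq_or_eq_of_isLink hx with rfl | rfl
      · rfl
      · exact absurd (Finset.mem_filter.1 hb1).2
          (hadj e (Finset.mem_filter.1 he).1 a b hx (Finset.mem_filter.1 ha1).2)
  -- A vertex of degree three has an edge to a neighbor not of degree two. That edge is outside `M`,
  -- which leaves at most two.
  have h2 : M.card * 1 ≤ V3.card * 2 := by
    refine Finset.card_mul_le_card_mul (fun e v => G.Inc e v) (fun e he => ?_) fun v hv => ?_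
    · obtain ⟨he1, u, ⟨v, hv⟩, hu2⟩ := Finset.mem_filter.1 he
      have hvE : v ∈ ends G S := mem_ends.2 ⟨e, he1, hv.inc_right⟩
      rw [Nat.succ_le_iff, Finset.card_pos]
      exact ⟨v, (Finset.mem_bipartiteAbove _).2 ⟨Finset.mem_filter.2 ⟨hvE,
        (hdeg v hvE).resolve_left (hadj e he1 u v hv hu2)⟩, hv.inc_right⟩⟩
    · obtain ⟨hv1, hv2⟩ := Finset.mem_filter.1 hv
      obtain ⟨e, he, u, hl, hne⟩ := hthree v hv2
      have hsub : M.bipartiteBelow (fun e v => G.Inc e v) v ⊆ (inc G S v).erase e := by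
        intro f hf
        obtain ⟨hf1, hf2⟩ := (Finset.mem_bipartiteBelow _).1 hf
        refine Finset.mem_erase.2 ⟨?_, mem_inc.2 ⟨(Finset.mem_filter.1 hf1).1, hf2⟩⟩
        rintro rfl
        obtain ⟨x, hx, hx2⟩ := (Finset.mem_filter.1 hf1).2
        rcases hx.eq_or_eq_of_isLink hl with rfl | rfl
        · omega
        · exact hne hx2
      have := Finset.card_le_card hsub
      rw [Finset.card_erase_of_mem (mem_inc.2 ⟨he, hl.inc_left⟩), hv2] at this
      exact this
  -- Now `|V2| ≤ |V3|`, so `4|S| = 4|V2| + 6|V3| ≥ 5(|V2| + |V3|)`.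
  omega

/-- In an edge set of average degree less than `24/11` with all degrees two or three, there are two
adjacent vertices of degree two with neighbors of degree two only. -/
lemma exists_of_average_lt_twentyfour_elevenths (hG : G.Loopless) (hS : ∀ e ∈ S, e ∈ E(G))
    (hdeg : ∀ v ∈ ends G S, (inc G S v).card = 2 ∨ (inc G S v).card = 3)
    (hlt : 11 * S.card < 12 * (ends G S).card) :
    ∃ e ∈ S, ∃ u v, G.IsLink e u v ∧ (inc G S u).card = 2 ∧ (inc G S v).card = 2 ∧
      (∀ f ∈ S, ∀ x, G.IsLink f u x → (inc G S x).card = 2) ∧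
      (∀ f ∈ S, ∀ x, G.IsLink f v x → (inc G S x).card = 2) := by
  classical
  by_contra! hcon
  obtain ⟨hc1, hc2⟩ := card_ends_of_two_or_three hG hS hdeg
  set V2 := (ends G S).filter fun v => (inc G S v).card = 2 with hV2
  set V3 := (ends G S).filter fun v => (inc G S v).card = 3 with hV3
  set A := V2.filter fun u => ∀ f ∈ S, ∀ x, G.IsLink f u x → (inc G S x).card = 2 with hA
  set M := S.filter fun e => ∃ u v, G.IsLink e u v ∧ u ∈ V2 ∧ v ∈ V3 with hM
  set N := S.filter fun e => ∃ u, G.Inc e u ∧ u ∈ A with hN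
  set B := V2.filter fun u => (inc G M u).card = 1 with hB
  have hV : ∀ v, v ∈ V2 → v ∈ V3 → False := by
    intro v h2 h3
    have := (Finset.mem_filter.1 h2).2
    have := (Finset.mem_filter.1 h3).2
    omega
  have hV' : ∀ e ∈ S, ∀ v, G.Inc e v → v ∈ V2 ∨ v ∈ V3 := by
    intro e he v hv
    have hvE : v ∈ ends G S := mem_ends.2 ⟨e, he, hv⟩
    rcases hdeg v hvE with h | h
    · exact .inl (Finset.mem_filter.2 ⟨hvE, h⟩)
    · exact .inr (Finset.mem_filter.2 ⟨hvE, h⟩)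
  have hMS : M ⊆ S := Finset.filter_subset _ _
  have hMN : ∀ e ∈ M, e ∉ N := by
    intro e he heN
    obtain ⟨he1, u, v, hl, hu, hv⟩ := Finset.mem_filter.1 he
    obtain ⟨_, x, hx, hxA⟩ := Finset.mem_filter.1 heN
    obtain ⟨hx2, hxN⟩ := Finset.mem_filter.1 hxA
    rcases hx.eq_or_eq_of_isLink hl with rfl | rfl
    · have := hxN e he1 v hl
      have := (Finset.mem_filter.1 hv).2
      omega
    · exact hV _ hx2 hv
  -- the edges between vertices of degree two and three
  have h1 : ∑ u ∈ V2, (inc G M u).card ≤ 3 * V3.card := by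
    have hs := Finset.sum_card_bipartiteAbove_eq_sum_card_bipartiteBelow
      (s := V2) (t := M) (fun v e => G.Inc e v)
    have e1 : ∀ v, (M.bipartiteAbove (fun v e => G.Inc e v) v) = inc G M v := by
      intro v; ext e; simp [Finset.mem_bipartiteAbove, mem_inc]
    simp only [e1] at hs
    have h2 : ∑ b ∈ M, (V2.bipartiteBelow (fun v e => G.Inc e v) b).card ≤ M.card * 1 := by
      refine Finset.sum_le_card_nsmul _ _ 1 fun e he => ?_
      obtain ⟨he1, u, v, hl, hu, hv⟩ := Finset.mem_filter.1 he
      refine Finset.card_le_one.2 fun a ha b hb => ?_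
      obtain ⟨ha1, ha2⟩ := (Finset.mem_bipartiteBelow _).1 ha
      obtain ⟨hb1, hb2⟩ := (Finset.mem_bipartiteBelow _).1 hb
      have := hV v
      rcases ha2.eq_or_eq_of_isLink hl with rfl | rfl <;>
        rcases hb2.eq_or_eq_of_isLink hl with rfl | rfl <;> tauto
    have h3 : M.card * 1 ≤ V3.card * 3 := by
      refine Finset.card_mul_le_card_mul (fun e v => G.Inc e v) (fun e he => ?_) fun v hv => ?_
      · obtain ⟨he1, u, v, hl, hu, hv⟩ := Finset.mem_filter.1 he
        rw [Nat.succ_le_iff, Finset.card_pos]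
        exact ⟨v, (Finset.mem_bipartiteAbove _).2 ⟨hv, hl.inc_right⟩⟩
      · rw [← (Finset.mem_filter.1 hv).2]
        refine Finset.card_le_card fun e he => ?_
        obtain ⟨h3, h4⟩ := (Finset.mem_bipartiteBelow _).1 he
        exact mem_inc.2 ⟨hMS h3, h4⟩
    omega
  -- An edge with both ends in `A` would be the desired configuration, so the edges of `N` are
  -- counted once.
  have h2 : A.card * 2 ≤ N.card * 1 := by
    refine Finset.card_mul_le_card_mul (fun v e => G.Inc e v) (fun u hu => ?_) fun e he => ?_
    · obtain ⟨hu1, hu2⟩ := Finset.mem_filter.1 hu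
      rw [← (Finset.mem_filter.1 hu1).2]
      refine Finset.card_le_card fun e he => ?_
      obtain ⟨he1, he2⟩ := mem_inc.1 he
      exact (Finset.mem_bipartiteAbove _).2 ⟨Finset.mem_filter.2 ⟨he1, u, he2, hu⟩, he2⟩
    · refine Finset.card_le_one.2 fun a ha b hb => ?_
      obtain ⟨ha1, ha2⟩ := (Finset.mem_bipartiteBelow _).1 ha
      obtain ⟨hb1, hb2⟩ := (Finset.mem_bipartiteBelow _).1 hb
      obtain ⟨x, hx⟩ := ha2
      rcases hb2.eq_or_eq_of_isLink hx with rfl | rfl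
      · rfl
      · obtain ⟨ha1, ha2⟩ := Finset.mem_filter.1 ha1
        obtain ⟨hb1, hb2⟩ := Finset.mem_filter.1 hb1
        obtain ⟨f, hf, y, hy, hne⟩ := hcon e (Finset.mem_filter.1 he).1 a b hx
          (Finset.mem_filter.1 ha1).2 (Finset.mem_filter.1 hb1).2 ha2
        exact absurd (hb2 f hf y hy) hne
  have hinc : ∀ u ∈ V2, (inc G S u).card = 2 := fun u hu => (Finset.mem_filter.1 hu).2
  -- An edge of `N` leads from `A` to a vertex `v` of degree two that also has a neighbor of degree
  -- three. So `v` lies in `B`, and its other edge belongs to `M`, not to `N`.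
  have h3 : N.card * 1 ≤ B.card * 1 := by
    refine Finset.card_mul_le_card_mul (fun e v => G.Inc e v) (fun e he => ?_) fun v hv => ?_
    · obtain ⟨he1, u, ⟨v, hv⟩, hu⟩ := Finset.mem_filter.1 he
      obtain ⟨hu2, huA⟩ := Finset.mem_filter.1 hu
      have hvd := huA e he1 v hv
      have hv2 : v ∈ V2 := Finset.mem_filter.2 ⟨mem_ends.2 ⟨e, he1, hv.inc_right⟩, hvd⟩
      obtain ⟨f, hf, y, hy, hne⟩ := hcon e he1 u v hv (hinc u hu2) hvd huA
      have hy3 : y ∈ V3 := (hV' f hf y hy.inc_right).resolve_left fun h => hne (hinc y h)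
      have hfM : f ∈ M := Finset.mem_filter.2 ⟨hf, v, y, hy, hv2, hy3⟩
      have hpos : 0 < (inc G M v).card := Finset.card_pos.2 ⟨f, mem_inc.2 ⟨hfM, hy.inc_left⟩⟩
      have hle : (inc G M v).card < (inc G S v).card := by
        refine Finset.card_lt_card ⟨inc_mono hMS v, fun hsub => ?_⟩
        exact hMN e (mem_inc.1 (hsub (mem_inc.2 ⟨he1, hv.inc_right⟩))).1 he
      rw [Nat.succ_le_iff, Finset.card_pos]
      exact ⟨v, (Finset.mem_bipartiteAbove _).2 ⟨Finset.mem_filter.2 ⟨hv2, by omega⟩, hv.inc_right⟩⟩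
    · obtain ⟨hv2, hv1⟩ := Finset.mem_filter.1 hv
      have hd : Disjoint (inc G M v) (N.bipartiteBelow (fun e v => G.Inc e v) v) := by
        refine Finset.disjoint_left.2 fun e h3 h4 => ?_
        exact hMN e (mem_inc.1 h3).1 ((Finset.mem_bipartiteBelow _).1 h4).1
      have hsub : inc G M v ∪ N.bipartiteBelow (fun e v => G.Inc e v) v ⊆ inc G S v := by
        refine Finset.union_subset (inc_mono hMS v) fun e he => ?_
        obtain ⟨h3, h4⟩ := (Finset.mem_bipartiteBelow _).1 he
        exact mem_inc.2 ⟨(Finset.mem_filter.1 h3).1, h4⟩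
      have := Finset.card_le_card hsub
      rw [Finset.card_union_of_disjoint hd, hinc v hv2] at this
      omega
  -- A vertex of degree two has two, one or no edges in `M`; the terms for `B` and `A` make up the
  -- deficit.
  have h4 : 2 * V2.card ≤ ∑ u ∈ V2, (inc G M u).card + B.card + 2 * A.card := by
    have hB' : B.card = ∑ u ∈ V2, if (inc G M u).card = 1 then 1 else 0 := Finset.card_filter _ _
    have hA' : A.card = ∑ u ∈ V2,
        if ∀ f ∈ S, ∀ x, G.IsLink f u x → (inc G S x).card = 2 then 1 else 0 :=
      Finset.card_filter _ _
    rw [hB', hA', Finset.mul_sum, ← Finset.sum_add_distrib, ← Finset.sum_add_distrib, mul_comm]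
    refine Finset.card_nsmul_le_sum _ _ 2 fun u hu => ?_
    by_cases hall : ∀ f ∈ S, ∀ x, G.IsLink f u x → (inc G S x).card = 2
    · rw [if_pos hall]; omega
    · push Not at hall
      obtain ⟨f, hf, x, hx, hne⟩ := hall
      have hx3 : x ∈ V3 := (hV' f hf x hx.inc_right).resolve_left fun h => hne (hinc x h)
      have : 0 < (inc G M u).card := Finset.card_pos.2
        ⟨f, mem_inc.2 ⟨Finset.mem_filter.2 ⟨hf, u, x, hx, hu, hx3⟩, hx.inc_left⟩⟩
      split_ifs <;> omega
  have h5 : B.card ≤ ∑ u ∈ V2, (inc G M u).card := by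
    rw [hB, Finset.card_filter]
    refine Finset.sum_le_sum fun u _ => ?_
    split_ifs <;> omega
  -- With `s` the sum over `V2`, `2|V2| ≤ s + |B| + 2|A| ≤ s + 2|B| ≤ 3s ≤ 9|V3|`, whereas the
  -- hypothesis amounts to `9|V3| < 2|V2|`.
  omega

end

/-! ### The core and its pendant edges -/

open Classical in
/-- The edges of `F` both of whose ends have degree at least two in `F`. -/
noncomputable def core {α β : Type*} (G : Graph α β) (F : Finset β) : Finset β :=
  F.filter fun e => ∀ v, G.Inc e v → 2 ≤ (inc G F v).card

/-- `e` joins `y` to a vertex of degree one in `F`. -/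
def IsPendant {α β : Type*} (G : Graph α β) (F : Finset β) (e : β) (y : α) : Prop :=
  ∃ x, G.IsLink e y x ∧ inc G F x = {e}

section

variable {α β : Type*} {k : ℕ} {G : Graph α β} {F H : Finset β} {c : β → Fin k}

lemma exists_notMem_of_card_lt (T : Finset (Fin k)) (h : T.card < k) : ∃ a, a ∉ T := by
  by_contra! h1
  have : T = Finset.univ := Finset.eq_univ_iff_forall.2 h1
  rw [this, Finset.card_univ, Fintype.card_fin] at h
  omega

open Classical in
lemma core_subset : core G F ⊆ F := Finset.filter_subset _ _

open Classical in
lemma mem_core {e : β} : e ∈ core G F ↔ e ∈ F ∧ ∀ v, G.Inc e v → 2 ≤ (inc G F v).card :=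
  Finset.mem_filter

lemma IsPendant.mem {e : β} {y : α} (h : IsPendant G F e y) : e ∈ F := by
  obtain ⟨x, _, h⟩ := h
  exact (mem_inc.1 (h ▸ Finset.mem_singleton_self e)).1

lemma IsPendant.inc_left {e : β} {y : α} (h : IsPendant G F e y) : G.Inc e y := by
  obtain ⟨x, h, _⟩ := h
  exact h.inc_left

lemma IsPendant.notMem_core {e : β} {y : α} (h : IsPendant G F e y) : e ∉ core G F := by
  obtain ⟨x, h, hx⟩ := h
  intro he
  have := (mem_core.1 he).2 x h.inc_right
  rw [hx, Finset.card_singleton] at this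
  omega

lemma IsPendant.anti {e : β} {y : α} (h : IsPendant G F e y) (hH : H ⊆ F) (he : e ∈ H) :
    IsPendant G H e y := by
  obtain ⟨x, h, hx⟩ := h
  refine ⟨x, h, Finset.Subset.antisymm (hx ▸ inc_mono hH x) ?_⟩
  rw [Finset.singleton_subset_iff]
  exact mem_inc.2 ⟨he, h.inc_right⟩

lemma isPendant_of_notMem_core {e : β} {y : α} (he : e ∈ F) (hc : e ∉ core G F)
    (hy : G.Inc e y) (h2 : 2 ≤ (inc G F y).card) : IsPendant G F e y := by
  have h : ¬ ∀ v, G.Inc e v → 2 ≤ (inc G F v).card := fun h => hc (mem_core.2 ⟨he, h⟩)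
  push Not at h
  obtain ⟨v, hv, hlt⟩ := h
  obtain ⟨x, hx⟩ := hy
  have hvx : v = x := (hv.eq_or_eq_of_isLink hx).resolve_left (by rintro rfl; omega)
  subst hvx
  refine ⟨v, hx, ?_⟩
  have hmem : e ∈ inc G F v := mem_inc.2 ⟨he, hv⟩
  have h1 : (inc G F v).card = 1 := by
    have := Finset.card_pos.2 ⟨e, hmem⟩
    omega
  obtain ⟨a, ha⟩ := Finset.card_eq_one.1 h1
  rw [ha, Finset.mem_singleton] at hmem
  rw [ha, hmem]

lemma two_le_of_mem_ends_core {v : α} (h : v ∈ ends G (core G F)) : 2 ≤ (inc G F v).card := by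
  obtain ⟨e, he, hv⟩ := mem_ends.1 h
  exact (mem_core.1 he).2 v hv

lemma StarOn.ne_of_inc (hs : StarOn G F c) {e f : β} {v : α} (he : e ∈ F) (hf : f ∈ F)
    (hne : e ≠ f) (h1 : G.Inc e v) (h2 : G.Inc f v) : c e ≠ c f := hs.proper e he f hf v hne h1 h2

-- Recoloring `m` alone leaves the palettes of `H` unchanged, so `StarOn.insert_edge` can be used
-- with a freely chosen color.
open Classical in
lemma StarOn.exists_insert (hG : G.Loopless) (hs : StarOn G H c) {m : β} {u v : α}
    (hm : G.IsLink m u v) (hmH : m ∉ H) {a : Fin k}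
    (hu : a ∉ colors G H c u) (hv : a ∉ colors G H c v)
    (hu' : ∀ f ∈ H, ∀ w, G.IsLink f u w → a ∉ colors G H c w ∨
      (c f ∉ colors G H c v ∧ ∀ h ∈ H, ∀ x, G.IsLink h w x → c h = a → c f ∉ colors G H c x))
    (hv' : ∀ f ∈ H, ∀ w, G.IsLink f v w → a ∉ colors G H c w ∨
      (c f ∉ colors G H c u ∧ ∀ h ∈ H, ∀ x, G.IsLink h w x → c h = a → c f ∉ colors G H c x)) :
    ∃ c', StarOn G (insert m H) c' ∧ (∀ e ∈ H, c' e = c e) ∧ c' m = a := by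
  set c' := Function.update c m a
  have hm' : c' m = a := Function.update_self ..
  have hc : ∀ e ∈ H, c' e = c e := fun e he =>
    Function.update_of_ne (by rintro rfl; exact hmH he) ..
  have hcol := fun x => colors_congr (G := G) hc x
  refine ⟨c', (hs.congr hc).insert_edge hG hm hmH ?_ ?_ ?_ ?_, hc, hm'⟩
  · rwa [hm', hcol]
  · rwa [hm', hcol]
  · intro f hf w hw
    simp only [hm', hcol, hc f hf]
    exact (hu' f hf w hw).imp_right fun h => ⟨h.1, fun g hg x hx h' => h.2 g hg x hx (hc g hg ▸ h')⟩
  · intro f hf w hw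
    simp only [hm', hcol, hc f hf]
    exact (hv' f hf w hw).imp_right fun h => ⟨h.1, fun g hg x hx h' => h.2 g hg x hx (hc g hg ▸ h')⟩

open Classical in
/-- Adding an edge with a color that is repeated at distance one only on pendant edges. -/
lemma StarOn.exists_insert_of_pendant (hG : G.Loopless) (hs : StarOn G H c) {m : β} {u v : α}
    (hm : G.IsLink m u v) (hmH : m ∉ H) {a : Fin k}
    (hu : a ∉ colors G H c u) (hv : a ∉ colors G H c v)
    (hu' : ∀ f ∈ H, ∀ w, G.IsLink f u w → a ∉ colors G H c w ∨
      (c f ∉ colors G H c v ∧ ∀ h ∈ H, G.Inc h w → c h = a → IsPendant G H h w))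
    (hv' : ∀ f ∈ H, ∀ w, G.IsLink f v w → a ∉ colors G H c w ∨
      (c f ∉ colors G H c u ∧ ∀ h ∈ H, G.Inc h w → c h = a → IsPendant G H h w)) :
    ∃ c', StarOn G (insert m H) c' ∧ (∀ e ∈ H, c' e = c e) ∧ c' m = a := by
  -- The far end of a pendant edge `h` sees only the color `a` of `h`. The color of `f` is not `a`,
  -- as `f` is an edge at `u`.
  have aux : ∀ {u}, a ∉ colors G H c u → ∀ f ∈ H, ∀ w, G.IsLink f u w → ∀ h ∈ H, ∀ x,
      G.IsLink h w x → c h = a → IsPendant G H h w → c f ∉ colors G H c x := by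
    intro u hu f hf w hw h hh x hx hha hp hfx
    obtain ⟨z, hz, hz1⟩ := hp
    obtain rfl := hx.right_unique hz
    obtain ⟨e, he, hex, hec⟩ := mem_colors.1 hfx
    have : e ∈ inc G H x := mem_inc.2 ⟨he, hex⟩
    rw [hz1, Finset.mem_singleton] at this
    subst this
    exact hu (mem_colors.2 ⟨f, hf, hw.inc_left, by rw [← hec, hha]⟩)
  refine hs.exists_insert hG hm hmH hu hv (fun f hf w hw => ?_) (fun f hf w hw => ?_)
  · exact (hu' f hf w hw).imp_right fun h =>
      ⟨h.1, fun g hg x hx h' => aux hu f hf w hw g hg x hx h' (h.2 g hg hx.inc_left h')⟩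
  · exact (hv' f hf w hw).imp_right fun h =>
      ⟨h.1, fun g hg x hx h' => aux hv f hf w hw g hg x hx h' (h.2 g hg hx.inc_left h')⟩

open Classical in
/-- Adding a pendant edge at `y` with a color that is repeated at distance one only on pendant
edges. -/
lemma StarOn.exists_insert_pendant (hG : G.Loopless) (hs : StarOn G H c) {m : β} {y : α}
    (hm : IsPendant G (insert m H) m y) (hmH : m ∉ H) {a : Fin k} (hy : a ∉ colors G H c y)
    (hy' : ∀ f ∈ H, ∀ w, G.IsLink f y w → ∀ h ∈ H, G.Inc h w → c h = a → IsPendant G H h w) :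
    ∃ c', StarOn G (insert m H) c' ∧ (∀ e ∈ H, c' e = c e) ∧ c' m = a := by
  obtain ⟨x, hmx, hx⟩ := hm
  have hx0 : ∀ e ∈ H, ¬ G.Inc e x := by
    intro e he hex
    have : e ∈ inc G (insert m H) x := mem_inc.2 ⟨Finset.mem_insert_of_mem he, hex⟩
    rw [hx, Finset.mem_singleton] at this
    exact hmH (this ▸ he)
  have hx1 : ∀ b, b ∉ colors G H c x := fun b hb => by
    obtain ⟨e, he, hex, _⟩ := mem_colors.1 hb
    exact hx0 e he hex
  exact hs.exists_insert_of_pendant hG hmx hmH hy (hx1 a)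
    (fun f hf w hw => .inr ⟨hx1 _, hy' f hf w hw⟩)
    (fun f hf w hw => absurd hw.inc_left (hx0 f hf))

open Classical in
/-- Adding at most one pendant edge at `y`. -/
lemma StarOn.exists_union_pendant (hG : G.Loopless) (hs : StarOn G H c) {P : Finset β} {y : α}
    (hP : P.card ≤ 1) (hp : ∀ p ∈ P, IsPendant G (H ∪ P) p y) (hPH : ∀ p ∈ P, p ∉ H)
    {a : Fin k} (hy : a ∉ colors G H c y)
    (hy' : ∀ f ∈ H, ∀ w, G.IsLink f y w → ∀ h ∈ H, G.Inc h w → c h = a → IsPendant G H h w) :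
    ∃ c', StarOn G (H ∪ P) c' ∧ (∀ e ∈ H, c' e = c e) ∧ ∀ p ∈ P, c' p = a := by
  obtain rfl | ⟨p, rfl⟩ : P = ∅ ∨ ∃ p, P = {p} := by
    rcases Nat.le_one_iff_eq_zero_or_eq_one.1 hP with h | h
    exacts [.inl (Finset.card_eq_zero.1 h), .inr (Finset.card_eq_one.1 h)]
  · exact ⟨c, by simpa using hs, fun _ _ => rfl, by simp⟩
  · have e : H ∪ {p} = insert p H := by rw [Finset.union_comm]; rfl
    rw [e] at hp ⊢
    obtain ⟨c', h1, h2, h3⟩ := hs.exists_insert_pendant hG (hp p (by simp)) (hPH p (by simp)) hy hy'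
    exact ⟨c', h1, h2, by simpa using h3⟩

open Classical in
/-- A pendant edge at a vertex with at most one core edge can be colored with five colors. -/
lemma exists_starOn_of_pendant_of_card_le_one (hG : G.Loopless) (hk : 5 ≤ k)
    (hdeg : ∀ v, (inc G F v).card ≤ 3) {e : β} {y : α} (he : IsPendant G F e y)
    (hy : (inc G (core G F) y).card ≤ 1) (hs : StarOn G (F.erase e) c) :
    ∃ c' : β → Fin k, StarOn G F c' := by
  have hins : insert e (F.erase e) = F := Finset.insert_erase he.mem
  have heH : e ∉ F.erase e := Finset.notMem_erase e F
  have hey : (inc G (F.erase e) y).card ≤ 2 := by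
    have : inc G (F.erase e) y = (inc G F y).erase e := by
      ext f; simp [mem_inc, and_assoc]
    rw [this, Finset.card_erase_of_mem (mem_inc.2 ⟨he.mem, he.inc_left⟩)]
    have := hdeg y
    omega
  -- Only core edges at `y` matter: the far end of another edge at `y` sees just the color of that
  -- edge, which is already excluded at `y`.
  suffices h : ∃ a : Fin k, a ∉ colors G (F.erase e) c y ∧
      ∀ f ∈ core G F, ∀ w, G.IsLink f y w → a ∉ colors G (F.erase e) c w by
    obtain ⟨a, ha, ha'⟩ := h
    obtain ⟨c', h1, -⟩ := hs.exists_insert_pendant hG (by rwa [hins]) heH ha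
      (fun f hf w hw h hh hhw hha => by
        exfalso
        by_cases hfc : f ∈ core G F
        · exact ha' f hfc w hw (mem_colors.2 ⟨h, hh, hhw, hha⟩)
        · have hef : e ≠ f := fun h => heH (h ▸ hf)
          have h2 : 2 ≤ (inc G F y).card := by
            rw [← Finset.card_pair hef]
            refine Finset.card_le_card fun g hg => ?_
            simp only [Finset.mem_insert, Finset.mem_singleton] at hg
            rcases hg with rfl | rfl
            · exact mem_inc.2 ⟨he.mem, he.inc_left⟩
            · exact mem_inc.2 ⟨Finset.mem_of_mem_erase hf, hw.inc_left⟩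
          obtain ⟨x, hx, hx1⟩ := isPendant_of_notMem_core (Finset.mem_of_mem_erase hf) hfc
            hw.inc_left h2
          obtain rfl := hx.right_unique hw
          have : h ∈ inc G F x := mem_inc.2 ⟨Finset.mem_of_mem_erase hh, hhw⟩
          rw [hx1, Finset.mem_singleton] at this
          subst this
          exact ha (mem_colors.2 ⟨h, hh, hw.inc_left, hha⟩))
    exact ⟨c', hins ▸ h1⟩
  rcases (inc G (core G F) y).eq_empty_or_nonempty with h0 | ⟨f, hf⟩
  · obtain ⟨a, ha⟩ := exists_notMem_of_card_lt (colors G (F.erase e) c y)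
      (by have := card_colors_le (G := G) (F := F.erase e) (c := c) y; omega)
    refine ⟨a, ha, fun f hf w hw => ?_⟩
    have : f ∈ inc G (core G F) y := mem_inc.2 ⟨hf, hw.inc_left⟩
    simp [h0] at this
  · obtain ⟨hfc, z, hz⟩ := mem_inc.1 hf
    have hfF : f ∈ F.erase e := Finset.mem_erase.2
      ⟨by rintro rfl; exact he.notMem_core hfc, core_subset hfc⟩
    have h1 : (((inc G (F.erase e) y).erase f).image c).card ≤ 1 := by
      refine Finset.card_image_le.trans ?_
      rw [Finset.card_erase_of_mem (mem_inc.2 ⟨hfF, hz.inc_left⟩)]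
      omega
    have h2 : (colors G (F.erase e) c z).card ≤ 3 := (card_colors_le z).trans
      ((Finset.card_le_card (inc_mono (Finset.erase_subset _ _) z)).trans (hdeg z))
    -- At most three colors at `z`, among them that of `f`, and at most one further color at `y` are
    -- forbidden.
    obtain ⟨a, ha⟩ := exists_notMem_of_card_lt
      (colors G (F.erase e) c z ∪ ((inc G (F.erase e) y).erase f).image c)
      (by have := Finset.card_union_le (colors G (F.erase e) c z)
            (((inc G (F.erase e) y).erase f).image c); omega)
    rw [Finset.mem_union, not_or] at ha
    refine ⟨a, fun h => ?_, fun g hg w hw => ?_⟩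
    · obtain ⟨g, hg, hgy, hga⟩ := mem_colors.1 h
      by_cases hgf : g = f
      · subst hgf
        exact ha.1 (mem_colors.2 ⟨g, hg, hz.inc_right, hga⟩)
      · exact ha.2 (Finset.mem_image.2 ⟨g, Finset.mem_erase.2 ⟨hgf, mem_inc.2 ⟨hg, hgy⟩⟩, hga⟩)
    · have : g = f := Finset.card_le_one.1 hy g (mem_inc.2 ⟨hg, hw.inc_left⟩) f hf
      subst this
      rw [hw.right_unique hz]
      exact ha.1

/-- The degrees in the core of a minimal non-colorable set are two or three. -/
lemma core_degree (hG : G.Loopless) (hk : 5 ≤ k) (hdeg : ∀ v, (inc G F v).card ≤ 3)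
    (hmin : ∀ H ⊂ F, ∃ c : β → Fin k, StarOn G H c)
    (hno : ¬ ∃ c : β → Fin k, StarOn G F c) (v : α) (hv : v ∈ ends G (core G F)) :
    (inc G (core G F) v).card = 2 ∨ (inc G (core G F) v).card = 3 := by
  classical
  have h3 := (Finset.card_le_card (inc_mono (core_subset (G := G) (F := F)) v)).trans (hdeg v)
  by_contra hcon
  have h1 : (inc G (core G F) v).card ≤ 1 := by omega
  have h2 := two_le_of_mem_ends_core hv
  -- The vertex has at least two edges in `F` but at most one in the core, so some edge at it is
  -- pendant.
  obtain ⟨e, he, hne⟩ := Finset.exists_of_ssubset (Finset.ssubset_iff_subset_ne.2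
    ⟨inc_mono (core_subset (G := G) (F := F)) v, fun h => by rw [h] at h1; omega⟩)
  obtain ⟨heF, hev⟩ := mem_inc.1 he
  have hp := isPendant_of_notMem_core heF (fun h => hne (mem_inc.2 ⟨h, hev⟩)) hev h2
  obtain ⟨c, hc⟩ := hmin _ (Finset.erase_ssubset heF)
  exact hno (exists_starOn_of_pendant_of_card_le_one hG hk hdeg hp h1 hc)

/-- The core of a minimal non-colorable set is nonempty. -/
lemma core_nonempty (hG : G.Loopless) (hk : 5 ≤ k) (hE : ∀ e ∈ F, e ∈ E(G))
    (hdeg : ∀ v, (inc G F v).card ≤ 3)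
    (hmin : ∀ H ⊂ F, ∃ c : β → Fin k, StarOn G H c)
    (hno : ¬ ∃ c : β → Fin k, StarOn G F c) : (core G F).Nonempty := by
  classical
  by_contra hcon
  rw [Finset.not_nonempty_iff_eq_empty] at hcon
  rcases F.eq_empty_or_nonempty with rfl | ⟨e, he⟩
  · exact hno ⟨fun _ => ⟨0, by omega⟩, starOn_empty _⟩
  obtain ⟨x, y, hl⟩ := G.exists_isLink_of_mem_edgeSet (hE e he)
  have hec : e ∉ core G F := by simp [hcon]
  obtain ⟨c, hc⟩ := hmin _ (Finset.erase_ssubset he)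
  have key : ∀ y, (inc G (core G F) y).card ≤ 1 := fun y => by simp [hcon, inc]
  by_cases h2 : 2 ≤ (inc G F y).card
  · exact hno (exists_starOn_of_pendant_of_card_le_one hG hk hdeg
      (isPendant_of_notMem_core he hec hl.inc_right h2) (key y) hc)
  · have hy : inc G F y = {e} := by
      have hmem : e ∈ inc G F y := mem_inc.2 ⟨he, hl.inc_right⟩
      refine (Finset.eq_of_subset_of_card_le (Finset.singleton_subset_iff.2 hmem) ?_).symm
      rw [Finset.card_singleton]
      omega
    exact hno (exists_starOn_of_pendant_of_card_le_one hG hk hdeg ⟨y, hl, hy⟩ (key x) hc)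

end

/-! ### Five colors: threads of vertices of degree two -/

open Classical in
/-- The pendant edges of `F` at `v`. -/
noncomputable def pendants {α β : Type*} (G : Graph α β) (F : Finset β) (v : α) : Finset β :=
  inc G F v \ core G F

section

variable {α β : Type*} {k : ℕ} {G : Graph α β} {F H : Finset β} {c : β → Fin k}

lemma mem_pendants {e : β} {v : α} :
    e ∈ pendants G F v ↔ (e ∈ F ∧ G.Inc e v) ∧ e ∉ core G F := by
  simp [pendants, mem_inc]

lemma isPendant_of_mem_pendants {e : β} {v : α} (h2 : 2 ≤ (inc G F v).card)
    (he : e ∈ pendants G F v) : IsPendant G F e v := by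
  obtain ⟨⟨h, h'⟩, h3⟩ := mem_pendants.1 he
  exact isPendant_of_notMem_core h h3 h' h2

lemma IsPendant.eq_of_inc {e : β} {v w : α} (h : IsPendant G F e v) (hw : G.Inc e w)
    (h2 : 2 ≤ (inc G F w).card) : w = v := by
  obtain ⟨x, hx, hx1⟩ := h
  refine (hw.eq_or_eq_of_isLink hx).resolve_right ?_
  rintro rfl
  rw [hx1, Finset.card_singleton] at h2
  omega

/-- With maximum degree three, this leaves at most one pendant edge at a vertex with two core edges
and none at one with three. -/
lemma card_pendants (v : α) :
    (pendants G F v).card + (inc G (core G F) v).card = (inc G F v).card := by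
  classical
  have : pendants G F v = inc G F v \ inc G (core G F) v := by
    ext e
    simp only [mem_pendants, Finset.mem_sdiff, mem_inc]
    tauto
  rw [this]
  exact Finset.card_sdiff_add_card_eq_card (inc_mono core_subset v)

/-- The edges at a vertex with two core edges. -/
lemma exists_core_edge_of_card_eq_two {m : β} {v : α} (hm : m ∈ core G F)
    (hv : G.Inc m v) (h2 : (inc G (core G F) v).card = 2) :
    2 ≤ (inc G F v).card ∧ ∃ e ∈ core G F, e ≠ m ∧ G.Inc e v ∧
      ∀ h ∈ F, G.Inc h v → h = m ∨ h = e ∨ h ∈ pendants G F v := by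
  classical
  refine ⟨(mem_core.1 hm).2 v hv, ?_⟩
  have hmem : m ∈ inc G (core G F) v := mem_inc.2 ⟨hm, hv⟩
  obtain ⟨e, he⟩ : ∃ e, (inc G (core G F) v).erase m = {e} := by
    rw [← Finset.card_eq_one, Finset.card_erase_of_mem hmem, h2]
  have he' : e ∈ (inc G (core G F) v).erase m := he ▸ Finset.mem_singleton_self e
  obtain ⟨h1, h3⟩ := Finset.mem_erase.1 he'
  refine ⟨e, (mem_inc.1 h3).1, h1, (mem_inc.1 h3).2, fun h hh hhv => ?_⟩
  by_cases hc : h ∈ core G F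
  · by_cases h4 : h = m
    · exact .inl h4
    · have : h ∈ (inc G (core G F) v).erase m := Finset.mem_erase.2 ⟨h4, mem_inc.2 ⟨hc, hhv⟩⟩
      rw [he, Finset.mem_singleton] at this
      exact .inr (.inl this)
  · exact .inr (.inr (mem_pendants.2 ⟨⟨hh, hhv⟩, hc⟩))

lemma card_colors_le_three (hdeg : ∀ v, (inc G F v).card ≤ 3) (hH : H ⊆ F) (v : α) :
    (colors G H c v).card ≤ 3 :=
  (card_colors_le v).trans ((Finset.card_le_card (inc_mono hH v)).trans (hdeg v))

lemma mem_colors_self {e : β} {v : α} (he : e ∈ F) (hv : G.Inc e v) : c e ∈ colors G F c v :=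
  mem_colors.2 ⟨e, he, hv, rfl⟩

set_option maxHeartbeats 1000000 in
/-- A thread of four core vertices of degree two is reducible for five colors. -/
lemma exists_starOn_of_thread (hG : G.Loopless) (hdeg : ∀ v, (inc G F v).card ≤ 3)
    (hmin : ∀ H ⊂ F, ∃ c : β → Fin 5, StarOn G H c) {m : β} {u v : α} (hm : m ∈ core G F)
    (hl : G.IsLink m u v) (hu : (inc G (core G F) u).card = 2)
    (hv : (inc G (core G F) v).card = 2)
    (hu' : ∀ f ∈ core G F, ∀ x, G.IsLink f u x → (inc G (core G F) x).card = 2)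
    (hv' : ∀ f ∈ core G F, ∀ x, G.IsLink f v x → (inc G (core G F) x).card = 2) :
    ∃ c : β → Fin 5, StarOn G F c := by
  classical
  obtain ⟨hu2, e, he, hem, ⟨y, hey⟩, hincu⟩ := exists_core_edge_of_card_eq_two hm hl.inc_left hu
  obtain ⟨hv2, e', he', hem', ⟨y', hey'⟩, hincv⟩ :=
    exists_core_edge_of_card_eq_two hm hl.inc_right hv
  have huv : u ≠ v := hl.ne
  have hmF : m ∈ F := core_subset hm
  by_cases hee : e = e'
  · subst hee
    -- two parallel edges
    obtain rfl : y = v := by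
      rcases hey'.inc_left.eq_or_eq_of_isLink hey with h | h
      · exact absurd h.symm huv
      · exact h.symm
    obtain ⟨c, hc⟩ := hmin _ (Finset.erase_ssubset hmF)
    have hcu : ∀ z, (z = u ∨ z = y) → (inc G (F.erase m) z).card ≤ 2 := by
      intro z hz
      have h1 : inc G (F.erase m) z = (inc G F z).erase m := by ext f; simp [mem_inc, and_assoc]
      have h2 : m ∈ inc G F z := mem_inc.2
        ⟨hmF, by rcases hz with rfl | rfl; exacts [hl.inc_left, hl.inc_right]⟩
      rw [h1, Finset.card_erase_of_mem h2]
      have := hdeg z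
      omega
    -- Without `m`, each of the two ends has at most two edges, so at most four colors are
    -- forbidden.
    obtain ⟨a, ha⟩ := exists_notMem_of_card_lt
      (colors G (F.erase m) c u ∪ colors G (F.erase m) c y) (by
        have h1 := Finset.card_union_le (colors G (F.erase m) c u) (colors G (F.erase m) c y)
        have h2 := (card_colors_le (G := G) (F := F.erase m) (c := c) u).trans (hcu u (.inl rfl))
        have h3 := (card_colors_le (G := G) (F := F.erase m) (c := c) y).trans (hcu y (.inr rfl))
        omega)
    rw [Finset.mem_union, not_or] at ha
    have far : ∀ s t, G.IsLink e s t → 2 ≤ (inc G F s).card → a ∉ colors G (F.erase m) c s →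
        a ∉ colors G (F.erase m) c t →
        (∀ h ∈ F, G.Inc h s → h = m ∨ h = e ∨ h ∈ pendants G F s) →
        ∀ f ∈ F.erase m, ∀ w, G.IsLink f s w → a ∉ colors G (F.erase m) c w := by
      intro s t hst hs2 has hat hs f hf w hw haw
      obtain ⟨hfm, hfF⟩ := Finset.mem_erase.1 hf
      rcases hs f hfF hw.inc_left with h | rfl | h
      · exact hfm h
      · rw [hw.right_unique hst] at haw
        exact hat haw
      · obtain ⟨x, hx, hx1⟩ := isPendant_of_mem_pendants hs2 h
        obtain rfl := hw.right_unique hx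
        obtain ⟨g, hg, hgw, rfl⟩ := mem_colors.1 haw
        have : g ∈ inc G F w := mem_inc.2 ⟨Finset.mem_of_mem_erase hg, hgw⟩
        rw [hx1, Finset.mem_singleton] at this
        subst this
        exact has (mem_colors_self hf hw.inc_left)
    obtain ⟨c', hc', -⟩ := hc.exists_insert hG hl (Finset.notMem_erase m F) ha.1 ha.2
      (fun f hf w hw => .inl (far u y hey hu2 ha.1 ha.2 hincu f hf w hw))
      (fun f hf w hw => .inl (far y u hey.symm hv2 ha.2 ha.1 hincv f hf w hw))
    exact ⟨c', by rwa [Finset.insert_erase hmF] at hc'⟩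
  -- The thread is `w -f- y -e- u -m- v -e'- y' -f'- w'`. The edges `e` and `m` and the pendant
  -- edges at `y`, `u`, `v` are removed. A pendant edge left at `y` would be a fifth constraint on
  -- `e`, besides `e'` and the three colors at `w`. Pendant edges at `y'` may stay.
  obtain ⟨hy2, f, hf, hfe, ⟨w, hfw⟩, hincy⟩ :=
    exists_core_edge_of_card_eq_two he hey.inc_right (hu' e he y hey)
  obtain ⟨hy2', f', hf', hfe', ⟨w', hfw'⟩, hincy'⟩ :=
    exists_core_edge_of_card_eq_two he' hey'.inc_right (hv' e' he' y' hey')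
  have hyu : y ≠ u := hey.ne.symm
  have hyv' : y' ≠ v := hey'.ne.symm
  have hnp : ∀ g ∈ core G F, ∀ z, g ∉ pendants G F z := fun g hg z h => (mem_pendants.1 h).2 hg
  have hyv : y ≠ v := by
    rintro rfl
    rcases hincv e (core_subset he) hey.inc_right with h | h | h
    exacts [hem h, hee h, hnp e he y h]
  have hyu' : y' ≠ u := by
    rintro rfl
    rcases hincu e' (core_subset he') hey'.inc_right with h | h | h
    exacts [hem' h, hee h.symm, hnp e' he' y' h]
  have hmy : ¬ G.Inc m y := fun h => by
    rcases h.eq_or_eq_of_isLink hl with h | h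
    exacts [hyu h, hyv h]
  have hmy' : ¬ G.Inc m y' := fun h => by
    rcases h.eq_or_eq_of_isLink hl with h | h
    exacts [hyu' h, hyv' h]
  have heF := core_subset he
  have heF' := core_subset he'
  have hpd : ∀ z : α, (inc G (core G F) z).card = 2 → (pendants G F z).card ≤ 1 := by
    intro z hz
    have := card_pendants (G := G) (F := F) z
    have := hdeg z
    omega
  have hpi : ∀ z g, g ∈ pendants G F z → G.Inc g z := fun z g h => (mem_pendants.1 h).1.2
  have hpe : ∀ s t g, 2 ≤ (inc G F s).card → 2 ≤ (inc G F t).card → g ∈ pendants G F s →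
      g ∈ pendants G F t → s = t := fun s t g hs ht h1 h2 =>
    ((isPendant_of_mem_pendants hs h1).eq_of_inc (hpi t g h2) ht).symm
  set P1 := pendants G F y
  set P2 := pendants G F u
  set P3 := pendants G F v
  have hP12 : ∀ g ∈ P1, g ∉ P2 := fun g h1 h2 => hyu (hpe y u g hy2 hu2 h1 h2)
  have hP13 : ∀ g ∈ P1, g ∉ P3 := fun g h1 h2 => hyv (hpe y v g hy2 hv2 h1 h2)
  have hP23 : ∀ g ∈ P2, g ∉ P3 := fun g h1 h2 => huv (hpe u v g hu2 hv2 h1 h2)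
  have hPF : ∀ z, pendants G F z ⊆ F := fun z g h => (mem_pendants.1 h).1.1
  -- the part that is colored by minimality
  set F0 := F \ ({e, m} ∪ P1 ∪ P2 ∪ P3) with hF0
  have mF0 : ∀ g, g ∈ F0 ↔ g ∈ F ∧ g ≠ e ∧ g ≠ m ∧ g ∉ P1 ∧ g ∉ P2 ∧ g ∉ P3 := by
    intro g
    simp only [hF0, Finset.mem_sdiff, Finset.mem_union, Finset.mem_insert, Finset.mem_singleton]
    tauto
  have hF0F : F0 ⊆ F := Finset.sdiff_subset
  obtain ⟨c0, hc0⟩ := hmin F0 ⟨hF0F, fun h => ((mF0 e).1 (h heF)).2.1 rfl⟩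
  have heF0 : e ∉ F0 := fun h => ((mF0 e).1 h).2.1 rfl
  have heF0' : e' ∈ F0 := (mF0 e').2
    ⟨heF', fun h => hee h.symm, hem', hnp e' he' _, hnp e' he' _, hnp e' he' _⟩
  have hfF0 : f ∈ F0 := (mF0 f).2
    ⟨core_subset hf, hfe, fun h => hmy (h ▸ hfw.inc_left), hnp f hf _, hnp f hf _, hnp f hf _⟩
  -- the edge `e`
  obtain ⟨a1, ha1⟩ := exists_notMem_of_card_lt (insert (c0 e') (colors G F0 c0 w)) (by
    have := Finset.card_insert_le (c0 e') (colors G F0 c0 w)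
    have := card_colors_le_three (c := c0) hdeg hF0F w
    omega)
  rw [Finset.mem_insert, not_or] at ha1
  have hF0u : ∀ g ∈ F0, ¬ G.Inc g u := by grind
  have hF0y : ∀ g ∈ F0, G.Inc g y → g = f := by grind
  obtain ⟨c1, hc1, hc10, hc1e⟩ := hc0.exists_insert hG hey heF0 (a := a1)
    (fun h => by obtain ⟨g, hg, hgu, _⟩ := mem_colors.1 h; exact hF0u g hg hgu)
    (fun h => by
      obtain ⟨g, hg, hgy, hga⟩ := mem_colors.1 h
      obtain rfl := hF0y g hg hgy
      exact ha1.2 (hga ▸ mem_colors_self hg hfw.inc_right))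
    (fun g hg z hz => absurd hz.inc_left (hF0u g hg))
    (fun g hg z hz => .inl (by
      obtain rfl := hF0y g hg hz.inc_left
      rw [hz.right_unique hfw]; exact ha1.2))
  set F1 := insert e F0 with hF1
  have mF1 : ∀ g, g ∈ F1 ↔ g = e ∨ g ∈ F0 := fun g => Finset.mem_insert
  have hF1F : F1 ⊆ F := Finset.insert_subset heF hF0F
  -- Since `e` and `e'` differ in color, neither has its color at the opposite end of `m`. No
  -- bicolored path has `m` as a middle edge, whatever the pendant edges at `y` and `y'` are.
  have h1ee : c1 e ≠ c1 e' := by rw [hc1e, hc10 e' heF0']; exact ha1.1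
  -- the pendant edges at `y`
  obtain ⟨a2, ha2⟩ := exists_notMem_of_card_lt (insert (c1 e) (colors G F1 c1 w)) (by
    have := Finset.card_insert_le (c1 e) (colors G F1 c1 w)
    have := card_colors_le_three (c := c1) hdeg hF1F w
    omega)
  rw [Finset.mem_insert, not_or] at ha2
  have hF1y : ∀ g ∈ F1, G.Inc g y → g = e ∨ g = f := by grind
  have hF1u : ∀ g ∈ F1, G.Inc g u → g = e := by grind
  have ha2f : a2 ≠ c1 f := fun h => ha2.2
    (h ▸ mem_colors_self ((mF1 f).2 (.inr hfF0)) hfw.inc_right)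
  have hpan : ∀ {H : Finset β} {z p}, H ⊆ F → 2 ≤ (inc G F z).card → p ∈ pendants G F z → p ∈ H →
      IsPendant G H p z := fun hH hz hp hpH => (isPendant_of_mem_pendants hz hp).anti hH hpH
  have hF2F : F1 ∪ P1 ⊆ F := Finset.union_subset hF1F (hPF y)
  obtain ⟨c2, hc2, hc21, -⟩ := hc1.exists_union_pendant hG (hpd y (hu' e he y hey))
    (fun p hp => hpan hF2F hy2 hp (Finset.mem_union_right _ hp)) (by grind) (a := a2)
    (fun h => by
      obtain ⟨g, hg, hgy, hga⟩ := mem_colors.1 h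
      rcases hF1y g hg hgy with rfl | rfl
      exacts [ha2.1 hga.symm, ha2f hga.symm])
    (fun g hg z hz h hh hhz hha => by
      exfalso
      rcases hF1y g hg hz.inc_left with rfl | rfl
      · obtain rfl := hz.right_unique hey.symm
        obtain rfl := hF1u h hh hhz
        exact ha2.1 hha.symm
      · obtain rfl := hz.right_unique hfw
        exact ha2.2 (hha ▸ mem_colors_self hh hhz))
  set F2 := F1 ∪ P1 with hF2
  have mF2 : ∀ g, g ∈ F2 ↔ g ∈ F1 ∨ g ∈ P1 := fun g => Finset.mem_union
  have h2ee : c2 e ≠ c2 e' := by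
    rw [hc21 e ((mF1 e).2 (.inl rfl)), hc21 e' ((mF1 e').2 (.inr heF0'))]; exact h1ee
  -- the middle edge
  have card4 : ∀ a b c d : Fin 5, ∃ x, x ≠ a ∧ x ≠ b ∧ x ≠ c ∧ x ≠ d := by
    intro a b c d
    obtain ⟨x, hx⟩ := exists_notMem_of_card_lt ({a, b, c, d} : Finset (Fin 5))
      (Finset.card_le_four.trans_lt (by norm_num))
    exact ⟨x, by simpa using hx⟩
  -- Once the colors of these four edges are avoided, the color of `m` can recur at `y` or `y'` only
  -- on pendant edges.
  obtain ⟨a3, h3a, h3b, h3c, h3d⟩ := card4 (c2 e) (c2 e') (c2 f) (c2 f')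
  have hF2u : ∀ g ∈ F2, G.Inc g u → g = e := by grind
  have hF2v : ∀ g ∈ F2, G.Inc g v → g = e' := by grind
  have hF2y : ∀ g ∈ F2, G.Inc g y → g = e ∨ g = f ∨ g ∈ P1 := by grind
  have hmF2 : m ∉ F2 := by grind
  obtain ⟨c3, hc3, hc32, hc3m⟩ := hc2.exists_insert_of_pendant hG hl hmF2 (a := a3)
    (fun h => by
      obtain ⟨g, hg, hgy, hga⟩ := mem_colors.1 h
      obtain rfl := hF2u g hg hgy
      exact h3a hga.symm)
    (fun h => by
      obtain ⟨g, hg, hgy, hga⟩ := mem_colors.1 h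
      obtain rfl := hF2v g hg hgy
      exact h3b hga.symm)
    (fun g hg z hz => .inr (by
      obtain rfl := hF2u g hg hz.inc_left
      obtain rfl := hz.right_unique hey
      refine ⟨fun h => ?_, fun h hh hhz hha => ?_⟩
      · obtain ⟨i, hi, hiv, hic⟩ := mem_colors.1 h
        obtain rfl := hF2v i hi hiv
        exact h2ee hic.symm
      · rcases hF2y h hh hhz with rfl | rfl | hp
        exacts [absurd hha.symm h3a, absurd hha.symm h3c, hpan hF2F hy2 hp hh]))
    (fun g hg z hz => .inr (by
      obtain rfl := hF2v g hg hz.inc_left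
      obtain rfl := hz.right_unique hey'
      refine ⟨fun h => ?_, fun h hh hhz hha => ?_⟩
      · obtain ⟨i, hi, hiv, hic⟩ := mem_colors.1 h
        obtain rfl := hF2u i hi hiv
        exact h2ee hic
      · rcases hincy' h (hF2F hh) hhz with rfl | rfl | hp
        exacts [absurd hha.symm h3b, absurd hha.symm h3d, hpan hF2F hy2' hp hh]))
  set F3 := insert m F2 with hF3
  have mF3 : ∀ g, g ∈ F3 ↔ g = m ∨ g ∈ F2 := fun g => Finset.mem_insert
  have hF3F : F3 ⊆ F := Finset.insert_subset hmF hF2F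
  -- the pendant edges at `u`
  obtain ⟨a4, h4a, h4b, h4c, h4d⟩ := card4 (c3 e) (c3 e') (c3 m) (c3 f)
  have hF3u : ∀ g ∈ F3, G.Inc g u → g = m ∨ g = e := by grind
  have hF3v : ∀ g ∈ F3, G.Inc g v → g = m ∨ g = e' := by grind
  have hF4F : F3 ∪ P2 ⊆ F := Finset.union_subset hF3F (hPF u)
  obtain ⟨c4, hc4, hc43, -⟩ := hc3.exists_union_pendant hG (hpd u hu)
    (fun p hp => hpan hF4F hu2 hp (Finset.mem_union_right _ hp)) (by grind) (a := a4)
    (fun h => by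
      obtain ⟨g, hg, hgy, hga⟩ := mem_colors.1 h
      rcases hF3u g hg hgy with rfl | rfl
      exacts [h4c hga.symm, h4a hga.symm])
    (fun g hg z hz h hh hhz hha => by
      rcases hF3u g hg hz.inc_left with rfl | rfl
      · obtain rfl := hz.right_unique hl
        rcases hF3v h hh hhz with rfl | rfl
        exacts [absurd hha.symm h4c, absurd hha.symm h4b]
      · obtain rfl := hz.right_unique hey
        rcases hincy h (hF3F hh) hhz with rfl | rfl | hp
        exacts [absurd hha.symm h4a, absurd hha.symm h4d, hpan hF3F hy2 hp hh])
  set F4 := F3 ∪ P2 with hF4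
  have mF4 : ∀ g, g ∈ F4 ↔ g ∈ F3 ∨ g ∈ P2 := fun g => Finset.mem_union
  -- the pendant edges at `v`
  obtain ⟨a5, h5a, h5b, h5c, h5d⟩ := card4 (c4 e) (c4 e') (c4 m) (c4 f')
  have hF4u : ∀ g ∈ F4, G.Inc g u → g = m ∨ g = e ∨ g ∈ P2 := by grind
  have hF4v : ∀ g ∈ F4, G.Inc g v → g = m ∨ g = e' := by grind
  have hF5F : F4 ∪ P3 = F := by
    ext g
    simp only [Finset.mem_union, mF4, mF3, mF2, mF1, mF0]
    constructor
    · rintro (((rfl | (rfl | h) | h) | h) | h)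
      exacts [hmF, heF, h.1, hPF _ h, hPF _ h, hPF _ h]
    · intro h
      tauto
  obtain ⟨c5, hc5, -⟩ := hc4.exists_union_pendant hG (hpd v hv)
    (fun p hp => hpan hF5F.le hv2 hp (Finset.mem_union_right _ hp)) (by grind) (a := a5)
    (fun h => by
      obtain ⟨g, hg, hgy, hga⟩ := mem_colors.1 h
      rcases hF4v g hg hgy with rfl | rfl
      exacts [h5c hga.symm, h5b hga.symm])
    (fun g hg z hz h hh hhz hha => by
      rcases hF4v g hg hz.inc_left with rfl | rfl
      · obtain rfl := hz.right_unique hl.symm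
        rcases hF4u h hh hhz with rfl | rfl | hp
        exacts [absurd hha.symm h5c, absurd hha.symm h5a, hpan hF4F hu2 hp hh]
      · obtain rfl := hz.right_unique hey'
        rcases hincy' h (hF4F hh) hhz with rfl | rfl | hp
        exacts [absurd hha.symm h5b, absurd hha.symm h5d, hpan hF4F hy2' hp hh])
  exact ⟨c5, hF5F ▸ hc5⟩

/-- A finite subcubic set of edges all of whose subsets have average degree less than `24/11` is
star `5`-edge-colorable. -/
theorem exists_starOn_five (hG : G.Loopless) (F : Finset β) (hE : ∀ e ∈ F, e ∈ E(G))
    (hdeg : ∀ v, (inc G F v).card ≤ 3)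
    (hsp : ∀ S ⊆ F, S.Nonempty → 11 * S.card < 12 * (ends G S).card) :
    ∃ c : β → Fin 5, StarOn G F c := by
  induction F using Finset.strongInduction with
  | H F ih =>
    by_contra hno
    have hmin : ∀ H ⊂ F, ∃ c : β → Fin 5, StarOn G H c := fun H hH =>
      ih H hH (fun e he => hE e (hH.1 he))
        (fun v => (Finset.card_le_card (inc_mono hH.1 v)).trans (hdeg v))
        fun S hS => hsp S (hS.trans hH.1)
    obtain ⟨m, hm, u, v, hl, h1, h2, h3, h4⟩ := exists_of_average_lt_twentyfour_elevenths hG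
      (fun e he => hE e (core_subset he)) (core_degree hG le_rfl hdeg hmin hno)
      (hsp _ core_subset (core_nonempty hG le_rfl hE hdeg hmin hno))
    exact hno (exists_starOn_of_thread hG hdeg hmin hm hl h1 h2 h3 h4)

end
-- Six colors: pendant edges, adjacent vertices of degree two, parallel edges
section

variable {α β : Type*} {k : ℕ} {G : Graph α β} {F H : Finset β} {c : β → Fin k}

open Classical in
lemma inc_erase (e : β) (v : α) : inc G (F.erase e) v = (inc G F v).erase e := by
  ext f; simp [mem_inc, and_assoc]

open Classical in
/-- A pendant edge with a neighboring core vertex of degree at most two can be colored with six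
colors. -/
lemma exists_starOn_of_pendant_of_core_neighbor (hG : G.Loopless) (hk : 6 ≤ k)
    (hdeg : ∀ v, (inc G F v).card ≤ 3) {e f : β} {y z : α}
    (he : IsPendant G F e y) (hf : f ∈ core G F) (hfz : G.IsLink f y z)
    (hz : (inc G (core G F) z).card ≤ 2)
    (hs : StarOn G (F.erase e) c) : ∃ c' : β → Fin k, StarOn G F c' := by
  classical
  have hins : insert e (F.erase e) = F := Finset.insert_erase he.mem
  have heH : e ∉ F.erase e := Finset.notMem_erase e F
  have hfe : f ≠ e := by rintro rfl; exact he.notMem_core hf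
  have hfH : f ∈ F.erase e := Finset.mem_erase.2 ⟨hfe, core_subset hf⟩
  have hz2 := (mem_core.1 hf).2 z hfz.inc_right
  -- `T` is the palette at the far end of the one possible remaining edge at `y`, and empty if there
  -- is none. With the at most two core edges at `z` this forbids at most five colors; recurrence on
  -- pendant edges at `z` is harmless.
  obtain ⟨T, hT, hyT⟩ : ∃ T : Finset (Fin k), T.card ≤ 3 ∧
      ∀ g ∈ F.erase e, g ≠ f → ∀ w, G.IsLink g y w → colors G (F.erase e) c w ⊆ T := by
    have hcard : ((inc G (F.erase e) y).erase f).card ≤ 1 := by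
      rw [Finset.card_erase_of_mem (mem_inc.2 ⟨hfH, hfz.inc_left⟩), inc_erase,
        Finset.card_erase_of_mem (mem_inc.2 ⟨he.mem, he.inc_left⟩)]
      have := hdeg y
      omega
    rcases ((inc G (F.erase e) y).erase f).eq_empty_or_nonempty with h0 | ⟨g, hg⟩
    · refine ⟨∅, by simp, fun g hg hgf w hw => ?_⟩
      have : g ∈ (inc G (F.erase e) y).erase f :=
        Finset.mem_erase.2 ⟨hgf, mem_inc.2 ⟨hg, hw.inc_left⟩⟩
      simp [h0] at this
    · obtain ⟨hgH, w, hw⟩ := mem_inc.1 (Finset.mem_of_mem_erase hg)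
      refine ⟨colors G (F.erase e) c w, card_colors_le_three hdeg (Finset.erase_subset _ _) w,
        fun g' hg' hgf' w' hw' => ?_⟩
      obtain rfl : g' = g := Finset.card_le_one.1 hcard g'
        (Finset.mem_erase.2 ⟨hgf', mem_inc.2 ⟨hg', hw'.inc_left⟩⟩) g hg
      rw [hw'.right_unique hw]
  obtain ⟨a, ha⟩ := exists_notMem_of_card_lt (T ∪ (inc G (core G F) z).image c) (by
    have := Finset.card_union_le T ((inc G (core G F) z).image c)
    have := Finset.card_image_le (s := inc G (core G F) z) (f := c)
    omega)
  rw [Finset.mem_union, not_or] at ha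
  obtain ⟨c', hc', -⟩ := hs.exists_insert_pendant hG (by rwa [hins]) heH (a := a)
    (fun h => by
      obtain ⟨g, hg, hgy, rfl⟩ := mem_colors.1 h
      by_cases hgf : g = f
      · exact ha.2 (Finset.mem_image_of_mem _ (mem_inc.2 ⟨hgf ▸ hf, hgf ▸ hfz.inc_right⟩))
      · obtain ⟨w, hw⟩ := hgy
        exact ha.1 (hyT g hg hgf w hw (mem_colors_self hg hw.inc_right)))
    (fun g hg w hw h hh hhw hha => by
      by_cases hgf : g = f
      · subst hgf
        obtain rfl := hw.right_unique hfz
        refine (isPendant_of_notMem_core (Finset.mem_of_mem_erase hh) (fun hc => ?_) hhw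
          hz2).anti (Finset.erase_subset _ _) hh
        exact ha.2 (hha ▸ Finset.mem_image_of_mem _ (mem_inc.2 ⟨hc, hhw⟩))
      · exact absurd (hyT g hg hgf w hw (mem_colors.2 ⟨h, hh, hhw, hha⟩)) ha.1)
  exact ⟨c', hins ▸ hc'⟩

open Classical in
/-- A pendant edge at a vertex with two parallel edges is reducible. -/
lemma exists_starOn_of_pendant_of_parallel (hG : G.Loopless) (hk : 4 ≤ k)
    (hdeg : ∀ v, (inc G F v).card ≤ 3) {e f g : β} {y z : α}
    (he : IsPendant G F e y) (hf : f ∈ core G F) (hg : g ∈ core G F) (hfg : f ≠ g)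
    (hfz : G.IsLink f y z) (hgz : G.IsLink g y z)
    (hs : StarOn G (F.erase e) c) : ∃ c' : β → Fin k, StarOn G F c' := by
  classical
  have hins : insert e (F.erase e) = F := Finset.insert_erase he.mem
  have heH : e ∉ F.erase e := Finset.notMem_erase e F
  have hfe : f ≠ e := by rintro rfl; exact he.notMem_core hf
  have hge : g ≠ e := by rintro rfl; exact he.notMem_core hg
  have hy : ∀ h ∈ F.erase e, ∀ w, G.IsLink h y w → w = z := by
    intro h hh w hw
    have h1 : ({e, f, g} : Finset β) = inc G F y := by
      refine Finset.eq_of_subset_of_card_le (fun i hi => ?_) ((hdeg y).trans ?_)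
      · simp only [Finset.mem_insert, Finset.mem_singleton] at hi
        rcases hi with rfl | rfl | rfl
        exacts [mem_inc.2 ⟨he.mem, he.inc_left⟩, mem_inc.2 ⟨core_subset hf, hfz.inc_left⟩,
          mem_inc.2 ⟨core_subset hg, hgz.inc_left⟩]
      · rw [Finset.card_eq_three.2 ⟨e, f, g, hfe.symm, hge.symm, hfg, rfl⟩]
    have h2 : h ∈ ({e, f, g} : Finset β) :=
      h1 ▸ mem_inc.2 ⟨Finset.mem_of_mem_erase hh, hw.inc_left⟩
    simp only [Finset.mem_insert, Finset.mem_singleton] at h2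
    rcases h2 with rfl | rfl | rfl
    exacts [absurd hh heH, hw.right_unique hfz, hw.right_unique hgz]
  -- All other edges at `y` lead to `z`, so avoiding the three colors at `z` is enough.
  obtain ⟨a, ha⟩ := exists_notMem_of_card_lt (colors G (F.erase e) c z) (by
    have := card_colors_le_three (c := c) hdeg (Finset.erase_subset e F) z
    omega)
  obtain ⟨c', hc', -⟩ := hs.exists_insert_pendant hG (by rwa [hins]) heH (a := a)
    (fun h => by
      obtain ⟨i, hi, ⟨w, hw⟩, rfl⟩ := mem_colors.1 h
      exact ha (mem_colors_self hi (hy i hi w hw ▸ hw.inc_right)))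
    (fun i hi w hw h hh hhw hha => by
      rw [hy i hi w hw] at hhw
      exact absurd (mem_colors.2 ⟨h, hh, hhw, hha⟩) ha)
  exact ⟨c', hins ▸ hc'⟩

/-- Two adjacent vertices of degree two are reducible for six colors. -/
lemma exists_starOn_of_adjacent_two (hG : G.Loopless)
    (hdeg : ∀ v, (inc G F v).card ≤ 3)
    (hmin : ∀ H ⊂ F, ∃ c : β → Fin 6, StarOn G H c) {m : β} {u v : α} (hm : m ∈ core G F)
    (hl : G.IsLink m u v) (hu : (inc G (core G F) u).card = 2)
    (hv : (inc G (core G F) v).card = 2) : ∃ c : β → Fin 6, StarOn G F c := by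
  classical
  by_contra hno
  have hmF := core_subset hm
  have hnp : ∀ {y z}, G.IsLink m y z → (inc G (core G F) z).card = 2 → 2 ≤ (inc G F y).card →
      ∀ p, p ∉ pendants G F y := by
    intro y z hl hz hy p hp
    have hp' := isPendant_of_mem_pendants hy hp
    obtain ⟨c, hc⟩ := hmin _ (Finset.erase_ssubset hp'.mem)
    exact hno (exists_starOn_of_pendant_of_core_neighbor hG le_rfl hdeg hp' hm hl hz.le hc)
  obtain ⟨hu2, e, he, hem, ⟨w, hew⟩, hincu⟩ := exists_core_edge_of_card_eq_two hm hl.inc_left hu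
  obtain ⟨hv2, e', he', hem', ⟨w', hew'⟩, hincv⟩ :=
    exists_core_edge_of_card_eq_two hm hl.inc_right hv
  replace hincu : ∀ h ∈ F, G.Inc h u → h = m ∨ h = e := fun h hh hhu => by
    rcases hincu h hh hhu with h1 | h1 | h1
    exacts [.inl h1, .inr h1, absurd h1 (hnp hl hv hu2 h)]
  replace hincv : ∀ h ∈ F, G.Inc h v → h = m ∨ h = e' := fun h hh hhv => by
    rcases hincv h hh hhv with h1 | h1 | h1
    exacts [.inl h1, .inr h1, absurd h1 (hnp hl.symm hu hv2 h)]
  set H := F.erase m with hH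
  have hHF : H ⊆ F := Finset.erase_subset _ _
  have hins : insert m H = F := Finset.insert_erase hmF
  have hmH : m ∉ H := Finset.notMem_erase m F
  have heH : e ∈ H := Finset.mem_erase.2 ⟨hem, core_subset he⟩
  have heH' : e' ∈ H := Finset.mem_erase.2 ⟨hem', core_subset he'⟩
  obtain ⟨c, hc⟩ := hmin H (Finset.erase_ssubset hmF)
  have hHu : ∀ g ∈ H, G.Inc g u → g = e := fun g hg hgu =>
    (hincu g (hHF hg) hgu).resolve_left (Finset.ne_of_mem_erase hg)
  have hHv : ∀ g ∈ H, G.Inc g v → g = e' := fun g hg hgv =>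
    (hincv g (hHF hg) hgv).resolve_left (Finset.ne_of_mem_erase hg)
  have hcu : ∀ c : β → Fin 6, ∀ a, a ≠ c e → a ∉ colors G H c u := fun c a ha h => by
    obtain ⟨g, hg, hgu, rfl⟩ := mem_colors.1 h
    exact ha (by rw [hHu g hg hgu])
  have hcv : ∀ c : β → Fin 6, ∀ a, a ≠ c e' → a ∉ colors G H c v := fun c a ha h => by
    obtain ⟨g, hg, hgv, rfl⟩ := mem_colors.1 h
    exact ha (by rw [hHv g hg hgv])
  have hfar : ∀ c : β → Fin 6, StarOn G H c → ∀ a, a ≠ c e → a ≠ c e' → a ∉ colors G H c w →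
      a ∉ colors G H c w' → False := by
    intro c hc a hae hae' haw haw'
    obtain ⟨c', hc', -⟩ := hc.exists_insert hG hl hmH (hcu c a hae) (hcv c a hae')
      (fun g hg x hx => .inl (by
        obtain rfl := hHu g hg hx.inc_left
        rwa [hx.right_unique hew]))
      (fun g hg x hx => .inl (by
        obtain rfl := hHv g hg hx.inc_left
        rwa [hx.right_unique hew']))
    exact hno ⟨c', hins ▸ hc'⟩
  have hew1 : c e ∈ colors G H c w := mem_colors_self heH hew.inc_right
  have hew1' : c e' ∈ colors G H c w' := mem_colors_self heH' hew'.inc_right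
  have hcw := card_colors_le_three (c := c) hdeg hHF w
  have hcw' := card_colors_le_three (c := c) hdeg hHF w'
  -- A color missing at both `w` and `w'` could be given to `m`. So the palettes there are disjoint
  -- triples covering all six colors.
  have hcov : 6 ≤ (colors G H c w ∪ colors G H c w').card := by
    by_contra hlt
    obtain ⟨a, ha⟩ := exists_notMem_of_card_lt _ (not_le.1 hlt)
    rw [Finset.mem_union, not_or] at ha
    exact hfar c hc a (fun h => ha.1 (h ▸ hew1)) (fun h => ha.2 (h ▸ hew1')) ha.1 ha.2
  have hui := Finset.card_union_add_card_inter (colors G H c w) (colors G H c w')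
  have hdisj : ∀ a, a ∈ colors G H c w → a ∉ colors G H c w' := by
    have : Disjoint (colors G H c w) (colors G H c w') := by
      rw [Finset.disjoint_iff_inter_eq_empty, ← Finset.card_eq_zero]
      omega
    exact fun a h => Finset.disjoint_left.1 this h
  have hee : e ≠ e' := by rintro rfl; exact hdisj _ hew1 hew1'
  have hcee : c e ≠ c e' := fun h => hdisj _ hew1 (h ▸ hew1')
  -- the color of `e` occurs at all further neighbors of `w`
  have hocc : ∀ r ∈ H, r ≠ e → ∀ x, G.IsLink r w x → c e ∈ colors G H c x := by
    intro r hr hre x hx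
    by_contra hcon
    have hrw : c r ∈ colors G H c w := mem_colors_self hr hx.inc_left
    have hrce := hc.ne_of_inc hr heH hre hx.inc_left hew.inc_right
    -- Otherwise `m` could take the color of `r`: at `w` only `r` has it, it is absent at `w'`, and
    -- the color of `e` is absent at `v` and at `x`.
    obtain ⟨c', hc', -⟩ := hc.exists_insert hG hl hmH (a := c r) (hcu c _ hrce)
      (hcv c _ fun h => hdisj _ hrw (h ▸ hew1'))
      (fun g hg z hz => .inr (by
        obtain rfl := hHu g hg hz.inc_left
        obtain rfl := hz.right_unique hew
        refine ⟨hcv c _ hcee, fun h hh y hy hhr => ?_⟩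
        obtain rfl : h = r := by
          by_contra hne
          exact hc.ne_of_inc hh hr hne hy.inc_left hx.inc_left hhr
        rwa [hy.right_unique hx]))
      (fun g hg z hz => .inl (by
        obtain rfl := hHv g hg hz.inc_left
        rw [hz.right_unique hew']
        exact hdisj _ hrw))
    exact hno ⟨c', hins ▸ hc'⟩
  -- recolor `e`
  have hsmall : ∀ r ∈ H, r ≠ e → ∀ x, G.IsLink r w x →
      (colors G H c w' ∩ colors G H c x).card ≤ 1 := by
    intro r hr hre x hx
    have h1 : c e ∉ colors G H c w' := hdisj _ hew1
    have h2 : c r ∉ colors G H c w' := hdisj _ (mem_colors_self hr hx.inc_left)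
    have h3 : c r ≠ c e := hc.ne_of_inc hr heH hre hx.inc_left hew.inc_right
    have h4 : colors G H c w' ∩ colors G H c x ⊆ ((colors G H c x).erase (c e)).erase (c r) := by
      intro a ha
      rw [Finset.mem_inter] at ha
      refine Finset.mem_erase.2 ⟨?_, Finset.mem_erase.2 ⟨?_, ha.2⟩⟩
      · rintro rfl; exact h2 ha.1
      · rintro rfl; exact h1 ha.1
    refine (Finset.card_le_card h4).trans ?_
    rw [Finset.card_erase_of_mem (Finset.mem_erase.2 ⟨h3, mem_colors_self hr hx.inc_right⟩),
      Finset.card_erase_of_mem (hocc r hr hre x hx)]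
    have := card_colors_le_three (c := c) hdeg hHF x
    omega
  -- At most two edges `r` other than `e` leave `w`, and each far end blocks at most one of the
  -- three colors at `w'`.
  obtain ⟨b, hbw', hb⟩ : ∃ b ∈ colors G H c w', ∀ r ∈ H, r ≠ e → ∀ x, G.IsLink r w x →
      b ∉ colors G H c x := by
    have hR : ((inc G H w).erase e).card ≤ 2 := by
      rw [Finset.card_erase_of_mem (mem_inc.2 ⟨heH, hew.inc_right⟩)]
      have := (Finset.card_le_card (inc_mono hHF w)).trans (hdeg w)
      omega
    set N := ((inc G H w).erase e).biUnion fun r =>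
      if h : ∃ x, G.IsLink r w x then colors G H c w' ∩ colors G H c h.choose else ∅ with hN
    have hNc : N.card ≤ 2 := by
      refine (Finset.card_biUnion_le_card_mul _ _ 1 fun r hr => ?_).trans (by omega)
      split_ifs with h
      · obtain ⟨hre, hr⟩ := Finset.mem_erase.1 hr
        exact hsmall r (mem_inc.1 hr).1 hre _ h.choose_spec
      · simp
    obtain ⟨b, hb, hbN⟩ := Finset.exists_mem_notMem_of_card_lt_card
      (show N.card < (colors G H c w').card by omega)
    refine ⟨b, hb, fun r hr hre x hx hbx => hbN (Finset.mem_biUnion.2 ⟨r, Finset.mem_erase.2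
      ⟨hre, mem_inc.2 ⟨hr, hx.inc_left⟩⟩, ?_⟩)⟩
    have h : ∃ x, G.IsLink r w x := ⟨x, hx⟩
    rw [dif_pos h, h.choose_spec.right_unique hx]
    exact Finset.mem_inter.2 ⟨hb, hbx⟩
  have hH'H : H.erase e ⊆ H := Finset.erase_subset _ _
  have hwu : ∀ r ∈ H.erase e, ¬ G.Inc r u := fun r hr h =>
    Finset.ne_of_mem_erase hr (hHu r (hH'H hr) h)
  obtain ⟨c1, hc1, hc1c, hc1e⟩ := (hc.mono hH'H).exists_insert hG hew (Finset.notMem_erase e H)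
    (a := b)
    (fun h => by
      obtain ⟨r, hr, hru, _⟩ := mem_colors.1 h
      exact hwu r hr hru)
    (fun h => hdisj _ (colors_mono hH'H w h) hbw')
    (fun r hr x hx => absurd hx.inc_left (hwu r hr))
    (fun r hr x hx => .inl fun h =>
      hb r (hH'H hr) (Finset.ne_of_mem_erase hr) x hx (colors_mono hH'H x h))
  rw [Finset.insert_erase heH] at hc1
  -- The old color of `e` has disappeared from `w` and never occurred at `w'`, so it is available
  -- for `m`.
  refine hfar c1 hc1 (c e) ?_ ?_ ?_ ?_
  · rw [hc1e]; rintro rfl; exact hdisj _ hew1 hbw'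
  · rwa [hc1c e' (Finset.mem_erase.2 ⟨hee.symm, heH'⟩)]
  · intro h
    obtain ⟨r, hr, hrw, hre⟩ := mem_colors.1 h
    by_cases hne : r = e
    · subst hne
      rw [hc1e] at hre
      exact hdisj _ hew1 (hre ▸ hbw')
    · rw [hc1c r (Finset.mem_erase.2 ⟨hne, hr⟩)] at hre
      exact hc.ne_of_inc hr heH hne hrw hew.inc_right hre
  · intro h
    obtain ⟨r, hr, hrw, hre⟩ := mem_colors.1 h
    by_cases hne : r = e
    · subst hne
      exact hdisj _ hew1 (mem_colors_self hr hrw)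
    · rw [hc1c r (Finset.mem_erase.2 ⟨hne, hr⟩)] at hre
      exact hdisj _ hew1 (hre ▸ mem_colors_self hr hrw)

/-- Two parallel edges at a vertex of degree two are reducible for six colors. -/
lemma exists_starOn_of_parallel (hG : G.Loopless) (hdeg : ∀ v, (inc G F v).card ≤ 3)
    (hmin : ∀ H ⊂ F, ∃ c : β → Fin 6, StarOn G H c) {f g : β} {u v : α} (hf : f ∈ core G F)
    (hg : g ∈ core G F) (hfg : f ≠ g) (hfl : G.IsLink f u v) (hgl : G.IsLink g u v)
    (hu : (inc G (core G F) u).card = 2) : ∃ c : β → Fin 6, StarOn G F c := by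
  classical
  by_contra hno
  obtain ⟨hu2, e, he, hef, heu, hincu⟩ := exists_core_edge_of_card_eq_two hf hfl.inc_left hu
  have hfF := core_subset hf
  obtain rfl : g = e := by
    rcases hincu g (core_subset hg) hgl.inc_left with h | h | h
    exacts [absurd h.symm hfg, h, absurd hg (mem_pendants.1 h).2]
  have hfu : ∀ h ∈ F.erase f, G.Inc h u → h = g := by
    intro h hh hhu
    rcases hincu h (Finset.mem_of_mem_erase hh) hhu with h1 | h1 | h1
    · exact absurd h1 (Finset.ne_of_mem_erase hh)
    · exact h1
    · exfalso
      have hp := isPendant_of_mem_pendants hu2 h1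
      obtain ⟨c, hc⟩ := hmin _ (Finset.erase_ssubset hp.mem)
      exact hno (exists_starOn_of_pendant_of_parallel hG (by norm_num) hdeg hp hf hg hfg hfl hgl hc)
  have hgH : g ∈ F.erase f := Finset.mem_erase.2 ⟨hfg.symm, core_subset hg⟩
  obtain ⟨c, hc⟩ := hmin _ (Finset.erase_ssubset hfF)
  have hfv : f ∈ inc G F v := mem_inc.2 ⟨hfF, hfl.inc_right⟩
  have hcv : (colors G (F.erase f) c v).card ≤ 2 := by
    refine (card_colors_le v).trans ?_
    rw [inc_erase, Finset.card_erase_of_mem hfv]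
    have := hdeg v
    omega
  obtain ⟨T, hT, hvT⟩ : ∃ T : Finset (Fin 6), T.card ≤ 3 ∧
      ∀ h ∈ F.erase f, h ≠ g → ∀ w, G.IsLink h v w → colors G (F.erase f) c w ⊆ T := by
    have hcard : ((inc G (F.erase f) v).erase g).card ≤ 1 := by
      rw [Finset.card_erase_of_mem (mem_inc.2 ⟨hgH, hgl.inc_right⟩), inc_erase,
        Finset.card_erase_of_mem hfv]
      have := hdeg v
      omega
    rcases ((inc G (F.erase f) v).erase g).eq_empty_or_nonempty with h0 | ⟨h, hh⟩
    · refine ⟨∅, by simp, fun h hh hhg w hw => ?_⟩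
      have : h ∈ (inc G (F.erase f) v).erase g :=
        Finset.mem_erase.2 ⟨hhg, mem_inc.2 ⟨hh, hw.inc_left⟩⟩
      simp [h0] at this
    · obtain ⟨hhH, w, hw⟩ := mem_inc.1 (Finset.mem_of_mem_erase hh)
      refine ⟨colors G (F.erase f) c w, card_colors_le_three hdeg (Finset.erase_subset _ _) w,
        fun h' hh' hhg' w' hw' => ?_⟩
      obtain rfl : h' = h := Finset.card_le_one.1 hcard h'
        (Finset.mem_erase.2 ⟨hhg', mem_inc.2 ⟨hh', hw'.inc_left⟩⟩) h hh
      rw [hw'.right_unique hw]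
  -- At most two colors at `v` and three at its possible third neighbor are forbidden; the palette
  -- at `u` consists of the color of `g`.
  obtain ⟨a, ha⟩ := exists_notMem_of_card_lt (colors G (F.erase f) c v ∪ T) (by
    have := Finset.card_union_le (colors G (F.erase f) c v) T
    omega)
  rw [Finset.mem_union, not_or] at ha
  have hau : a ∉ colors G (F.erase f) c u := by
    intro h
    obtain ⟨i, hi, hiu, rfl⟩ := mem_colors.1 h
    obtain rfl := hfu i hi hiu
    exact ha.1 (mem_colors_self hi hgl.inc_right)
  obtain ⟨c', hc', -⟩ := hc.exists_insert hG hfl (Finset.notMem_erase f F) hau ha.1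
    (fun i hi w hw => .inl (by
      obtain rfl := hfu i hi hw.inc_left
      rw [hw.right_unique hgl]
      exact ha.1))
    (fun i hi w hw => .inl (by
      by_cases hig : i = g
      · subst hig
        rw [hw.right_unique hgl.symm]
        exact hau
      · exact fun h => ha.2 (hvT i hi hig w hw h)))
  exact hno ⟨c', by rwa [Finset.insert_erase hfF] at hc'⟩

end
-- Six colors: a vertex of degree three with neighbors of degree two
section

variable {α β : Type*} {k : ℕ} {G : Graph α β} {F H : Finset β} {c : β → Fin k}

open Classical in
/-- Adding edges whose colors do not occur at distance at most one. -/
lemma StarOn.union_of_far (hG : G.Loopless) (hs : StarOn G H c) {Q : Finset β}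
    (hQ : ∀ q ∈ Q, q ∈ E(G))
    (hfar : ∀ q ∈ Q, ∀ y, G.Inc q y → c q ∉ colors G ((H ∪ Q).erase q) c y ∧
      ∀ f ∈ (H ∪ Q).erase q, ∀ w, G.IsLink f y w → c q ∉ colors G ((H ∪ Q).erase q) c w) :
    StarOn G (H ∪ Q) c := by
  have key : ∀ R, R ⊆ Q → StarOn G (H ∪ R) c := by
    intro R
    induction R using Finset.induction_on with
    | empty => simpa using hs
    | insert q R hq ih =>
      intro hR
      have hqQ := hR (Finset.mem_insert_self q R)
      have ih' := ih ((Finset.subset_insert q R).trans hR)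
      rw [Finset.union_insert]
      by_cases hqH : q ∈ H ∪ R
      · rwa [Finset.insert_eq_of_mem hqH]
      have hsub : H ∪ R ⊆ (H ∪ Q).erase q := by
        intro e he
        refine Finset.mem_erase.2 ⟨by rintro rfl; exact hqH he, ?_⟩
        exact Finset.union_subset_union_right ((Finset.subset_insert q R).trans hR) he
      obtain ⟨x, y, hl⟩ := G.exists_isLink_of_mem_edgeSet (hQ q hqQ)
      have hx := hfar q hqQ x hl.inc_left
      have hy := hfar q hqQ y hl.inc_right
      exact ih'.insert_edge_of_far hG hl hqH (fun h => hx.1 (colors_mono hsub _ h))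
        (fun h => hy.1 (colors_mono hsub _ h))
        (fun f hf w hw h => hx.2 f (hsub hf) w hw (colors_mono hsub _ h))
        (fun f hf w hw h => hy.2 f (hsub hf) w hw (colors_mono hsub _ h))
  exact key Q subset_rfl

open Classical in
/-- Adding all edges at a vertex `v`. -/
lemma StarOn.union_star (hG : G.Loopless) (hs : StarOn G H c) {N : Finset β} {v : α}
    (hHv : ∀ e ∈ H, ¬ G.Inc e v) (hNv : ∀ g ∈ N, G.Inc g v)
    (hinj : ∀ g ∈ N, ∀ g' ∈ N, g ≠ g' → c g ≠ c g')
    (hpar : ∀ g ∈ N, ∀ g' ∈ N, g ≠ g' → ∀ u, G.IsLink g v u → ¬ G.Inc g' u)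
    (hfar : ∀ g ∈ N, ∀ u, G.IsLink g v u → c g ∉ colors G H c u ∧
      ∀ f ∈ H, ∀ w, G.IsLink f u w → c g ∉ colors G H c w)
    (hswap : ∀ g ∈ N, ∀ g' ∈ N, g ≠ g' → ∀ u u', G.IsLink g v u → G.IsLink g' v u' →
      ¬ (c g' ∈ colors G H c u ∧ c g ∈ colors G H c u')) :
    StarOn G (H ∪ N) c := by
  have key : ∀ R, R ⊆ N → StarOn G (H ∪ R) c := by
    intro R
    induction R using Finset.induction_on with
    | empty => simpa using hs
    | insert g R hgR ih =>
      intro hR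
      have hgN := hR (Finset.mem_insert_self g R)
      have hRN := (Finset.subset_insert g R).trans hR
      have ih' := ih hRN
      rw [Finset.union_insert]
      obtain ⟨u, hl⟩ := hNv g hgN
      have hgH : g ∉ H ∪ R := by
        rw [Finset.mem_union, not_or]
        exact ⟨fun h => hHv g h (hNv g hgN), hgR⟩
      -- the new edges do not use the color of `g`
      have hcol : ∀ x, c g ∈ colors G (H ∪ R) c x → c g ∈ colors G H c x := by
        intro x hx
        obtain ⟨e, he, hex, hec⟩ := mem_colors.1 hx
        rcases Finset.mem_union.1 he with he | he
        · exact mem_colors.2 ⟨e, he, hex, hec⟩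
        · exact absurd hec (hinj e (hRN he) g hgN (by rintro rfl; exact hgR he))
      have hcol' : ∀ g' ∈ R, ∀ x, ¬ G.Inc g' x → c g' ∈ colors G (H ∪ R) c x →
          c g' ∈ colors G H c x := by
        intro g' hg' x hgx hx
        obtain ⟨e, he, hex, hec⟩ := mem_colors.1 hx
        rcases Finset.mem_union.1 he with he | he
        · exact mem_colors.2 ⟨e, he, hex, hec⟩
        · by_cases hee : e = g'
          · exact absurd (hee ▸ hex) hgx
          · exact absurd hec (hinj e (hRN he) g' (hRN hg') hee)
      have hnot : ∀ x, c g ∉ colors G H c x → c g ∉ colors G (H ∪ R) c x :=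
        fun x h h' => h (hcol x h')
      have hcv : c g ∉ colors G H c v := fun h => by
        obtain ⟨e, he, hev, _⟩ := mem_colors.1 h
        exact hHv e he hev
      refine ih'.insert_edge hG hl.symm hgH (hnot u (hfar g hgN u hl).1) (hnot v hcv)
        (fun f hf w hw => .inl ?_) (fun f hf w hw => ?_)
      · rcases Finset.mem_union.1 hf with hf | hf
        · exact hnot w ((hfar g hgN u hl).2 f hf w hw)
        · exact absurd hw.inc_left
            (hpar g hgN f (hRN hf) (by rintro rfl; exact hgR hf) u hl)
      · have hfR : f ∈ R := (Finset.mem_union.1 hf).resolve_left fun h => hHv f h hw.inc_left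
        have hgf : g ≠ f := by rintro rfl; exact hgR hfR
        -- If the color of `g` recurs at the end `w` of an earlier edge `f`, then `hswap` keeps the
        -- color of `f` away from `u`, and `hfar` for `f` keeps it from recurring beyond `w`.
        by_cases hgw : c g ∈ colors G H c w
        · refine .inr ⟨fun h => ?_, fun h hh x hx hhg hfx => ?_⟩
          · have h1 := hcol' f hfR u (hpar g hgN f (hRN hfR) hgf u hl) h
            exact hswap g hgN f (hRN hfR) hgf u w hl hw ⟨h1, hgw⟩
          · rcases Finset.mem_union.1 hh with hh | hh
            · have hfx' : ¬ G.Inc f x := by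
                intro h1
                rcases h1.eq_or_eq_of_isLink hw with rfl | rfl
                · exact hHv h hh hx.inc_right
                · exact hx.ne rfl
              exact (hfar f (hRN hfR) w hw).2 h hh x hx (hcol' f hfR x hfx' hfx)
            · exact absurd hhg (hinj h (hRN hh) g hgN (by rintro rfl; exact hgR hh))
        · exact .inl (hnot w hgw)
  exact key N subset_rfl

lemma exists_mem_ne_ne {γ : Type*} [DecidableEq γ] {L : Finset γ} (h : 3 ≤ L.card) (x y : γ) :
    ∃ z ∈ L, z ≠ x ∧ z ≠ y := by
  obtain ⟨z, hz, hz'⟩ := Finset.exists_mem_notMem_of_card_lt_card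
    (show ({x, y} : Finset γ).card < L.card from Finset.card_le_two.trans_lt h)
  exact ⟨z, hz, by simpa using hz'⟩

lemma exists_mem_ne_of_two {γ : Type*} [DecidableEq γ] {L : Finset γ} (h : 2 ≤ L.card) (x : γ) :
    ∃ z ∈ L, z ≠ x := Finset.exists_mem_ne (by omega) x

/-- Distinct representatives `gᵢ ∈ Lᵢ` avoiding prescribed coincidences. -/
lemma exists_distinct_representatives {γ : Type*} [DecidableEq γ] {L₁ L₂ L₃ : Finset γ}
    {c₁ c₂ c₃ : γ} (h₁ : 3 ≤ L₁.card) (h₂ : 3 ≤ L₂.card) (h₃ : 3 ≤ L₃.card)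
    (hc₁ : c₁ ∉ L₁) (hc₂ : c₂ ∉ L₂) (hc₃ : c₃ ∉ L₃) :
    ∃ g₁ ∈ L₁, ∃ g₂ ∈ L₂, ∃ g₃ ∈ L₃, (g₁ ≠ g₂ ∧ g₁ ≠ g₃ ∧ g₂ ≠ g₃) ∧
      (¬ (g₁ = c₂ ∧ g₂ = c₁) ∧ ¬ (g₁ = c₃ ∧ g₃ = c₁) ∧ ¬ (g₂ = c₃ ∧ g₃ = c₂)) ∧
      (¬ (g₁ = c₂ ∧ g₁ = c₃) ∧ ¬ (g₂ = c₁ ∧ g₂ = c₃) ∧ ¬ (g₃ = c₁ ∧ g₃ = c₂)) := by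
  -- If two of the `cᵢ` coincide, their own lists already miss this color. It suffices that the
  -- third representative avoids it as well.
  by_cases h12 : c₁ = c₂
  · obtain ⟨g₃, hg₃, h3, -⟩ := exists_mem_ne_ne h₃ c₁ c₁
    obtain ⟨g₁, hg₁, h13, -⟩ := exists_mem_ne_ne h₁ g₃ g₃
    obtain ⟨g₂, hg₂, h21, h23⟩ := exists_mem_ne_ne h₂ g₁ g₃
    exact ⟨g₁, hg₁, g₂, hg₂, g₃, hg₃, by grind⟩
  by_cases h13 : c₁ = c₃
  · obtain ⟨g₂, hg₂, h2, -⟩ := exists_mem_ne_ne h₂ c₁ c₁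
    obtain ⟨g₁, hg₁, h12, -⟩ := exists_mem_ne_ne h₁ g₂ g₂
    obtain ⟨g₃, hg₃, h31, h32⟩ := exists_mem_ne_ne h₃ g₁ g₂
    exact ⟨g₁, hg₁, g₂, hg₂, g₃, hg₃, by grind⟩
  by_cases h23 : c₂ = c₃
  · obtain ⟨g₁, hg₁, h1, -⟩ := exists_mem_ne_ne h₁ c₂ c₂
    obtain ⟨g₂, hg₂, h21, -⟩ := exists_mem_ne_ne h₂ g₁ g₁
    obtain ⟨g₃, hg₃, h31, h32⟩ := exists_mem_ne_ne h₃ g₁ g₂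
    exact ⟨g₁, hg₁, g₂, hg₂, g₃, hg₃, by grind⟩
  -- distinct `cᵢ`: it suffices to avoid `g₁ = c₃`, `g₂ = c₁` and `g₃ = c₂`
  have hcard : ∀ (L : Finset γ) (x : γ), 3 ≤ L.card → 2 ≤ (L.erase x).card := fun L x h => by
    have := Finset.pred_card_le_card_erase (s := L) (a := x)
    omega
  have k1 := hcard L₁ c₃ h₁
  have k2 := hcard L₂ c₁ h₂
  have k3 := hcard L₃ c₂ h₃
  -- The second alternative covers a possible failure of Hall's condition for the shortened lists.
  -- Then `g₁ = c₃` is harmless, as `x` and `y` lie in all three lists and so differ from every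
  -- `cᵢ`.
  suffices h : (∃ g₁ ∈ L₁.erase c₃, ∃ g₂ ∈ L₂.erase c₁, ∃ g₃ ∈ L₃.erase c₂,
      g₁ ≠ g₂ ∧ g₁ ≠ g₃ ∧ g₂ ≠ g₃) ∨
      (c₃ ∈ L₁ ∧ ∃ x ∈ L₁ ∩ L₂ ∩ L₃, ∃ y ∈ L₁ ∩ L₂ ∩ L₃, x ≠ y) by
    rcases h with ⟨g₁, hg₁, g₂, hg₂, g₃, hg₃, h⟩ | ⟨h, x, hx, y, hy, hxy⟩
    · exact ⟨g₁, Finset.mem_of_mem_erase hg₁, g₂, Finset.mem_of_mem_erase hg₂, g₃,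
        Finset.mem_of_mem_erase hg₃, by grind⟩
    · exact ⟨c₃, h, x, by grind, y, by grind, by grind⟩
  -- Lists of size two have distinct representatives by a greedy choice as soon as one of these
  -- inclusions fails.
  by_cases s1 : L₁.erase c₃ ⊆ L₂.erase c₁
  swap
  · obtain ⟨x, hx, hx'⟩ := Finset.not_subset.1 s1
    obtain ⟨g₃, hg₃, h3⟩ := exists_mem_ne_of_two k3 x
    obtain ⟨g₂, hg₂, h2⟩ := exists_mem_ne_of_two k2 g₃
    exact .inl ⟨x, hx, g₂, hg₂, g₃, hg₃, by rintro rfl; exact hx' hg₂, h3.symm, h2⟩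
  by_cases s2 : L₂.erase c₁ ⊆ L₃.erase c₂
  swap
  · obtain ⟨x, hx, hx'⟩ := Finset.not_subset.1 s2
    obtain ⟨g₁, hg₁, h1⟩ := exists_mem_ne_of_two k1 x
    obtain ⟨g₃, hg₃, h3⟩ := exists_mem_ne_of_two k3 g₁
    exact .inl ⟨g₁, hg₁, x, hx, g₃, hg₃, h1, h3.symm, by rintro rfl; exact hx' hg₃⟩
  by_cases hc : c₃ ∈ L₁
  · obtain ⟨x, hx, y, hy, hxy⟩ := Finset.one_lt_card.1 (show 1 < (L₁.erase c₃).card by omega)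
    refine .inr ⟨hc, x, ?_, y, ?_, hxy⟩ <;> grind
  · have k1' : 3 ≤ (L₁.erase c₃).card := by rwa [Finset.erase_eq_of_notMem hc]
    have k2' := k1'.trans (Finset.card_le_card s1)
    have k3' := k2'.trans (Finset.card_le_card s2)
    obtain ⟨g₁, hg₁, -⟩ := exists_mem_ne_ne k1' c₁ c₁
    obtain ⟨g₂, hg₂, h21, -⟩ := exists_mem_ne_ne k2' g₁ g₁
    obtain ⟨g₃, hg₃, h31, h32⟩ := exists_mem_ne_ne k3' g₁ g₂
    exact .inl ⟨g₁, hg₁, g₂, hg₂, g₃, hg₃, h21.symm, h31.symm, h32.symm⟩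

/-- The colors of the edges `gᵢ` at a vertex and of pendant edges `eᵢ` at their other ends. -/
lemma exists_star_colors {γ : Type*} [DecidableEq γ] {L₁ L₂ L₃ : Finset γ}
    {c₁ c₂ c₃ : γ} (h₁ : 3 ≤ L₁.card) (h₂ : 3 ≤ L₂.card) (h₃ : 3 ≤ L₃.card)
    (hc₁ : c₁ ∉ L₁) (hc₂ : c₂ ∉ L₂) (hc₃ : c₃ ∉ L₃) :
    ∃ g₁ ∈ L₁, ∃ g₂ ∈ L₂, ∃ g₃ ∈ L₃, ∃ e₁ ∈ L₁, ∃ e₂ ∈ L₂, ∃ e₃ ∈ L₃,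
      (g₁ ≠ g₂ ∧ g₁ ≠ g₃ ∧ g₂ ≠ g₃) ∧ (e₁ ≠ g₁ ∧ e₂ ≠ g₂ ∧ e₃ ≠ g₃) ∧
      ¬ ((g₁ = c₂ ∨ g₁ = e₂) ∧ (g₂ = c₁ ∨ g₂ = e₁)) ∧
      ¬ ((g₁ = c₃ ∨ g₁ = e₃) ∧ (g₃ = c₁ ∨ g₃ = e₁)) ∧
      ¬ ((g₂ = c₃ ∨ g₂ = e₃) ∧ (g₃ = c₂ ∨ g₃ = e₂)) := by
  obtain ⟨g₁, hg₁, g₂, hg₂, g₃, hg₃, ⟨d12, d13, d23⟩, ⟨s1, s2, s3⟩, t1, t2, t3⟩ :=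
    exists_distinct_representatives h₁ h₂ h₃ hc₁ hc₂ hc₃
  -- Either `eᵢ` can avoid all `gⱼ` and does no harm, or `Lᵢ = {g₁, g₂, g₃}`. In the second case
  -- `cᵢ` is none of the `gⱼ`, and only the choice of `eᵢ` among the other two is left.
  have free : ∀ L : Finset γ, 3 ≤ L.card →
      (∃ e ∈ L, e ≠ g₁ ∧ e ≠ g₂ ∧ e ≠ g₃) ∨ (g₁ ∈ L ∧ g₂ ∈ L ∧ g₃ ∈ L) := by
    clear * -
    intro L hL
    by_contra! h
    obtain ⟨h, h'⟩ := h
    have hsub : L ⊆ {g₁, g₂, g₃} := by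
      intro e he
      have := h e he
      simp only [Finset.mem_insert, Finset.mem_singleton]
      tauto
    have := Finset.eq_of_subset_of_card_le hsub (Finset.card_le_three.trans hL)
    subst this
    simp at h'
  have f1 := free L₁ h₁
  have f2 := free L₂ h₂
  have f3 := free L₃ h₃
  have ne : ∀ {L : Finset γ} {c x : γ}, c ∉ L → x ∈ L → x ≠ c := fun h h' => by
    rintro rfl; exact h h'
  have n1 := ne hc₁ hg₁
  have n2 := ne hc₂ hg₂
  have n3 := ne hc₃ hg₃
  clear free h₁ h₂ h₃
  rcases f1 with ⟨e₁, he₁, f1⟩ | ⟨m11, m12, m13⟩ <;>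
  rcases f2 with ⟨e₂, he₂, f2⟩ | ⟨m21, m22, m23⟩ <;>
  rcases f3 with ⟨e₃, he₃, f3⟩ | ⟨m31, m32, m33⟩ <;>
  clear ne
  · exact ⟨g₁, hg₁, g₂, hg₂, g₃, hg₃, e₁, he₁, e₂, he₂, e₃, he₃, by grind⟩
  -- `e₃ = g₁` fails only if `c₁ = g₃`. In that case `e₃ = g₂` works because `c₁ = c₂ = g₃` is
  -- excluded; this is why one representative may not equal both foreign `cⱼ`.
  · by_cases h : c₁ = g₃
    · exact ⟨g₁, hg₁, g₂, hg₂, g₃, hg₃, e₁, he₁, e₂, he₂, g₂, m32, by grind⟩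
    · exact ⟨g₁, hg₁, g₂, hg₂, g₃, hg₃, e₁, he₁, e₂, he₂, g₁, m31, by grind⟩
  · by_cases h : c₁ = g₂
    · exact ⟨g₁, hg₁, g₂, hg₂, g₃, hg₃, e₁, he₁, g₃, m23, e₃, he₃, by grind⟩
    · exact ⟨g₁, hg₁, g₂, hg₂, g₃, hg₃, e₁, he₁, g₁, m21, e₃, he₃, by grind⟩
  · by_cases h : c₁ = g₂
    · exact ⟨g₁, hg₁, g₂, hg₂, g₃, hg₃, e₁, he₁, g₃, m23, g₁, m31, by grind⟩
    · exact ⟨g₁, hg₁, g₂, hg₂, g₃, hg₃, e₁, he₁, g₁, m21, g₂, m32, by grind⟩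
  · by_cases h : c₂ = g₁
    · exact ⟨g₁, hg₁, g₂, hg₂, g₃, hg₃, g₃, m13, e₂, he₂, e₃, he₃, by grind⟩
    · exact ⟨g₁, hg₁, g₂, hg₂, g₃, hg₃, g₂, m12, e₂, he₂, e₃, he₃, by grind⟩
  · by_cases h : c₂ = g₁
    · exact ⟨g₁, hg₁, g₂, hg₂, g₃, hg₃, g₃, m13, e₂, he₂, g₂, m32, by grind⟩
    · exact ⟨g₁, hg₁, g₂, hg₂, g₃, hg₃, g₂, m12, e₂, he₂, g₁, m31, by grind⟩
  · by_cases h : c₃ = g₁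
    · exact ⟨g₁, hg₁, g₂, hg₂, g₃, hg₃, g₂, m12, g₃, m23, e₃, he₃, by grind⟩
    · exact ⟨g₁, hg₁, g₂, hg₂, g₃, hg₃, g₃, m13, g₁, m21, e₃, he₃, by grind⟩
  · exact ⟨g₁, hg₁, g₂, hg₂, g₃, hg₃, g₂, m12, g₃, m23, g₁, m31, by grind⟩

/-- The previous lemma for a set of three indices. -/
lemma exists_star_colors_of_card_eq_three {ι γ : Type*} [DecidableEq γ] {N : Finset ι}
    (hN : N.card = 3) (L : ι → Finset γ) (c : ι → γ) (hL : ∀ i ∈ N, 3 ≤ (L i).card)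
    (hc : ∀ i ∈ N, c i ∉ L i) :
    ∃ g e : ι → γ, (∀ i ∈ N, g i ∈ L i ∧ e i ∈ L i ∧ e i ≠ g i) ∧
      ∀ i ∈ N, ∀ j ∈ N, i ≠ j → g i ≠ g j ∧
        ¬ ((g i = c j ∨ g i = e j) ∧ (g j = c i ∨ g j = e i)) := by
  classical
  obtain ⟨i₁, i₂, i₃, h12, h13, h23, rfl⟩ := Finset.card_eq_three.1 hN
  simp only [Finset.mem_insert, Finset.mem_singleton, forall_eq_or_imp, forall_eq] at hL hc
  obtain ⟨g₁, hg₁, g₂, hg₂, g₃, hg₃, e₁, he₁, e₂, he₂, e₃, he₃, h1, h2, h3, h4, h5⟩ :=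
    exists_star_colors hL.1 hL.2.1 hL.2.2 hc.1 hc.2.1 hc.2.2
  refine ⟨fun i => if i = i₁ then g₁ else if i = i₂ then g₂ else g₃,
    fun i => if i = i₁ then e₁ else if i = i₂ then e₂ else e₃, ?_, ?_⟩
  · simp only [Finset.mem_insert, Finset.mem_singleton, forall_eq_or_imp, forall_eq, h12.symm,
      h13.symm, h23.symm, if_true, if_false]
    tauto
  · simp only [Finset.mem_insert, Finset.mem_singleton, forall_eq_or_imp, forall_eq, h12.symm,
      h13.symm, h23.symm, h12, h13, h23, if_true, if_false, ne_eq, not_true, false_imp_iff,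
      true_and, and_true, not_false_eq_true, forall_const]
    exact ⟨⟨⟨h1.1, h3⟩, h1.2.1, h4⟩, ⟨⟨h1.1.symm, fun h => h3 h.symm⟩, h1.2.2, h5⟩,
      ⟨h1.2.1.symm, fun h => h4 h.symm⟩, h1.2.2.symm, fun h => h5 h.symm⟩

end
section

variable {α β : Type*} {k : ℕ} {G : Graph α β} {F H : Finset β} {c : β → Fin k}

/-- A vertex of degree three in the core with neighbors of degree two only is reducible for six
colors, provided that no two vertices of degree two are adjacent. -/
lemma exists_starOn_of_three_two (hG : G.Loopless) (hE : ∀ e ∈ F, e ∈ E(G))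
    (hdeg : ∀ v, (inc G F v).card ≤ 3)
    (hmin : ∀ H ⊂ F, ∃ c : β → Fin 6, StarOn G H c)
    (hadj : ∀ m ∈ core G F, ∀ u v, G.IsLink m u v → (inc G (core G F) u).card = 2 →
      (inc G (core G F) v).card ≠ 2) {v : α}
    (hv : (inc G (core G F) v).card = 3)
    (hnb : ∀ e ∈ core G F, ∀ u, G.IsLink e v u → (inc G (core G F) u).card = 2) :
    ∃ c : β → Fin 6, StarOn G F c := by
  classical
  by_contra hno
  set N := inc G F v with hN
  have hNcore : inc G (core G F) v = N :=
    Finset.eq_of_subset_of_card_le (inc_mono core_subset v) (by rw [hv]; exact hdeg v)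
  have hN3 : N.card = 3 := by rw [← hNcore, hv]
  have hNc : ∀ g ∈ N, g ∈ core G F := fun g hg => (mem_inc.1 (hNcore ▸ hg)).1
  have hNv : ∀ g ∈ N, G.Inc g v := fun g hg => (mem_inc.1 hg).2
  have hNmem : ∀ g ∈ F, G.Inc g v → g ∈ N := fun g hg h => mem_inc.2 ⟨hg, h⟩
  obtain ⟨g₀, hg₀⟩ : N.Nonempty := Finset.card_pos.1 (by omega)
  -- Each `g` at `v` continues as `v -g- u -f- w`. The values for `g ∉ N` are irrelevant and only
  -- make the functions total.
  have hdata : ∀ g, ∃ u f w, g ∈ N → (G.IsLink g v u ∧ (inc G (core G F) u).card = 2 ∧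
      2 ≤ (inc G F u).card ∧ f ∈ core G F ∧ f ≠ g ∧ G.IsLink f u w ∧
      ∀ h ∈ F, G.Inc h u → h = g ∨ h = f ∨ h ∈ pendants G F u) := by
    intro g
    by_cases hg : g ∈ N
    · obtain ⟨u, hu⟩ := hNv g hg
      have hu2 := hnb g (hNc g hg) u hu
      obtain ⟨h1, f, hf, hfg, ⟨w, hw⟩, hinc⟩ :=
        exists_core_edge_of_card_eq_two (hNc g hg) hu.inc_right hu2
      exact ⟨u, f, w, fun _ => ⟨hu, hu2, h1, hf, hfg, hw, hinc⟩⟩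
    · exact ⟨v, g, v, fun h => absurd h hg⟩
  choose u f w hdata using hdata
  have hgu : ∀ g ∈ N, G.IsLink g v (u g) := fun g hg => (hdata g hg).1
  have hu2 : ∀ g ∈ N, (inc G (core G F) (u g)).card = 2 := fun g hg => (hdata g hg).2.1
  have hud : ∀ g ∈ N, 2 ≤ (inc G F (u g)).card := fun g hg => (hdata g hg).2.2.1
  have hfc : ∀ g ∈ N, f g ∈ core G F := fun g hg => (hdata g hg).2.2.2.1
  have hfg : ∀ g ∈ N, f g ≠ g := fun g hg => (hdata g hg).2.2.2.2.1
  have hfw : ∀ g ∈ N, G.IsLink (f g) (u g) (w g) := fun g hg => (hdata g hg).2.2.2.2.2.1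
  have hinc : ∀ g ∈ N, ∀ h ∈ F, G.Inc h (u g) → h = g ∨ h = f g ∨ h ∈ pendants G F (u g) :=
    fun g hg => (hdata g hg).2.2.2.2.2.2
  have huinj : ∀ g ∈ N, ∀ g' ∈ N, u g = u g' → g = g' := by
    intro g hg g' hg' h
    by_contra hne
    exact hno (exists_starOn_of_parallel hG hdeg hmin (hNc g hg) (hNc g' hg') hne
      (hgu g hg).symm (h ▸ (hgu g' hg').symm) (hu2 g hg))
  have hfN : ∀ g ∈ N, f g ∉ N := by
    intro g hg h
    have h1 := (hgu (f g) h)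
    rcases (hfw g hg).inc_left.eq_or_eq_of_isLink h1 with h2 | h2
    · exact (hgu g hg).ne h2.symm
    · exact hfg g hg (huinj _ hg _ h h2).symm
  -- Since vertices of degree two are not adjacent, recoloring the pendant edges at the `u g'` does
  -- not affect the palettes at the `w g`.
  have hwu : ∀ g ∈ N, ∀ g' ∈ N, w g ≠ u g' := fun g hg g' hg' h =>
    hadj (f g) (hfc g hg) _ _ (hfw g hg) (hu2 g hg) (h ▸ hu2 g' hg')
  have hwd : ∀ g ∈ N, 2 ≤ (inc G F (w g)).card := fun g hg =>
    (mem_core.1 (hfc g hg)).2 _ (hfw g hg).inc_right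
  have hpp : ∀ g ∈ N, ∀ q ∈ pendants G F (u g), IsPendant G F q (u g) := fun g hg q hq =>
    isPendant_of_mem_pendants (hud g hg) hq
  set Q := N.biUnion fun g => pendants G F (u g) with hQ
  have mQ : ∀ q, q ∈ Q ↔ ∃ g ∈ N, q ∈ pendants G F (u g) := fun q => Finset.mem_biUnion
  have hQc : ∀ q ∈ Q, q ∈ F ∧ q ∉ core G F := fun q hq => by
    obtain ⟨g, -, h⟩ := (mQ q).1 hq
    exact ⟨(mem_pendants.1 h).1.1, (mem_pendants.1 h).2⟩
  set K := F \ (N ∪ Q) with hK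
  have mK : ∀ e, e ∈ K ↔ e ∈ F ∧ e ∉ N ∧ e ∉ Q := fun e => by
    simp only [hK, Finset.mem_sdiff, Finset.mem_union, not_or]
  have hKF : K ⊆ F := Finset.sdiff_subset
  obtain ⟨c, hc⟩ := hmin K ⟨hKF, fun h => ((mK g₀).1 (h (mem_inc.1 hg₀).1)).2.1 hg₀⟩
  have hfK : ∀ g ∈ N, f g ∈ K := fun g hg => (mK _).2
    ⟨core_subset (hfc g hg), hfN g hg, fun h => (hQc _ h).2 (hfc g hg)⟩
  -- The list of `g` consists of the at least three colors missing at `w g`. `γ g` is for `g` itself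
  -- and `ε g` for the pendant edge at `u g`.
  obtain ⟨γ, ε, h1, h2⟩ := exists_star_colors_of_card_eq_three hN3
    (fun g => Finset.univ \ colors G K c (w g)) (fun g => c (f g))
    (fun g _ => by
      have h1 := Finset.card_sdiff_add_card_eq_card (Finset.subset_univ (colors G K c (w g)))
      have h2 := card_colors_le_three (c := c) hdeg hKF (w g)
      rw [Finset.card_univ, Fintype.card_fin] at h1
      omega)
    (fun g hg h => (Finset.mem_sdiff.1 h).2 (mem_colors_self (hfK g hg) (hfw g hg).inc_right))
  have hγ : ∀ g ∈ N, γ g ∉ colors G K c (w g) := fun g hg => (Finset.mem_sdiff.1 (h1 g hg).1).2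
  have hε : ∀ g ∈ N, ε g ∉ colors G K c (w g) := fun g hg => (Finset.mem_sdiff.1 (h1 g hg).2.1).2
  have hεγ : ∀ g ∈ N, ε g ≠ γ g := fun g hg => (h1 g hg).2.2
  set c' : β → Fin 6 := fun e => if e ∈ N then γ e else
    if h : ∃ g ∈ N, e ∈ pendants G F (u g) then ε h.choose else c e with hc'
  have c'N : ∀ g ∈ N, c' g = γ g := fun g hg => if_pos hg
  have c'Q : ∀ g ∈ N, ∀ q ∈ pendants G F (u g), c' q = ε g := by
    intro g hg q hq
    have hqN : q ∉ N := fun h => (mem_pendants.1 hq).2 (hNc q h)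
    have h : ∃ g ∈ N, q ∈ pendants G F (u g) := ⟨g, hg, hq⟩
    have h4 : h.choose = g := by
      obtain ⟨h5, h6⟩ := h.choose_spec
      exact huinj _ h5 _ hg
        ((hpp g hg q hq).eq_of_inc (mem_pendants.1 h6).1.2 (hud _ h5))
    simp only [hc', if_neg hqN, dif_pos h, h4]
  have c'K : ∀ e ∈ K, c' e = c e := by
    intro e he
    obtain ⟨-, h3, h4⟩ := (mK e).1 he
    simp only [hc', if_neg h3, dif_neg (fun h => h4 ((mQ e).2 h))]
  have hKQF : K ∪ Q ⊆ F := Finset.union_subset hKF fun q hq => (hQc q hq).1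
  have hKQN : ∀ e ∈ K ∪ Q, e ∉ N := by
    intro e he heN
    rcases Finset.mem_union.1 he with h | h
    exacts [((mK e).1 h).2.1 heN, (hQc e h).2 (hNc e heN)]
  -- the edges and colors around the neighbors of `v`
  have hKQu : ∀ g ∈ N, ∀ h ∈ K ∪ Q, G.Inc h (u g) → h = f g ∨ h ∈ pendants G F (u g) := by
    intro g hg h hh hhu
    exact (hinc g hg h (hKQF hh) hhu).resolve_left fun h' => hKQN h hh (h' ▸ hg)
  have hKQw : ∀ g ∈ N, ∀ a, a ∈ colors G (K ∪ Q) c' (w g) → a ∈ colors G K c (w g) := by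
    intro g hg a ha
    obtain ⟨e, he, hew, rfl⟩ := mem_colors.1 ha
    rcases Finset.mem_union.1 he with h | h
    · rw [c'K e h]
      exact mem_colors_self h hew
    · obtain ⟨g', hg', hp⟩ := (mQ e).1 h
      exact absurd ((hpp g' hg' e hp).eq_of_inc hew (hwd g hg)) (hwu g hg g' hg')
  have hcf : ∀ g ∈ N, c' (f g) ∈ colors G K c (w g) := fun g hg => by
    rw [c'K _ (hfK g hg)]
    exact mem_colors_self (hfK g hg) (hfw g hg).inc_right
  have hcu : ∀ g ∈ N, ∀ a, a ∈ colors G (K ∪ Q) c' (u g) → a = c (f g) ∨ a = ε g := by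
    intro g hg a ha
    obtain ⟨e, he, hew, rfl⟩ := mem_colors.1 ha
    rcases hKQu g hg e he hew with rfl | h
    · exact .inl (c'K _ (hfK g hg))
    · exact .inr (c'Q g hg e h)
  have hKQ : StarOn G (K ∪ Q) c' := by
    refine (hc.congr c'K).union_of_far hG (fun q hq => hE q (hQc q hq).1) fun q hq y hy => ?_
    obtain ⟨g, hg, hqg⟩ := (mQ q).1 hq
    obtain ⟨x, hx, hx1⟩ := hpp g hg q hqg
    have hcard : (pendants G F (u g)).card ≤ 1 := by
      have := card_pendants (G := G) (F := F) (u g)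
      have := hdeg (u g)
      have := hu2 g hg
      omega
    rw [c'Q g hg q hqg]
    have hsub : (K ∪ Q).erase q ⊆ K ∪ Q := Finset.erase_subset _ _
    rcases hy.eq_or_eq_of_isLink hx with rfl | rfl
    · have hu : ∀ h ∈ (K ∪ Q).erase q, G.Inc h (u g) → h = f g := fun h hh hhu =>
        (hKQu g hg h (hsub hh) hhu).resolve_right fun hp =>
          Finset.ne_of_mem_erase hh (Finset.card_le_one.1 hcard h hp q hqg)
      refine ⟨fun ha => ?_, fun h hh z hz ha => ?_⟩
      · obtain ⟨e, he, heu, hec⟩ := mem_colors.1 ha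
        rw [hu e he heu] at hec
        exact hε g hg (hec ▸ hcf g hg)
      · obtain rfl := hu h hh hz.inc_left
        rw [hz.right_unique (hfw g hg)] at ha
        exact hε g hg (hKQw g hg _ (colors_mono hsub _ ha))
    · have hy0 : ∀ h ∈ (K ∪ Q).erase q, ¬ G.Inc h y := by
        intro h hh hhy
        have : h ∈ inc G F y := mem_inc.2 ⟨hKQF (hsub hh), hhy⟩
        rw [hx1, Finset.mem_singleton] at this
        exact Finset.ne_of_mem_erase hh this
      refine ⟨fun ha => ?_, fun h hh z hz => absurd hz.inc_left (hy0 h hh)⟩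
      obtain ⟨e, he, hey, _⟩ := mem_colors.1 ha
      exact hy0 e he hey
  have hfin : StarOn G (K ∪ Q ∪ N) c' := by
    refine hKQ.union_star hG (fun e he hev => hKQN e he (hNmem e (hKQF he) hev)) hNv
      (fun g hg g' hg' hne => ?_) (fun g hg g' hg' hne x hx hgx => ?_) (fun g hg x hx => ?_)
      (fun g hg g' hg' hne x x' hx hx' => ?_)
    · rw [c'N g hg, c'N g' hg']
      exact (h2 g hg g' hg' hne).1
    · obtain rfl := hx.right_unique (hgu g hg)
      rcases hgx.eq_or_eq_of_isLink (hgu g' hg') with h | h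
      · exact hx.ne h.symm
      · exact hne (huinj g hg g' hg' h)
    · obtain rfl := hx.right_unique (hgu g hg)
      rw [c'N g hg]
      refine ⟨fun ha => ?_, fun h hh z hz ha => ?_⟩
      · rcases hcu g hg _ ha with h | h
        · refine hγ g hg ?_
          rw [h, ← c'K _ (hfK g hg)]
          exact hcf g hg
        · exact hεγ g hg h.symm
      · rcases hKQu g hg h hh hz.inc_left with rfl | hp
        · rw [hz.right_unique (hfw g hg)] at ha
          exact hγ g hg (hKQw g hg _ ha)
        · obtain ⟨y, hy, hy1⟩ := hpp g hg h hp
          obtain rfl := hz.right_unique hy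
          obtain ⟨e, he, hez, hec⟩ := mem_colors.1 ha
          have : e ∈ inc G F z := mem_inc.2 ⟨hKQF he, hez⟩
          rw [hy1, Finset.mem_singleton] at this
          subst this
          rw [c'Q g hg e hp] at hec
          exact hεγ g hg hec
    · obtain rfl := hx.right_unique (hgu g hg)
      obtain rfl := hx'.right_unique (hgu g' hg')
      rw [c'N g hg, c'N g' hg']
      rintro ⟨ha, hb⟩
      exact (h2 g hg g' hg' hne).2 ⟨hcu g' hg' _ hb, hcu g hg _ ha⟩
  have hF : K ∪ Q ∪ N = F := by
    ext e
    simp only [Finset.mem_union, mK]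
    constructor
    · rintro ((h | h) | h)
      exacts [h.1, (hQc e h).1, (mem_inc.1 h).1]
    · tauto
  exact hno ⟨c', hF ▸ hfin⟩

/-- A finite subcubic set of edges all of whose subsets have average degree less than `5/2` is
star `6`-edge-colorable. -/
theorem exists_starOn_six (hG : G.Loopless) (F : Finset β) (hE : ∀ e ∈ F, e ∈ E(G))
    (hdeg : ∀ v, (inc G F v).card ≤ 3)
    (hsp : ∀ S ⊆ F, S.Nonempty → 4 * S.card < 5 * (ends G S).card) :
    ∃ c : β → Fin 6, StarOn G F c := by
  induction F using Finset.strongInduction with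
  | H F ih =>
    by_contra hno
    have hmin : ∀ H ⊂ F, ∃ c : β → Fin 6, StarOn G H c := fun H hH =>
      ih H hH (fun e he => hE e (hH.1 he))
        (fun v => (Finset.card_le_card (inc_mono hH.1 v)).trans (hdeg v))
        fun S hS => hsp S (hS.trans hH.1)
    have hadj : ∀ m ∈ core G F, ∀ u v, G.IsLink m u v → (inc G (core G F) u).card = 2 →
        (inc G (core G F) v).card ≠ 2 := fun m hm u v hl hu hv =>
      hno (exists_starOn_of_adjacent_two hG hdeg hmin hm hl hu hv)
    rcases exists_of_average_lt_five_halves hG (fun e he => hE e (core_subset he))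
      (core_degree hG (by norm_num) hdeg hmin hno)
      (hsp _ core_subset (core_nonempty hG (by norm_num) hE hdeg hmin hno)) with
      ⟨m, hm, u, v, hl, hu, hv⟩ | ⟨v, hv, hnb⟩
    · exact hadj m hm u v hl hu hv
    · exact hno (exists_starOn_of_three_two hG hE hdeg hmin hadj hv hnb)

end

/-! ### Four colors: forests and cyclic arcs -/

/-- At the vertex `p`, the color of `f` occurs at the other end of `e`. -/
structure Arc {α β : Type*} {k : ℕ} (G : Graph α β) (F : Finset β) (c : β → Fin k) (p : α)
    (e f : β) : Prop where
  mem_left : e ∈ F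
  mem_right : f ∈ F
  ne : e ≠ f
  inc : G.Inc f p
  exists_link : ∃ x, G.IsLink e p x ∧ c f ∈ colors G F c x

/-- A star edge-coloring for which the arcs at every vertex are part of a cyclic order. -/
structure CyclicOn {α β : Type*} {k : ℕ} (G : Graph α β) (F : Finset β) (c : β → Fin k) :
    Prop extends StarOn G F c where
  out_unique : ∀ p e f f', Arc G F c p e f → Arc G F c p e f' → f = f'
  in_unique : ∀ p e e' f, Arc G F c p e f → Arc G F c p e' f → e = e'

section

variable {α β : Type*} {k : ℕ} {G : Graph α β} {F H : Finset β} {c c' : β → Fin k}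

lemma Arc.congr {p : α} {e f : β} (h : ∀ e ∈ F, c' e = c e) (ha : Arc G F c' p e f) :
    Arc G F c p e f := by
  obtain ⟨h1, h2, h3, h4, x, hx, h5⟩ := ha
  exact ⟨h1, h2, h3, h4, x, hx, by rwa [colors_congr h, h f h2] at h5⟩

lemma CyclicOn.congr (hs : CyclicOn G F c) (h : ∀ e ∈ F, c' e = c e) : CyclicOn G F c' :=
  ⟨hs.toStarOn.congr h,
    fun p e f f' h1 h2 => hs.out_unique p e f f' (h1.congr h) (h2.congr h),
    fun p e e' f h1 h2 => hs.in_unique p e e' f (h1.congr h) (h2.congr h)⟩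

-- The new edge creates an arc `f → m` at `y` when its color occurs at the far end `w` of `f`, and
-- an arc `f → r` at `w` when `r` has its color. `hback` keeps the coloring star; `hpar`, `hone`,
-- `hout` and `hin` keep in- and outdegrees at most one.
open Classical in
lemma CyclicOn.insert_pendant (hG : G.Loopless) (hs : CyclicOn G H c) {m : β} {x y : α}
    (hm : G.IsLink m y x) (hmH : m ∉ H) (hx : ∀ e ∈ H, ¬ G.Inc e x)
    (hy : c m ∉ colors G H c y)
    (hpar : ∀ f ∈ H, ∀ f' ∈ H, ∀ w, G.IsLink f y w → G.IsLink f' y w → f = f')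
    (hone : ∀ f ∈ H, ∀ f' ∈ H, ∀ w w', G.IsLink f y w → G.IsLink f' y w' →
      c m ∈ colors G H c w → c m ∈ colors G H c w' → f = f')
    (hout : ∀ f ∈ H, ∀ w, G.IsLink f y w → c m ∈ colors G H c w →
      ∀ g ∈ H, g ≠ f → G.Inc g y → c g ∉ colors G H c w)
    (hback : ∀ f ∈ H, ∀ w, G.IsLink f y w → ∀ r ∈ H, ∀ z, G.IsLink r w z → c r = c m →
      c f ∉ colors G H c z)
    (hin : ∀ f ∈ H, ∀ w, G.IsLink f y w → ∀ r ∈ H, G.Inc r w → c r = c m →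
      ∀ s ∈ H, s ≠ f → s ≠ r → ∀ z, G.IsLink s w z → c m ∉ colors G H c z) :
    CyclicOn G (insert m H) c := by
  have hx0 : ∀ a, a ∉ colors G H c x := fun a h => by
    obtain ⟨e, he, hex, _⟩ := mem_colors.1 h
    exact hx e he hex
  have hstar : StarOn G (insert m H) c :=
    hs.insert_edge hG hm hmH hy (hx0 _)
      (fun f hf w hw => .inr ⟨hx0 _, fun r hr z hz hrm => hback f hf w hw r hr z hz hrm⟩)
      (fun f hf w hw => absurd hw.inc_left (hx f hf))
  have hcol : ∀ z a, a ∈ colors G (insert m H) c z →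
      (a = c m ∧ (z = y ∨ z = x)) ∨ a ∈ colors G H c z := by
    intro z a ha
    obtain ⟨e, he, hez, rfl⟩ := mem_colors.1 ha
    rcases Finset.mem_insert.1 he with rfl | he
    · exact .inl ⟨rfl, hez.eq_or_eq_of_isLink hm⟩
    · exact .inr (mem_colors_self he hez)
  -- the new arcs
  have harc : ∀ p e f, Arc G (insert m H) c p e f → Arc G H c p e f ∨
      (e ∈ H ∧ G.IsLink e y p ∧ f ∈ H ∧ G.Inc f p ∧ c f = c m ∧ e ≠ f) ∨
      (p = y ∧ f = m ∧ e ∈ H ∧ ∃ w, G.IsLink e y w ∧ c m ∈ colors G H c w) := by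
    rintro p e f ⟨he, hf, hne, hfp, z, hz, hc⟩
    rcases Finset.mem_insert.1 he with rfl | he₀
    · exfalso
      have hfH : f ∈ H := (Finset.mem_insert.1 hf).resolve_left hne.symm
      rcases hm.eq_and_eq_or_eq_and_eq hz with ⟨rfl, rfl⟩ | ⟨rfl, rfl⟩
      · rcases hcol _ _ hc with ⟨h1, -⟩ | h1
        · exact hy (h1 ▸ mem_colors_self hfH hfp)
        · exact hx0 _ h1
      · exact hx f hfH hfp
    · rcases Finset.mem_insert.1 hf with rfl | hf₀
      · rcases hfp.eq_or_eq_of_isLink hm with rfl | rfl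
        · refine .inr (.inr ⟨rfl, rfl, he₀, z, hz, ?_⟩)
          rcases hcol _ _ hc with ⟨-, rfl | rfl⟩ | h1
          · exact absurd rfl hz.ne
          · exact absurd hz.inc_right (hx e he₀)
          · exact h1
        · exact absurd hz.inc_left (hx e he₀)
      · rcases hcol _ _ hc with ⟨h1, rfl | rfl⟩ | h1
        · exact .inr (.inl ⟨he₀, hz.symm, hf₀, hfp, h1, hne⟩)
        · exact absurd hz.inc_right (hx e he₀)
        · exact .inl ⟨he₀, hf₀, hne, hfp, z, hz, h1⟩
  have hout' : ∀ e ∈ H, ∀ w, G.IsLink e y w → ∀ r ∈ H, G.Inc r w → c r = c m → ∀ f,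
      Arc G H c w e f → f = r := by
    rintro e he w hew r hr hrw hrm f ⟨-, hf, hne, hfw, z, hz, hc⟩
    obtain rfl := hz.right_unique hew.symm
    exfalso
    obtain ⟨g, hg, hgz, hgf⟩ := mem_colors.1 hc
    have hgfe : g ≠ e := by
      rintro rfl
      exact hs.proper g hg f hf w hne hew.inc_right hfw hgf
    exact hout e he w hew (mem_colors.2 ⟨r, hr, hrw, hrm⟩) g hg hgfe hgz
      (mem_colors.2 ⟨f, hf, hfw, hgf.symm⟩)
  have hout'' : ∀ e, ∀ w, G.IsLink e y w → c m ∈ colors G H c w → ∀ f,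
      ¬ Arc G H c y e f := by
    rintro e w hew hmw f ⟨he, hf, hne, hfy, z, hz, hc⟩
    obtain rfl := hz.right_unique hew
    exact hout e he z hew hmw f hf hne.symm hfy hc
  have hin' : ∀ e ∈ H, ∀ w, G.IsLink e y w → ∀ r ∈ H, G.Inc r w → c r = c m → ∀ s,
      Arc G H c w s r → s = e := by
    rintro e he w hew r hr hrw hrm s ⟨hs', -, hne, -, z, hz, hc⟩
    by_contra hse
    exact hin e he w hew r hr hrw hrm s hs' hse hne z hz (hrm ▸ hc)
  refine ⟨hstar, fun p e f f' h1 h2 => ?_, fun p e e' f h1 h2 => ?_⟩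
  · rcases harc _ _ _ h1 with a1 | ⟨he, hep, hf, hfp, hfm, -⟩ | ⟨rfl, rfl, he, w, hw, hmw⟩
    · rcases harc _ _ _ h2 with a2 | ⟨he, hep, hf, hfp, hfm, -⟩ | ⟨rfl, rfl, he, w, hw, hmw⟩
      · exact hs.out_unique p e f f' a1 a2
      · exact hout' e he p hep f' hf hfp hfm f a1
      · exact absurd a1 (hout'' e w hw hmw f)
    · rcases harc _ _ _ h2 with a2 | ⟨-, -, hf', hfp', hfm', -⟩ | ⟨rfl, rfl, -⟩
      · exact (hout' e he p hep f hf hfp hfm f' a2).symm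
      · by_contra hne
        exact hs.proper f hf f' hf' p hne hfp hfp' (hfm.trans hfm'.symm)
      · exact absurd rfl hep.ne
    · rcases harc _ _ _ h2 with a2 | ⟨-, hep, -⟩ | ⟨-, rfl, -⟩
      · exact absurd a2 (hout'' e w hw hmw f')
      · exact absurd rfl hep.ne
      · rfl
  · rcases harc _ _ _ h1 with a1 | ⟨he, hep, hf, hfp, hfm, -⟩ | ⟨rfl, rfl, he, w, hw, hmw⟩
    · rcases harc _ _ _ h2 with a2 | ⟨he, hep, hf, hfp, hfm, -⟩ | ⟨rfl, rfl, he, w, hw, hmw⟩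
      · exact hs.in_unique p e e' f a1 a2
      · exact hin' e' he p hep f hf hfp hfm e a1
      · exact absurd a1.mem_right hmH
    · rcases harc _ _ _ h2 with a2 | ⟨he', hep', -⟩ | ⟨rfl, rfl, -⟩
      · exact (hin' e he p hep f hf hfp hfm e' a2).symm
      · exact hpar e he e' he' p hep hep'
      · exact absurd rfl hep.ne
    · rcases harc _ _ _ h2 with a2 | ⟨-, hep, -⟩ | ⟨-, -, he', w', hw', hmw'⟩
      · exact absurd a2.mem_right hmH
      · exact absurd rfl hep.ne
      · exact hone e he e' he' w w' hw hw' hmw hmw'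

open Classical in
/-- A pendant edge at a vertex with at most one core edge can be colored with four colors. -/
lemma exists_cyclicOn_of_pendant (hG : G.Loopless) {c : β → Fin 4}
    (hdeg : ∀ v, (inc G F v).card ≤ 3)
    (hpar : ∀ f ∈ F, ∀ f' ∈ F, ∀ y w, G.IsLink f y w → G.IsLink f' y w → f = f')
    {e : β} {y : α} (he : IsPendant G F e y)
    (hy : (inc G (core G F) y).card ≤ 1) (hs : CyclicOn G (F.erase e) c) :
    ∃ c' : β → Fin 4, CyclicOn G F c' := by
  have hins : insert e (F.erase e) = F := Finset.insert_erase he.mem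
  set H := F.erase e with hH
  have hHF : H ⊆ F := Finset.erase_subset _ _
  have heH : e ∉ H := Finset.notMem_erase e F
  obtain ⟨x, hl, hx⟩ := id he
  have hx' : ∀ g ∈ H, ¬ G.Inc g x := by
    intro g hg hgx
    have : g ∈ inc G F x := mem_inc.2 ⟨hHF hg, hgx⟩
    rw [hx, Finset.mem_singleton] at this
    exact heH (this ▸ hg)
  have hey : (inc G H y).card ≤ 2 := by
    rw [hH, inc_erase, Finset.card_erase_of_mem (mem_inc.2 ⟨he.mem, he.inc_left⟩)]
    have := hdeg y
    omega
  have hcy := card_colors_le (G := G) (F := H) (c := c) y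
  -- recolor `e`
  have hsuff : ∀ a, a ∉ colors G H c y →
      (∀ f ∈ H, ∀ f' ∈ H, ∀ w w', G.IsLink f y w → G.IsLink f' y w' →
        a ∈ colors G H c w → a ∈ colors G H c w' → f = f') →
      (∀ f ∈ H, ∀ w, G.IsLink f y w → a ∈ colors G H c w →
        ∀ g ∈ H, g ≠ f → G.Inc g y → c g ∉ colors G H c w) →
      (∀ f ∈ H, ∀ w, G.IsLink f y w → ∀ r ∈ H, ∀ z, G.IsLink r w z → c r = a →
        c f ∉ colors G H c z) →
      (∀ f ∈ H, ∀ w, G.IsLink f y w → ∀ r ∈ H, G.Inc r w → c r = a →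
        ∀ s ∈ H, s ≠ f → s ≠ r → ∀ z, G.IsLink s w z → a ∉ colors G H c z) →
      ∃ c' : β → Fin 4, CyclicOn G F c' := by
    intro a ha h1 h2 h3 h4
    set c' := Function.update c e a
    have hm' : c' e = a := Function.update_self ..
    have hcc : ∀ g ∈ H, c' g = c g := fun g hg =>
      Function.update_of_ne (by rintro rfl; exact heH hg) ..
    have hcol := fun x => colors_congr (G := G) hcc x
    refine ⟨c', hins ▸ (hs.congr hcc).insert_pendant hG hl heH hx' ?_
      (fun f hf f' hf' w => hpar f (hHF hf) f' (hHF hf') y w) ?_ ?_ ?_ ?_⟩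
    · rwa [hm', hcol]
    · simpa only [hm', hcol] using h1
    · intro f hf w hw ha g hg
      rw [hm', hcol] at ha
      rw [hcc g hg, hcol]
      exact h2 f hf w hw ha g hg
    · intro f hf w hw r hr z hz
      rw [hm', hcc r hr, hcc f hf, hcol]
      exact h3 f hf w hw r hr z hz
    · intro f hf w hw r hr hrw hra s hs hsf hsr z hz
      rw [hm', hcc r hr] at hra
      rw [hm', hcol]
      exact h4 f hf w hw r hr hrw hra s hs hsf hsr z hz
  have hpend : ∀ f ∈ H, f ∉ core G F → ∀ w, G.IsLink f y w → ∀ r ∈ H, G.Inc r w → r = f := by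
    intro f hf hfc w hw r hr hrw
    have h2 : 2 ≤ (inc G F y).card := by
      refine (Finset.card_le_card fun g (hg : g ∈ ({e, f} : Finset β)) => ?_).trans' ?_
      · simp only [Finset.mem_insert, Finset.mem_singleton] at hg
        rcases hg with rfl | rfl
        · exact mem_inc.2 ⟨he.mem, he.inc_left⟩
        · exact mem_inc.2 ⟨hHF hf, hw.inc_left⟩
      · rw [Finset.card_pair (by rintro rfl; exact heH hf)]
    obtain ⟨z, hz, hz1⟩ := isPendant_of_notMem_core (hHF hf) hfc hw.inc_left h2
    obtain rfl := hw.right_unique hz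
    have : r ∈ inc G F w := mem_inc.2 ⟨hHF hr, hrw⟩
    rwa [hz1, Finset.mem_singleton] at this
  have hpendc : ∀ f ∈ H, f ∉ core G F → ∀ w, G.IsLink f y w → ∀ a ∉ colors G H c y,
      a ∉ colors G H c w := by
    intro f hf hfc w hw a ha haw
    obtain ⟨r, hr, hrw, rfl⟩ := mem_colors.1 haw
    obtain rfl := hpend f hf hfc w hw r hr hrw
    exact ha (mem_colors_self hr hw.inc_left)
  have hfar : ∀ a, a ∉ colors G H c y →
      (∀ f ∈ core G F, ∀ w, G.IsLink f y w → a ∉ colors G H c w) →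
      ∃ c' : β → Fin 4, CyclicOn G F c' := by
    intro a ha hc
    have hw' : ∀ f ∈ H, ∀ w, G.IsLink f y w → a ∉ colors G H c w := by
      intro f hf w hw
      by_cases hfc : f ∈ core G F
      · exact hc f hfc w hw
      · exact hpendc f hf hfc w hw a ha
    exact hsuff a ha (fun f hf _ _ w _ hw _ h => absurd h (hw' f hf w hw))
      (fun f hf w hw h => absurd h (hw' f hf w hw))
      (fun f hf w hw r hr z hz h => absurd (mem_colors.2 ⟨r, hr, hz.inc_left, h⟩) (hw' f hf w hw))
      (fun f hf w hw r hr hz h => absurd (mem_colors.2 ⟨r, hr, hz, h⟩) (hw' f hf w hw))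
  rcases (inc G (core G F) y).eq_empty_or_nonempty with h0 | ⟨f, hf⟩
  · obtain ⟨a, ha⟩ := exists_notMem_of_card_lt (colors G H c y) (by omega)
    refine hfar a ha fun f hf w hw => ?_
    have : f ∈ inc G (core G F) y := mem_inc.2 ⟨hf, hw.inc_left⟩
    simp [h0] at this
  obtain ⟨hfc, z, hz⟩ := mem_inc.1 hf
  have hfH : f ∈ H := Finset.mem_erase.2
    ⟨by rintro rfl; exact he.notMem_core hfc, core_subset hfc⟩
  have hcore : ∀ g ∈ core G F, ∀ w, G.IsLink g y w → g = f ∧ w = z := by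
    intro g hg w hw
    obtain rfl : g = f := Finset.card_le_one.1 hy g (mem_inc.2 ⟨hg, hw.inc_left⟩) f hf
    exact ⟨rfl, hw.right_unique hz⟩
  by_cases hlt : (colors G H c y ∪ colors G H c z).card < 4
  · obtain ⟨a, ha⟩ := exists_notMem_of_card_lt _ hlt
    rw [Finset.mem_union, not_or] at ha
    refine hfar a ha.1 fun g hg w hw => ?_
    rw [(hcore g hg w hw).2]
    exact ha.2
  -- All four colors occur at `y` or `z`. As `y` has at most two edges in `H` and `z` at most three,
  -- these bounds are attained and only the color of `f` is shared. The new edge must repeat the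
  -- color of one of the other edges `r`, `s` at `z`.
  have hfy : c f ∈ colors G H c y := mem_colors_self hfH hz.inc_left
  have hfz : c f ∈ colors G H c z := mem_colors_self hfH hz.inc_right
  have hcz := card_colors_le (G := G) (F := H) (c := c) z
  have hiz := (Finset.card_le_card (inc_mono hHF z)).trans (hdeg z)
  have hui := Finset.card_union_add_card_inter (colors G H c y) (colors G H c z)
  have hpos : 0 < (colors G H c y ∩ colors G H c z).card :=
    Finset.card_pos.2 ⟨c f, Finset.mem_inter.2 ⟨hfy, hfz⟩⟩
  have hint : ∀ a, a ∈ colors G H c y → a ∈ colors G H c z → a = c f := fun a h1 h2 =>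
    Finset.card_le_one.1 (by omega) a (Finset.mem_inter.2 ⟨h1, h2⟩) (c f)
      (Finset.mem_inter.2 ⟨hfy, hfz⟩)
  obtain ⟨r, s, hrs, hrs'⟩ := Finset.card_eq_two.1 (show ((inc G H z).erase f).card = 2 by
    rw [Finset.card_erase_of_mem (mem_inc.2 ⟨hfH, hz.inc_right⟩)]; omega)
  have hz3 : ∀ g ∈ H, G.Inc g z → g = f ∨ g = r ∨ g = s := by
    intro g hg hgz
    by_cases hgf : g = f
    · exact .inl hgf
    · have : g ∈ (inc G H z).erase f := Finset.mem_erase.2 ⟨hgf, mem_inc.2 ⟨hg, hgz⟩⟩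
      rw [hrs'] at this
      exact .inr (by simpa using this)
  have hmem : ∀ g, g = r ∨ g = s → g ≠ f ∧ g ∈ H ∧ G.Inc g z := by
    intro g hg
    have : g ∈ (inc G H z).erase f := by rw [hrs']; simpa using hg
    obtain ⟨h1, h2⟩ := Finset.mem_erase.1 this
    exact ⟨h1, mem_inc.1 h2⟩
  -- the color of an edge at `z` that may be repeated on `e`
  have hgood : ∀ r, r ≠ f → r ∈ H → G.Inc r z → ¬ Arc G H c z r f →
      (∀ s, s ≠ f → ¬ Arc G H c z s r) → ∃ c' : β → Fin 4, CyclicOn G F c' := by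
    intro r hrf hr hrz hback hin
    have hry : c r ∉ colors G H c y := fun h =>
      hs.proper r hr f hfH z hrf hrz hz.inc_right (hint _ h (mem_colors_self hr hrz))
    have hf' : ∀ g ∈ H, ∀ w, G.IsLink g y w → c r ∈ colors G H c w → g = f ∧ w = z := by
      intro g hg w hw hrw
      by_cases hgc : g ∈ core G F
      · exact hcore g hgc w hw
      · exact absurd hrw (hpendc g hg hgc w hw _ hry)
    have hr' : ∀ t ∈ H, G.Inc t z → c t = c r → t = r := by
      intro t ht htz htr
      by_contra hne
      exact hs.proper t ht r hr z hne htz hrz htr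
    refine hsuff (c r) hry (fun g hg g' hg' w w' hw hw' h h' => ?_)
      (fun g hg w hw h i hi hig hiy hic => ?_) (fun g hg w hw t ht x' hx' htr hgx => ?_)
      (fun g hg w hw t ht htw htr s hs' hsg hst x' hx' hrx => ?_)
    · rw [(hf' g hg w hw h).1, (hf' g' hg' w' hw' h').1]
    · obtain ⟨rfl, rfl⟩ := hf' g hg w hw h
      exact hs.proper i hi g hg y hig hiy hw.inc_left (hint _ (mem_colors_self hi hiy) hic)
    · obtain ⟨rfl, rfl⟩ := hf' g hg w hw (mem_colors.2 ⟨t, ht, hx'.inc_left, htr⟩)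
      obtain rfl := hr' t ht hx'.inc_left htr
      exact hback ⟨ht, hg, hrf, hw.inc_right, x', hx', hgx⟩
    · obtain ⟨rfl, rfl⟩ := hf' g hg w hw (mem_colors.2 ⟨t, ht, htw, htr⟩)
      obtain rfl := hr' t ht htw htr
      exact hin s hsg ⟨hs', ht, hst, htw, x', hx', hrx⟩
  obtain ⟨hrf, hr, hrz⟩ := hmem r (.inl rfl)
  obtain ⟨hsf, hs', hsz⟩ := hmem s (.inr rfl)
  have hsr : ∀ t, t ≠ f → Arc G H c z t r → t = s := fun t htf h => by
    obtain ⟨w, hw, -⟩ := h.exists_link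
    rcases hz3 t h.mem_left hw.inc_left with h1 | h1 | h1
    exacts [absurd h1 htf, absurd h1 h.ne, h1]
  have hsr' : ∀ t, t ≠ f → Arc G H c z t s → t = r := fun t htf h => by
    obtain ⟨w, hw, -⟩ := h.exists_link
    rcases hz3 t h.mem_left hw.inc_left with h1 | h1 | h1
    exacts [absurd h1 htf, h1, absurd h1 h.ne]
  -- Repeating `r` fails only through an arc `r → f` or `s → r`, repeating `s` only through `s → f`
  -- or `r → s`. Any two of these, one from each pair, violate the degree conditions or are the
  -- opposite arcs `s → r`, `r → s`.
  by_cases hgr : ¬ Arc G H c z r f ∧ ¬ Arc G H c z s r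
  · exact hgood r hrf hr hrz hgr.1 fun t htf h => hgr.2 (hsr t htf h ▸ h)
  · refine hgood s hsf hs' hsz (fun h => ?_) (fun t htf h => ?_)
    · refine hgr ⟨fun h1 => hrs (hs.in_unique z _ _ _ h1 h), fun h1 => ?_⟩
      exact hrf (hs.out_unique z _ _ _ h1 h)
    · obtain rfl := hsr' t htf h
      refine hgr ⟨fun h1 => hsf (hs.out_unique z _ _ _ h h1), fun h1 => ?_⟩
      obtain ⟨w, hw, hcw⟩ := h.exists_link
      obtain ⟨w', hw', hcw'⟩ := h1.exists_link
      refine hs.not_swap t hr s hs' z w w' hw hw' ?_ ⟨hcw, hcw'⟩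
      rintro rfl
      exact hrs (hpar t (hHF hr) s (hHF hs') z w hw hw')

/-- A finite subcubic forest is star `4`-edge-colorable. -/
theorem exists_starOn_four (hG : G.Loopless) (F : Finset β) (hE : ∀ e ∈ F, e ∈ E(G))
    (hdeg : ∀ v, (inc G F v).card ≤ 3)
    (hsp : ∀ S ⊆ F, S.Nonempty → S.card < (ends G S).card) :
    ∃ c : β → Fin 4, StarOn G F c := by
  classical
  suffices h : ∃ c : β → Fin 4, CyclicOn G F c from h.imp fun c hc => hc.toStarOn
  induction F using Finset.strongInduction with
  | H F ih =>
    rcases F.eq_empty_or_nonempty with rfl | hne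
    · exact ⟨fun _ => 0, starOn_empty _, fun p e f f' h => absurd h.mem_left (by simp),
        fun p e e' f h => absurd h.mem_left (by simp)⟩
    have hpar : ∀ f ∈ F, ∀ f' ∈ F, ∀ y w, G.IsLink f y w → G.IsLink f' y w → f = f' := by
      intro f hf f' hf' y w h h'
      by_contra hne
      have h1 := hsp {f, f'} (Finset.insert_subset hf (Finset.singleton_subset_iff.2 hf'))
        ⟨f, Finset.mem_insert_self _ _⟩
      have h2 : ends G {f, f'} ⊆ {y, w} := by
        intro v hv
        obtain ⟨g, hg, hgv⟩ := mem_ends.1 hv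
        simp only [Finset.mem_insert, Finset.mem_singleton] at hg ⊢
        rcases hg with rfl | rfl
        exacts [hgv.eq_or_eq_of_isLink h, hgv.eq_or_eq_of_isLink h']
      have h3 := (Finset.card_le_card h2).trans Finset.card_le_two
      rw [Finset.card_pair hne] at h1
      omega
    obtain ⟨e, y, hp, hy⟩ : ∃ e y, IsPendant G F e y ∧ (inc G (core G F) y).card ≤ 1 := by
      rcases (core G F).eq_empty_or_nonempty with h0 | hc
      · obtain ⟨e, he⟩ := hne
        obtain ⟨x, y, hl⟩ := G.exists_isLink_of_mem_edgeSet (hE e he)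
        have key : ∀ y, (inc G (core G F) y).card ≤ 1 := fun y => by simp [h0, inc]
        by_cases h2 : 2 ≤ (inc G F y).card
        · exact ⟨e, y, isPendant_of_notMem_core he (by simp [h0]) hl.inc_right h2, key y⟩
        · refine ⟨e, x, ⟨y, hl, ?_⟩, key x⟩
          have hmem : e ∈ inc G F y := mem_inc.2 ⟨he, hl.inc_right⟩
          refine (Finset.eq_of_subset_of_card_le (Finset.singleton_subset_iff.2 hmem) ?_).symm
          rw [Finset.card_singleton]
          omega
      -- A leaf of the core has degree at least two in `F`, hence carries a pendant edge.
      · obtain ⟨v, hv, hv1⟩ := exists_card_inc_le_one hG (fun e he => hE e (core_subset he))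
          (hsp _ core_subset hc)
        have h2 := two_le_of_mem_ends_core hv
        obtain ⟨e, he, hne⟩ := Finset.exists_of_ssubset (Finset.ssubset_iff_subset_ne.2
          ⟨inc_mono (core_subset (G := G) (F := F)) v, fun h => by rw [h] at hv1; omega⟩)
        obtain ⟨heF, hev⟩ := mem_inc.1 he
        exact ⟨e, v, isPendant_of_notMem_core heF (fun h => hne (mem_inc.2 ⟨h, hev⟩)) hev h2, hv1⟩
    have hsub : F.erase e ⊂ F := Finset.erase_ssubset hp.mem
    obtain ⟨c, hc⟩ := ih (F.erase e) hsub (fun e he => hE e (hsub.1 he))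
      (fun v => (Finset.card_le_card (inc_mono hsub.1 v)).trans (hdeg v))
      fun S hS => hsp S (hS.trans hsub.1)
    exact exists_cyclicOn_of_pendant hG hdeg hpar hp hy hc

end
-- From maximum average degree to the star chromatic index
section

variable {α β : Type*} {k : ℕ} {G : Graph α β} {F : Finset β} {c : β → Fin k}

/-- The subgraph consisting of the edges in `S` and their ends. -/
noncomputable def edgeSubgraph (G : Graph α β) (S : Finset β) : Graph α β where
  vertexSet := ends G S
  IsLink e x y := e ∈ S ∧ G.IsLink e x y
  isLink_symm _ _ := ⟨fun _ _ h => ⟨h.1, h.2.symm⟩⟩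
  eq_or_eq_of_isLink_of_isLink e x y v w h h' := h.2.left_eq_or_eq h'.2
  left_mem_of_isLink e x y h := mem_ends.2 ⟨e, h.1, h.2.inc_left⟩

lemma edgeSubgraph_le (S : Finset β) : edgeSubgraph G S ≤ G where
  vertexSet_mono := fun v hv => by
    obtain ⟨e, -, h⟩ := mem_ends.1 hv
    exact h.vertex_mem
  isLink_mono := fun e x y h => h.2

lemma edgeSet_edgeSubgraph {S : Finset β} (hS : ∀ e ∈ S, e ∈ E(G)) :
    E(edgeSubgraph G S) = S := by
  ext e
  constructor
  · intro he
    obtain ⟨x, y, h⟩ := Graph.exists_isLink_of_mem_edgeSet he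
    exact h.1
  · intro he
    obtain ⟨x, y, h⟩ := Graph.exists_isLink_of_mem_edgeSet (hS e he)
    exact Graph.IsLink.edge_mem (G := edgeSubgraph G S) ⟨he, h⟩

/-- Finiteness bounds the set of densities by `2 e(G)`, so its real supremum is a genuine upper
bound. -/
lemma le_mad (hV : V(G).Finite) (hE : E(G).Finite) {H : Graph α β} (hH : H ≤ G)
    (hne : V(H).Nonempty) : 2 * (E(H).ncard : ℝ) / (V(H).ncard : ℝ) ≤ mad G := by
  refine le_csSup ⟨2 * (E(G).ncard : ℝ), ?_⟩ ⟨H, hH, hne, rfl⟩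
  rintro d ⟨K, hK, hKne, rfl⟩
  have h1 : (E(K).ncard : ℝ) ≤ E(G).ncard := by
    exact_mod_cast Set.ncard_le_ncard hK.edgeSet_mono hE
  have h2 : (1 : ℝ) ≤ V(K).ncard := by
    exact_mod_cast (Set.ncard_pos (hV.subset hK.vertexSet_mono)).2 hKne
  calc 2 * (E(K).ncard : ℝ) / (V(K).ncard : ℝ) ≤ 2 * (E(K).ncard : ℝ) :=
        div_le_self (by positivity) h2
    _ ≤ 2 * (E(G).ncard : ℝ) := by linarith

lemma IsSubcubic.card_lt_of_mad_lt (hG : IsSubcubic G) {q : ℝ} (hq : mad G < q) {S : Finset β}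
    (hS : ∀ e ∈ S, e ∈ E(G)) (hne : S.Nonempty) :
    2 * (S.card : ℝ) < q * ((ends G S).card : ℝ) := by
  have hends : (ends G S).Nonempty := by
    obtain ⟨e, he⟩ := hne
    obtain ⟨x, y, h⟩ := Graph.exists_isLink_of_mem_edgeSet (hS e he)
    exact ⟨x, mem_ends.2 ⟨e, he, h.inc_left⟩⟩
  have h := (le_mad hG.finite_vertexSet hG.finite_edgeSet (edgeSubgraph_le S)
    (Finset.coe_nonempty.2 hends)).trans_lt hq
  have hV : V(edgeSubgraph G S) = ends G S := rfl
  rw [edgeSet_edgeSubgraph hS, hV, Set.ncard_coe_finset, Set.ncard_coe_finset, div_lt_iff₀] at h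
  · exact h
  · exact_mod_cast Finset.card_pos.2 hends

lemma IsSubcubic.card_inc_le (hG : IsSubcubic G) (F : Finset β) (v : α) :
    (inc G F v).card ≤ 3 := by
  by_cases hv : v ∈ V(G)
  · refine le_trans ?_ (hG.degree_le v hv)
    rw [← Set.ncard_coe_finset]
    exact Set.ncard_le_ncard (fun e he => (mem_inc.1 (Finset.mem_coe.1 he)).2)
      (hG.finite_edgeSet.subset (G.incidenceSet_subset_edgeSet v))
  · have : inc G F v = ∅ := Finset.eq_empty_of_forall_notMem fun e he =>
      hv (mem_inc.1 he).2.vertex_mem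
    simp [this]

/-- Only vertices two steps apart need to differ, so the cycle is the case `v₄ = v₀`. -/
lemma StarOn.not_bicolored (hs : StarOn G F c) {e₁ e₂ e₃ e₄ : β} {v₀ v₁ v₂ v₃ v₄ : α}
    (h₁ : e₁ ∈ F) (h₂ : e₂ ∈ F) (h₃ : e₃ ∈ F) (h₄ : e₄ ∈ F)
    (l₁ : G.IsLink e₁ v₀ v₁) (l₂ : G.IsLink e₂ v₁ v₂) (l₃ : G.IsLink e₃ v₂ v₃)
    (l₄ : G.IsLink e₄ v₃ v₄) (n02 : v₀ ≠ v₂) (n13 : v₁ ≠ v₃) (n24 : v₂ ≠ v₄) {a b : Fin k}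
    (k₁ : c e₁ = a ∨ c e₁ = b) (k₂ : c e₂ = a ∨ c e₂ = b) (k₃ : c e₃ = a ∨ c e₃ = b)
    (k₄ : c e₄ = a ∨ c e₄ = b) : False := by
  have d12 : c e₁ ≠ c e₂ := hs.proper _ h₁ _ h₂ v₁
    (by rintro rfl; exact n02 (l₁.symm.right_unique l₂)) l₁.inc_right l₂.inc_left
  have d23 : c e₂ ≠ c e₃ := hs.proper _ h₂ _ h₃ v₂
    (by rintro rfl; exact n13 (l₂.symm.right_unique l₃)) l₂.inc_right l₃.inc_left
  have d34 : c e₃ ≠ c e₄ := hs.proper _ h₃ _ h₄ v₃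
    (by rintro rfl; exact n24 (l₃.symm.right_unique l₄)) l₃.inc_right l₄.inc_left
  have e13 : c e₁ = c e₃ := by grind
  have e24 : c e₂ = c e₄ := by grind
  exact hs.not_swap e₂ h₂ e₃ h₃ v₂ v₁ v₃ l₂.symm l₃ n13
    ⟨mem_colors.2 ⟨e₁, h₁, l₁.inc_right, e13⟩, mem_colors.2 ⟨e₄, h₄, l₄.inc_left, e24.symm⟩⟩

lemma StarOn.starEdgeColorable (hs : StarOn G F c) (hF : ∀ e ∈ E(G), e ∈ F) :
    StarEdgeColorable G k := by
  refine ⟨fun e => c e, fun e f v hne he hf => ?_, ?_⟩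
  · exact hs.proper e (hF e e.2) f (hF f f.2) v (fun h => hne (Subtype.ext h)) he hf
  · rintro e₁ e₂ e₃ e₄ h ⟨a, b, hab⟩
    simp only [List.mem_cons, List.not_mem_nil, or_false, forall_eq_or_imp, forall_eq] at hab
    obtain ⟨k₁, k₂, k₃, k₄⟩ := hab
    rcases h with ⟨v₀, v₁, v₂, v₃, v₄, hnd, l₁, l₂, l₃, l₄⟩ | ⟨v₀, v₁, v₂, v₃, hnd, l₁, l₂, l₃, l₄⟩
    · simp only [List.nodup_cons, List.mem_cons, List.not_mem_nil, or_false, not_or] at hnd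
      exact hs.not_bicolored (hF _ e₁.2) (hF _ e₂.2) (hF _ e₃.2) (hF _ e₄.2) l₁ l₂ l₃ l₄
        hnd.1.2.1 hnd.2.1.2.1 hnd.2.2.1.2 k₁ k₂ k₃ k₄
    · simp only [List.nodup_cons, List.mem_cons, List.not_mem_nil, or_false, not_or] at hnd
      exact hs.not_bicolored (hF _ e₁.2) (hF _ e₂.2) (hF _ e₃.2) (hF _ e₄.2) l₁ l₂ l₃ l₄
        hnd.1.2.1 hnd.2.1.2 (Ne.symm hnd.1.2.1) k₁ k₂ k₃ k₄

lemma starChromaticIndex_le (hk : 1 ≤ k) (h : StarEdgeColorable G k) :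
    starChromaticIndex G ≤ k :=
  iInf₂_le (f := fun (k : ℕ) (_ : k ∈ {k : ℕ | 1 ≤ k ∧ StarEdgeColorable G k}) => (k : ℕ∞))
    k ⟨hk, h⟩

theorem IsSubcubic.starChromaticIndex_le_four (hG : IsSubcubic G) (h : mad G < 2) :
    starChromaticIndex G ≤ 4 := by
  have hm : ∀ e, e ∈ hG.finite_edgeSet.toFinset ↔ e ∈ E(G) := fun e => Set.Finite.mem_toFinset _
  obtain ⟨c, hc⟩ := exists_starOn_four hG.loopless hG.finite_edgeSet.toFinset
    (fun e he => (hm e).1 he) (hG.card_inc_le _) fun S hS hne => by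
      have := hG.card_lt_of_mad_lt h (fun e he => (hm e).1 (hS he)) hne
      exact_mod_cast (by linarith : (S.card : ℝ) < (ends G S).card)
  exact starChromaticIndex_le (by norm_num) (hc.starEdgeColorable fun e he => (hm e).2 he)

theorem IsSubcubic.starChromaticIndex_le_five (hG : IsSubcubic G) (h : mad G < 24 / 11) :
    starChromaticIndex G ≤ 5 := by
  have hm : ∀ e, e ∈ hG.finite_edgeSet.toFinset ↔ e ∈ E(G) := fun e => Set.Finite.mem_toFinset _
  obtain ⟨c, hc⟩ := exists_starOn_five hG.loopless hG.finite_edgeSet.toFinset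
    (fun e he => (hm e).1 he) (hG.card_inc_le _) fun S hS hne => by
      have := hG.card_lt_of_mad_lt h (fun e he => (hm e).1 (hS he)) hne
      exact_mod_cast (by linarith : 11 * (S.card : ℝ) < 12 * (ends G S).card)
  exact starChromaticIndex_le (by norm_num) (hc.starEdgeColorable fun e he => (hm e).2 he)

theorem IsSubcubic.starChromaticIndex_le_six (hG : IsSubcubic G) (h : mad G < 5 / 2) :
    starChromaticIndex G ≤ 6 := by
  have hm : ∀ e, e ∈ hG.finite_edgeSet.toFinset ↔ e ∈ E(G) := fun e => Set.Finite.mem_toFinset _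
  obtain ⟨c, hc⟩ := exists_starOn_six hG.loopless hG.finite_edgeSet.toFinset
    (fun e he => (hm e).1 he) (hG.card_inc_le _) fun S hS hne => by
      have := hG.card_lt_of_mad_lt h (fun e he => (hm e).1 (hS he)) hne
      exact_mod_cast (by linarith : 4 * (S.card : ℝ) < 5 * (ends G S).card)
  exact starChromaticIndex_le (by norm_num) (hc.starEdgeColorable fun e he => (hm e).2 he)

/-! ### Lower bounds: the two extremal graphs -/

/-- If `G` has star chromatic index at most `m`, then its edges have an `m`-coloring without
monochromatic adjacent edges and bicolored paths of length four. -/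
lemma exists_coloring_of_lt {m : ℕ} (h : starChromaticIndex G < (m + 2 : ℕ)) :
    ∃ c : β → Fin (m + 1), (∀ e f v, e ≠ f → G.Inc e v → G.Inc f v → c e ≠ c f) ∧
      ∀ e₁ e₂ e₃ e₄, IsPathFour G e₁ e₂ e₃ e₄ → ¬ (c e₁ = c e₃ ∧ c e₂ = c e₄) := by
  classical
  have h' : ∃ k, ∃ _ : k ∈ {k : ℕ | 1 ≤ k ∧ StarEdgeColorable G k}, (k : ℕ∞) < (m + 2 : ℕ) := by
    simpa only [starChromaticIndex, iInf_lt_iff] using h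
  obtain ⟨k, ⟨-, c, hc⟩, hk⟩ := h'
  have hk' : k ≤ m + 1 := by
    have : k < m + 2 := by exact_mod_cast hk
    omega
  have inj : Function.Injective (Fin.castLE hk') := Fin.castLE_injective hk'
  -- Labels that are not edges get color `0`; this needs a nonempty set of colors, hence `m + 1`.
  set c' : β → Fin (m + 1) := fun e => if he : e ∈ E(G) then Fin.castLE hk' (c ⟨e, he⟩) else 0
  have hc' : ∀ e (he : e ∈ E(G)), c' e = Fin.castLE hk' (c ⟨e, he⟩) := fun e he => dif_pos he
  refine ⟨c', fun e f v hne he hf heq => ?_, ?_⟩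
  · rw [hc' e he.edge_mem, hc' f hf.edge_mem] at heq
    exact hc.proper ⟨e, he.edge_mem⟩ ⟨f, hf.edge_mem⟩ v (fun h => hne (congrArg Subtype.val h))
      he hf (inj heq)
  · rintro e₁ e₂ e₃ e₄ hp ⟨h13, h24⟩
    obtain ⟨v₀, v₁, v₂, v₃, v₄, -, l₁, l₂, l₃, l₄⟩ := id hp
    rw [hc' _ l₁.edge_mem, hc' _ l₃.edge_mem] at h13
    rw [hc' _ l₂.edge_mem, hc' _ l₄.edge_mem] at h24
    refine hc.not_bicolored ⟨e₁, l₁.edge_mem⟩ ⟨e₂, l₂.edge_mem⟩ ⟨e₃, l₃.edge_mem⟩ ⟨e₄, l₄.edge_mem⟩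
      (.inl hp) ⟨c ⟨e₁, l₁.edge_mem⟩, c ⟨e₂, l₂.edge_mem⟩, ?_⟩
    simp [inj h13, inj h24]

/-- The graph on `{0, …, n - 1}` in which each `e ∈ E` is an edge joining `e` to `t e`. -/
def parentGraph (n : ℕ) (E : Finset ℕ) (t : ℕ → ℕ) (h : ∀ e ∈ E, e < n ∧ t e < n) :
    Graph ℕ ℕ where
  vertexSet := {v | v < n}
  IsLink e x y := e ∈ E ∧ ((x = e ∧ y = t e) ∨ (x = t e ∧ y = e))
  isLink_symm _ _ := ⟨fun _ _ => by tauto⟩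
  eq_or_eq_of_isLink_of_isLink e x y v w := by
    rintro ⟨-, ⟨rfl, rfl⟩ | ⟨rfl, rfl⟩⟩ ⟨-, ⟨rfl, rfl⟩ | ⟨rfl, rfl⟩⟩ <;> simp
  left_mem_of_isLink e x y := by
    rintro ⟨he, ⟨rfl, rfl⟩ | ⟨rfl, rfl⟩⟩
    exacts [(h _ he).1, (h _ he).2]

section parentGraph

variable {n : ℕ} {E : Finset ℕ} {t : ℕ → ℕ} {h : ∀ e ∈ E, e < n ∧ t e < n}

lemma parentGraph_isLink {e x y : ℕ} : (parentGraph n E t h).IsLink e x y ↔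
    e ∈ E ∧ ((x = e ∧ y = t e) ∨ (x = t e ∧ y = e)) := Iff.rfl

lemma parentGraph_inc {e x : ℕ} : (parentGraph n E t h).Inc e x ↔
    e ∈ E ∧ (x = e ∨ x = t e) := by
  simp only [Graph.Inc, parentGraph_isLink]
  constructor
  · rintro ⟨y, he, ⟨rfl, rfl⟩ | ⟨rfl, rfl⟩⟩ <;> simp [he]
  · rintro ⟨he, rfl | rfl⟩
    exacts [⟨_, he, .inl ⟨rfl, rfl⟩⟩, ⟨_, he, .inr ⟨rfl, rfl⟩⟩]

lemma edgeSet_parentGraph : E(parentGraph n E t h) = E := by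
  ext e
  constructor
  · intro he
    obtain ⟨x, y, hl⟩ := Graph.exists_isLink_of_mem_edgeSet he
    exact hl.1
  · intro he
    exact Graph.IsLink.edge_mem (parentGraph_isLink.2 ⟨he, .inl ⟨rfl, rfl⟩⟩)

lemma finite_vertexSet_parentGraph : V(parentGraph n E t h).Finite := Set.finite_lt_nat n

lemma ncard_vertexSet_parentGraph : V(parentGraph n E t h).ncard = n := by
  have : V(parentGraph n E t h) = (Finset.range n : Set ℕ) := by
    ext v; simp [parentGraph]
  rw [this, Set.ncard_coe_finset, Finset.card_range]

lemma isSubcubic_parentGraph (ht : ∀ e ∈ E, t e ≠ e)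
    (hd : ∀ v < n, (E.filter fun e => v = e ∨ v = t e).card ≤ 3) :
    IsSubcubic (parentGraph n E t h) where
  finite_vertexSet := finite_vertexSet_parentGraph
  finite_edgeSet := by rw [edgeSet_parentGraph]; exact E.finite_toSet
  loopless := ⟨fun e x hx => by
    rcases hx with ⟨he, ⟨rfl, h2⟩ | ⟨h1, rfl⟩⟩
    exacts [ht _ he h2.symm, ht _ he h1.symm]⟩
  degree_le v hv := by
    have : (parentGraph n E t h).incidenceSet v = (E.filter fun e => v = e ∨ v = t e : Finset ℕ) := by
      ext e; simp [parentGraph_inc]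
    rw [degree, this, Set.ncard_coe_finset]
    exact hd v hv

/-- Each edge is labeled by one of its ends, so no subgraph has more edges than vertices. -/
lemma edgeSet_subset_vertexSet {H : Graph ℕ ℕ} (hH : H ≤ parentGraph n E t h) :
    E(H) ⊆ V(H) := by
  intro e he
  obtain ⟨x, y, hl⟩ := Graph.exists_isLink_of_mem_edgeSet he
  rcases hl.mono hH with ⟨-, ⟨rfl, -⟩ | ⟨-, rfl⟩⟩
  exacts [hl.left_mem, hl.right_mem]

lemma mad_parentGraph_le : mad (parentGraph n E t h) ≤ 2 := by
  refine Real.sSup_le ?_ (by norm_num)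
  rintro d ⟨H, hH, hne, rfl⟩
  have hf := finite_vertexSet_parentGraph.subset hH.vertexSet_mono
  have h1 : (E(H).ncard : ℝ) ≤ V(H).ncard := by
    exact_mod_cast Set.ncard_le_ncard (edgeSet_subset_vertexSet hH) hf
  have h2 : (0 : ℝ) < V(H).ncard := by exact_mod_cast (Set.ncard_pos hf).2 hne
  rw [div_le_iff₀ h2]
  linarith

lemma mad_parentGraph_lt (ht : ∀ e ∈ E, t e < e) : mad (parentGraph n E t h) < 2 := by
  have hn : (0 : ℝ) < n + 1 := by positivity
  -- Strictness for a supremum needs a uniform bound below `2`. The smallest vertex of `H` labels no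
  -- edge of `H`, so the density is at most `2 - 2/|H|`; `n + 1` avoids division by zero.
  have hlt : 2 - 2 / (n + 1 : ℝ) < 2 := by
    have : 0 < 2 / (n + 1 : ℝ) := by positivity
    linarith
  refine lt_of_le_of_lt (Real.sSup_le ?_ ?_) hlt
  · rintro d ⟨H, hH, hne, rfl⟩
    have hf := finite_vertexSet_parentGraph.subset hH.vertexSet_mono
    have hmin : sInf V(H) ∈ V(H) := Nat.sInf_mem hne
    have hsub : E(H) ⊆ V(H) \ {sInf V(H)} := by
      intro e he
      refine ⟨edgeSet_subset_vertexSet hH he, ?_⟩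
      rintro rfl
      obtain ⟨x, y, hl⟩ := Graph.exists_isLink_of_mem_edgeSet he
      rcases hl.mono hH with ⟨h1, ⟨-, h2⟩ | ⟨h2, -⟩⟩
      · have := Nat.sInf_le hl.right_mem
        have := ht _ h1
        omega
      · have := Nat.sInf_le hl.left_mem
        have := ht _ h1
        omega
    have h1 : E(H).ncard + 1 ≤ V(H).ncard := by
      have h1 := Set.ncard_le_ncard hsub hf.sdiff
      have h2 := Set.ncard_sdiff_singleton_add_one hmin hf
      omega
    have h3 : V(H).ncard ≤ n := by
      have := Set.ncard_le_ncard hH.vertexSet_mono finite_vertexSet_parentGraph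
      rwa [ncard_vertexSet_parentGraph] at this
    have h1' : (E(H).ncard : ℝ) + 1 ≤ V(H).ncard := by exact_mod_cast h1
    have h3' : (V(H).ncard : ℝ) ≤ n := by exact_mod_cast h3
    have h2 : (0 : ℝ) < V(H).ncard := by exact_mod_cast (Set.ncard_pos hf).2 hne
    rw [div_le_iff₀ h2]
    have h4 : 2 / (n + 1 : ℝ) * V(H).ncard ≤ 2 := by
      rw [div_mul_eq_mul_div, div_le_iff₀ hn]
      linarith
    linarith
  · rw [sub_nonneg, div_le_iff₀ hn]
    have : (0 : ℝ) ≤ n := by positivity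
    linarith

end parentGraph

/-- The complete binary tree on seven vertices. -/
def binaryTree : Graph ℕ ℕ := parentGraph 7 (Finset.Ico 1 7) (fun e => (e - 1) / 2) (by decide)

lemma isSubcubic_binaryTree : IsSubcubic binaryTree :=
  isSubcubic_parentGraph (by decide) (by decide)

lemma mad_binaryTree_lt : mad binaryTree < 2 := mad_parentGraph_lt (by decide)

lemma starChromaticIndex_binaryTree : starChromaticIndex binaryTree = 4 := by
  refine le_antisymm (isSubcubic_binaryTree.starChromaticIndex_le_four mad_binaryTree_lt) ?_
  by_contra hlt
  obtain ⟨c, hc, hp⟩ := exists_coloring_of_lt (m := 2) (not_le.1 hlt)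
  have adj : ∀ e f v, e ≠ f ∧ (e ∈ Finset.Ico 1 7 ∧ (v = e ∨ v = (e - 1) / 2)) ∧
      (f ∈ Finset.Ico 1 7 ∧ (v = f ∨ v = (f - 1) / 2)) → c e ≠ c f := fun e f v h =>
    hc e f v h.1 (parentGraph_inc.2 h.2.1) (parentGraph_inc.2 h.2.2)
  have path : ∀ a b, (a = 3 ∨ a = 4) → (b = 5 ∨ b = 6) → ¬ (c a = c 2 ∧ c 1 = c b) := by
    intro a b ha hb
    refine hp a 1 2 b ⟨a, 1, 0, 2, b, ?_, ?_, ?_, ?_, ?_⟩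
    · rcases ha with rfl | rfl <;> rcases hb with rfl | rfl <;> decide
    · rcases ha with rfl | rfl <;> exact parentGraph_isLink.2 (by decide)
    · exact parentGraph_isLink.2 (by decide)
    · exact parentGraph_isLink.2 (by decide)
    · rcases hb with rfl | rfl <;> exact parentGraph_isLink.2 (by decide)
  -- With three colors, both other colors occur below each of the edges `1` and `2` at the root. So
  -- each of these two colors recurs below the other edge, giving a bicolored path.
  have key : ∀ a b : Fin 3, a ≠ b → ∀ x y, x ≠ y → x ≠ a → y ≠ a → (x = b ∨ y = b) := by decide
  have h12 := adj 1 2 0 (by decide)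
  have h1 := key _ _ h12 (c 3) (c 4) (adj 3 4 1 (by decide)) (adj 3 1 1 (by decide))
    (adj 4 1 1 (by decide))
  have h2 := key _ _ h12.symm (c 5) (c 6) (adj 5 6 2 (by decide)) (adj 5 2 2 (by decide))
    (adj 6 2 2 (by decide))
  have := path 3 5 (by simp) (by simp)
  have := path 3 6 (by simp) (by simp)
  have := path 4 5 (by simp) (by simp)
  have := path 4 6 (by simp) (by simp)
  grind

/-- The cycle of length five with a pendant edge at every vertex. -/
def sunGraph : Graph ℕ ℕ :=
  parentGraph 10 (Finset.range 10) (fun e => if e < 5 then (e + 1) % 5 else e - 5) (by decide)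

lemma isSubcubic_sunGraph : IsSubcubic sunGraph := isSubcubic_parentGraph (by decide) (by decide)

lemma simple_sunGraph : sunGraph.Simple where
  not_isLoopAt := isSubcubic_sunGraph.loopless.not_isLoopAt
  eq_of_isLink e f x y he hf := by
    obtain ⟨he', h1⟩ := parentGraph_isLink.1 he
    obtain ⟨hf', h2⟩ := parentGraph_isLink.1 hf
    rw [Finset.mem_range] at he' hf'
    grind

lemma mad_sunGraph : mad sunGraph = 2 := by
  refine le_antisymm mad_parentGraph_le ?_
  have h := le_mad isSubcubic_sunGraph.finite_vertexSet isSubcubic_sunGraph.finite_edgeSet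
    le_rfl ⟨0, show 0 < 10 by norm_num⟩
  have hE : E(sunGraph).ncard = 10 := by
    rw [sunGraph, edgeSet_parentGraph, Set.ncard_coe_finset]; rfl
  have hV : V(sunGraph).ncard = 10 := ncard_vertexSet_parentGraph
  rw [hE, hV] at h
  norm_num at h
  exact h

set_option synthInstance.maxSize 1000 in
set_option synthInstance.maxHeartbeats 200000 in
/-- Four colors do not suffice for the cycle edges `aᵢ` and the pendant edges `pᵢ`. -/
lemma not_four_colorable_sun :
    ∀ a0 : Fin 4,
    ∀ a1 : Fin 4, a0 ≠ a1 →
    ∀ a2 : Fin 4, a1 ≠ a2 →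
    ∀ a3 : Fin 4, ¬ (a0 = a2 ∧ a1 = a3) → a2 ≠ a3 →
    ∀ a4 : Fin 4, ¬ (a1 = a3 ∧ a2 = a4) → ¬ (a2 = a4 ∧ a3 = a0) → a3 ≠ a4 → ¬ (a3 = a0 ∧ a4 =
    a1) → a4 ≠ a0 → ¬ (a4 = a1 ∧ a0 = a2) →
    ∀ p0 : Fin 4, p0 ≠ a0 → p0 ≠ a4 → ¬ (p0 = a1 ∧ a0 = a2) → ¬ (p0 = a3 ∧ a4 = a2) →
    ∀ p1 : Fin 4, p1 ≠ a1 → p1 ≠ a0 → ¬ (p1 = a2 ∧ a1 = a3) → ¬ (p1 = a4 ∧ a0 = a3) →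
    ∀ p2 : Fin 4, ¬ (p0 = a1 ∧ a0 = p2) → p2 ≠ a2 → p2 ≠ a1 → ¬ (p2 = a3 ∧ a2 = a4) → ¬ (p2 = a0
    ∧ a1 = a4) →
    ∀ p3 : Fin 4, ¬ (p1 = a2 ∧ a1 = p3) → p3 ≠ a3 → p3 ≠ a2 → ¬ (p3 = a4 ∧ a3 = a0) → ¬ (p3 = a1
    ∧ a2 = a0) → ¬ (p3 = a4 ∧ a3 = p0) →
    ∀ p4 : Fin 4, ¬ (p2 = a3 ∧ a2 = p4) → p4 ≠ a4 → p4 ≠ a3 → ¬ (p4 = a0 ∧ a4 = a1) → ¬ (p4 = a2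
    ∧ a3 = a1) → ¬ (p4 = a0 ∧ a4 = p1) → False := by
  -- Each constraint stands as soon as its variables are quantified, so a failing partial coloring
  -- is cut off early.
  decide +kernel

lemma starChromaticIndex_sunGraph : starChromaticIndex sunGraph = 5 := by
  refine le_antisymm (isSubcubic_sunGraph.starChromaticIndex_le_five
    (mad_sunGraph.trans_lt (by norm_num))) ?_
  by_contra hlt
  obtain ⟨c, hc, hp⟩ := exists_coloring_of_lt (m := 3) (not_le.1 hlt)
  set t : ℕ → ℕ := fun e => if e < 5 then (e + 1) % 5 else e - 5 with ht
  have adj : ∀ e f v, e ≠ f ∧ (e ∈ Finset.range 10 ∧ (v = e ∨ v = t e)) ∧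
      (f ∈ Finset.range 10 ∧ (v = f ∨ v = t f)) → c e ≠ c f := fun e f v h =>
    hc e f v h.1 (parentGraph_inc.2 h.2.1) (parentGraph_inc.2 h.2.2)
  have link : ∀ e x y, e ∈ Finset.range 10 ∧ ((x = e ∧ y = t e) ∨ (x = t e ∧ y = e)) →
      sunGraph.IsLink e x y := fun e x y h => parentGraph_isLink.2 h
  have path : ∀ e₁ e₂ e₃ e₄ v₀ v₁ v₂ v₃ v₄, [v₀, v₁, v₂, v₃, v₄].Nodup ∧
      (e₁ ∈ Finset.range 10 ∧ ((v₀ = e₁ ∧ v₁ = t e₁) ∨ (v₀ = t e₁ ∧ v₁ = e₁))) ∧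
      (e₂ ∈ Finset.range 10 ∧ ((v₁ = e₂ ∧ v₂ = t e₂) ∨ (v₁ = t e₂ ∧ v₂ = e₂))) ∧
      (e₃ ∈ Finset.range 10 ∧ ((v₂ = e₃ ∧ v₃ = t e₃) ∨ (v₂ = t e₃ ∧ v₃ = e₃))) ∧
      (e₄ ∈ Finset.range 10 ∧ ((v₃ = e₄ ∧ v₄ = t e₄) ∨ (v₃ = t e₄ ∧ v₄ = e₄))) →
      ¬ (c e₁ = c e₃ ∧ c e₂ = c e₄) := fun e₁ e₂ e₃ e₄ v₀ v₁ v₂ v₃ v₄ h =>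
    hp e₁ e₂ e₃ e₄ ⟨v₀, v₁, v₂, v₃, v₄, h.1, link _ _ _ h.2.1, link _ _ _ h.2.2.1,
      link _ _ _ h.2.2.2.1, link _ _ _ h.2.2.2.2⟩
  exact not_four_colorable_sun
    (c 0) (c 1) (adj 0 1 1 (by decide)) (c 2) (adj 1 2 2 (by decide)) (c 3)
    (path 0 1 2 3 0 1 2 3 4 (by decide)) (adj 2 3 3 (by decide)) (c 4)
    (path 1 2 3 4 1 2 3 4 0 (by decide)) (path 2 3 4 0 2 3 4 0 1 (by decide))
    (adj 3 4 4 (by decide)) (path 3 4 0 1 3 4 0 1 2 (by decide)) (adj 4 0 0 (by decide))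
    (path 4 0 1 2 4 0 1 2 3 (by decide)) (c 5) (adj 5 0 0 (by decide)) (adj 5 4 0 (by decide))
    (path 5 0 1 2 5 0 1 2 3 (by decide)) (path 5 4 3 2 5 0 4 3 2 (by decide)) (c 6)
    (adj 6 1 1 (by decide)) (adj 6 0 1 (by decide)) (path 6 1 2 3 6 1 2 3 4 (by decide))
    (path 6 0 4 3 6 1 0 4 3 (by decide)) (c 7) (path 5 0 1 7 5 0 1 2 7 (by decide))
    (adj 7 2 2 (by decide)) (adj 7 1 2 (by decide)) (path 7 2 3 4 7 2 3 4 0 (by decide))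
    (path 7 1 0 4 7 2 1 0 4 (by decide)) (c 8) (path 6 1 2 8 6 1 2 3 8 (by decide))
    (adj 8 3 3 (by decide)) (adj 8 2 3 (by decide)) (path 8 3 4 0 8 3 4 0 1 (by decide))
    (path 8 2 1 0 8 3 2 1 0 (by decide)) (path 8 3 4 5 8 3 4 0 5 (by decide)) (c 9)
    (path 7 2 3 9 7 2 3 4 9 (by decide)) (adj 9 4 4 (by decide)) (adj 9 3 4 (by decide))
    (path 9 4 0 1 9 4 0 1 2 (by decide)) (path 9 3 2 1 9 4 3 2 1 (by decide))
    (path 9 4 0 6 9 4 0 1 6 (by decide))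

end
end StarEdge

theorem mainTheorem1 :
    (∀ {α β : Type*} (G : Graph α β), StarEdge.IsSubcubic G →
      (StarEdge.mad G < 2 → StarEdge.starChromaticIndex G ≤ 4) ∧
      (StarEdge.mad G < 24 / 11 → StarEdge.starChromaticIndex G ≤ 5) ∧
      (StarEdge.mad G < 5 / 2 → StarEdge.starChromaticIndex G ≤ 6)) ∧
    (∃ G : Graph ℕ ℕ, StarEdge.IsSubcubic G ∧
      StarEdge.mad G < 2 ∧ StarEdge.starChromaticIndex G = 4) ∧
    (∃ G : Graph ℕ ℕ, StarEdge.IsSubcubic G ∧ G.Simple ∧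
      StarEdge.mad G = 2 ∧ StarEdge.starChromaticIndex G = 5) :=
  ⟨fun _ hG => ⟨hG.starChromaticIndex_le_four, hG.starChromaticIndex_le_five,
    hG.starChromaticIndex_le_six⟩,
    ⟨StarEdge.binaryTree, StarEdge.isSubcubic_binaryTree, StarEdge.mad_binaryTree_lt,
      StarEdge.starChromaticIndex_binaryTree⟩,
    ⟨StarEdge.sunGraph, StarEdge.isSubcubic_sunGraph, StarEdge.simple_sunGraph,
      StarEdge.mad_sunGraph, StarEdge.starChromaticIndex_sunGraph⟩⟩
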